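/- **Definitions.** A *thick planar Lie group* is a topological group $\mathbb G$ with a continuous homomorphism $p:\mathbb G\to GL(2,\mathbb R)$ that is a covering of a union of connected components of $GL(2,\mathbb R)$ and for which $p^{-1}(GL^+(2,\mathbb R))$ is connected. Put $G_0=p^{-1}(\{\mathrm{diag}(1,\pm1)\})$, with its parity $G_0\to\{\pm1\}$, and let $\kappa\in\ker p$ be the endpoint of the lift, starting at $1$, of the loop of rotations by $2\pi t$, $t\in[0,1]$. The associated crossed simplicial group $\Delta G$ is the category with objects $[n]$, $n\ge 0$, in which a morphism $[m]\to[n]$ is a class of pairs $(F,x)$, where $x\in G_0$ has parity $\varepsilon$ and $F:\mathbb Z\to\mathbb Z$ is non-decreasing if $\varepsilon=1$, non-increasing if $\varepsilon=-1$, with $F(l+m+1)=F(l)+\varepsilon(n+1)$; the pairs $(F+j(n+1),x)$ and $(F,\kappa^jx)$, $j\in\mathbb Z$, are identified, and pairs are composed componentwise. It contains the simplex category $\Delta$ (extend monotone maps periodically, with $x=1$), and $F\mapsto F \bmod (n+1)$ gives a functor $[n]\mapsto\{0,\dots,n\}$ to sets. (These are the cyclic, dihedral, paracyclic, paradihedral,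 $N$-cyclic, $N$-dihedral and $N$-quaternionic categories.) A *$\Delta G$-structured set* is a set $I$ with $n+1$ elements, $n\ge0$, a right $\mathrm{Aut}_{\Delta G}([n])$-torsor $\mathcal O(I)$ (of *structured frames*) and a map from $\mathcal O(I)$ to the bijections $\{0,\dots,n\}\to I$, equivariant along $\mathrm{Aut}_{\Delta G}([n])\to S_{n+1}$. A morphism $\psi:I'\to I$ is a family of morphisms $\psi_{f,f'}:[n']\to[n]$ of $\Delta G$, $f\in\mathcal O(I)$, $f'\in\mathcal O(I')$, with $\psi_{fg,f'g'}=g^{-1}\psi_{f,f'}g'$; composition is $(\psi\psi')_{f,f''}=\psi_{f,f'}\psi'_{f',f''}$. A *graph* $\Gamma$ consists of sets $H$ (half-edges) and $V$ (vertices), an involution $\tau$ of $H$ without fixed points and a map $s:H\to V$; put $H(v)=s^{-1}(v)$. Its edges are the sets $\{h,\tau h\}$. Its *incidence category* $I(\Gamma)$ has the vertices and edges as objects, and one non-identity morphism $s(h)\to\{h,\tau h\}$ for each $h\in H$. Its *incidence diagram* $I_\Gamma:I(\Gamma)\to\mathrm{Set}$ sends $v$ to $H(v)$, $\{h,\tau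 h\}$ to $\{h,\tau h\}$, and the morphism of $h$ to the map that takes $h$ to $\tau h$ and every other element of $H(s(h))$ to $h$. A *$\Delta G$-structure* on $\Gamma$ is a lift of $I_\Gamma$ to a functor from $I(\Gamma)$ to $\Delta G$-structured sets. The realization $|\Gamma|$ is the geometric realization of $I(\Gamma)$; it has a segment from $s(h)$ to the midpoint of $\{h,\tau h\}$ for each $h\in H$. A *surface* $S$ is a connected $C^\infty$ surface, possibly with boundary. A *$\mathbb G$-structure* on $S$ is a principal $\mathbb G$-bundle $F\to S$ with a $p$-equivariant continuous map $\rho:F\to\mathrm{Fr}_S$ over $S$ to the bundle of frames of the tangent bundle. An *embedding* of $\Gamma$ in $S$ is an injective continuous map $\gamma:|\Gamma|\to S$ that sends the $1$-valent vertices to $\partial S$ and all other points to the interior, is a regular $C^\infty$ curve (nowhere vanishing velocity) on each segment, and for which the tangent directions of the segments leaving any given vertex or any given midpoint are distinct. **Statement.** Let $\mathbb G$ be a thick planar Lie group, $S$ a surface with a $\mathbb G$-structure, $\Gamma$ a graph all of whose vertices have finite nonzero valency, and $\gamma$ an embedding of $\Gamma$ in $S$. Then $\gamma$ induces a canonical $\Delta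 G$-structure on $\Gamma$. That is, there is a lift $\widetilde I_\Gamma$ of $I_\Gamma$ to $\Delta G$-structured sets with the following properties. 1. For a vertex or edge $X$ with half-edge set $I=I_\Gamma(X)$, viewed as a set of tangent directions at $\gamma(X)$, the set $\mathcal O(I)$ is identified with $\pi_0$ of the space of those $f\in F_{\gamma(X)}$ for which the first vector of the frame $\rho(f)$ has its direction in $I$. This direction is the element of $I$ numbered $0$ by $f$. The class of $(l\mapsto\varepsilon l,x)$, $x\in G_0$ of parity $\varepsilon$, acts by $f\mapsto fx$; the class of $(l\mapsto l+1,1)$ acts by turning $f$, in the sense from its first vector to its second one, until the first vector next has its direction in $I$. 2. Let $h\in H$, $v=s(h)$, $e=\{h,\tau h\}$, and let $f$ be a structured frame at $v$ whose first vector points along $h$. Transport $f$ along $\gamma$ from $v$ to the midpoint of $e$ so that its first vector points along the velocity, and then move its first vector at the midpoint to the direction of $\tau h$ without crossing the direction of $h$; let $f'$ be the resulting structured frame of $e$. Then the morphism $\psi=\widetilde I_\Gamma(v\to e)$ has $\psi_{f',f}$ equal to the morphism $[n]\to[1]$, $0\mapsto0$, $i\mapsto1$ $(i>0)$, of $\Delta$,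 where $n+1=|H(v)|$. Such a lift is unique up to a unique natural isomorphism that lies over the identity of $I_\Gamma$ and respects the identifications in 1. -/

import Mathlib

open CategoryTheory Topology
open scoped Manifold ContDiff

namespace PlanarGraph

noncomputable section


universe a b c d e

/-! ### Thick planar Lie groups -/

/-- A homomorphism of topological groups is a connective covering if it is a covering of a union of
connected components of the target (fibres over the other components are empty) and the preimage
of the identity component is connected. -/
structure IsConnectiveCovering {A : Type a} {B : Type b} [Group A] [TopologicalSpace A]
    [Group B] [TopologicalSpace B] (p : A →* B) : Prop where
  isCoveringMap : IsCoveringMap p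
  isConnected_preimage : IsConnected (p ⁻¹' connectedComponent (1 : B))

/-- The rotation by the angle `θ`. -/
def rotation (θ : ℝ) : GL (Fin 2) ℝ where
  val := !![Real.cos θ, -Real.sin θ; Real.sin θ, Real.cos θ]
  inv := !![Real.cos θ, Real.sin θ; -Real.sin θ, Real.cos θ]
  val_inv := by
    ext i j
    fin_cases i <;> fin_cases j <;> simp [Matrix.mul_apply, Fin.sum_univ_two] <;>
      nlinarith [Real.sin_sq_add_cos_sq θ]
  inv_val := by
    ext i j
    fin_cases i <;> fin_cases j <;> simp [Matrix.mul_apply, Fin.sum_univ_two] <;>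
      nlinarith [Real.sin_sq_add_cos_sq θ]

/-- The subgroup `O(1) = {diag(1, 1), diag(1, -1)}` of `GL(2, ℝ)`. -/
def reflection : ℤˣ →* GL (Fin 2) ℝ where
  toFun ε :=
    { val := !![1, 0; 0, ((ε : ℤ) : ℝ)]
      inv := !![1, 0; 0, ((ε : ℤ) : ℝ)]
      val_inv := by
        rcases Int.units_eq_one_or ε with rfl | rfl <;>
          (ext i j; fin_cases i <;> fin_cases j <;> simp [Matrix.mul_apply, Fin.sum_univ_two])
      inv_val := by
        rcases Int.units_eq_one_or ε with rfl | rfl <;>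
          (ext i j; fin_cases i <;> fin_cases j <;> simp [Matrix.mul_apply, Fin.sum_univ_two]) }
  map_one' := by
    ext i j; fin_cases i <;> fin_cases j <;> simp
  map_mul' x y := by
    ext i j; fin_cases i <;> fin_cases j <;> simp [Matrix.mul_apply, Fin.sum_univ_two]

theorem rotation_zero : rotation 0 = 1 := by
  ext i j; fin_cases i <;> fin_cases j <;> simp [rotation]

theorem rotation_add (x y : ℝ) : rotation (x + y) = rotation x * rotation y := by
  ext i j
  fin_cases i <;> fin_cases j <;>
    simp [rotation, Matrix.mul_apply, Fin.sum_univ_two, Real.cos_add, Real.sin_add] <;> ring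

theorem reflection_mul_rotation (ε : ℤˣ) (x : ℝ) :
    reflection ε * rotation x = rotation (((ε : ℤ) : ℝ) * x) * reflection ε := by
  rcases Int.units_eq_one_or ε with rfl | rfl <;>
    (ext i j
     fin_cases i <;> fin_cases j <;>
      simp [rotation, reflection, Matrix.mul_apply, Fin.sum_univ_two])

/-! ### The crossed simplicial group of a thick planar Lie group

For `p : 𝔾 → GL(2, ℝ)` put `G₀ = p⁻¹(O(1))`, with its parity `G₀ → O(1) = {±1}`. A morphism
`[m] → [n]` of `ΔG` is represented by a morphism `F : ℤ → ℤ` of the paradihedral category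
(a monotone or antitone map with `F(l + m + 1) = F(l) ± (n + 1)`) and an element of `G₀` of the
same parity. A full turn on `[n]` is identified with its image in `G₀`, namely the endpoint of the
lift to `𝔾` of the loop of rotations. For the coverings of `SO(2)` and `O(2)` one finds the
(`N`-)cyclic, paracyclic, (`N`-)dihedral, paradihedral and (`N`-)quaternionic categories, and
`Aut([n])` is the preimage of the dihedral group of order `2(n + 1)`. -/

section DeltaG

variable {𝔾 : Type a} [Group 𝔾] [TopologicalSpace 𝔾]

/-- Representatives of morphisms `[m] → [n]`. -/
@[ext]
structure PreHom (p : 𝔾 →* GL (Fin 2) ℝ) (m n : ℕ) where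
  /-- the parity -/
  sign : ℤˣ
  /-- the periodic map -/
  toFun : ℤ → ℤ
  monotone : Monotone fun l => (sign : ℤ) * toFun l
  periodic : ∀ l, toFun (l + (m + 1)) = toFun l + sign * (n + 1)
  /-- the element of `G₀` -/
  elt : 𝔾
  map_elt : p elt = reflection sign

namespace PreHom

variable {p : 𝔾 →* GL (Fin 2) ℝ} {m n k : ℕ}

theorem periodic_mul (u : PreHom p m n) (l j : ℤ) :
    u.toFun (l + j * (m + 1)) = u.toFun l + u.sign * j * (n + 1) := by
  induction j using Int.induction_on with
  | zero => simp
  | succ i ih =>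
    have h := u.periodic (l + i * (m + 1))
    rw [ih] at h
    rw [show l + ((i : ℤ) + 1) * (m + 1) = l + i * (m + 1) + (m + 1) by ring, h]; ring
  | pred i ih =>
    have h := u.periodic (l + (-(i : ℤ) - 1) * (m + 1))
    rw [show l + (-(i : ℤ) - 1) * (m + 1) + (m + 1) = l + -(i : ℤ) * (m + 1) by ring, ih] at h
    linear_combination -h

/-- The identity of `[n]`. -/
protected def id (p : 𝔾 →* GL (Fin 2) ℝ) (n : ℕ) : PreHom p n n where
  sign := 1
  toFun l := l
  monotone := by intro x y h; simpa using h
  periodic l := by simp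
  elt := 1
  map_elt := by simp

/-- `u.comp v` is `v` followed by `u`. -/
def comp (u : PreHom p n k) (v : PreHom p m n) : PreHom p m k where
  sign := u.sign * v.sign
  toFun l := u.toFun (v.toFun l)
  monotone := by
    intro x y h
    have h1 := v.monotone h
    have hu : ∀ s t : ℤ, s ≤ t → (u.sign : ℤ) * u.toFun s ≤ u.sign * u.toFun t :=
      fun s t hst => u.monotone hst
    rcases Int.units_eq_one_or v.sign with hv | hv
    · simp only [hv, Units.val_one, one_mul, mul_one] at h1 ⊢
      exact hu _ _ h1
    · simp only [hv, Units.val_neg, Units.val_one, mul_neg, mul_one, neg_mul, one_mul,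
        neg_le_neg_iff] at h1 ⊢
      exact hu _ _ h1
  periodic l := by
    rw [v.periodic, u.periodic_mul]; push_cast; ring
  elt := u.elt * v.elt
  map_elt := by rw [map_mul, u.map_elt, v.map_elt, map_mul]

/-- `(F + j (n + 1), γ)` is identified with `(F, γ')` if `γ'` is the endpoint of the lift, starting
at `γ`, of the path of `j` full turns. -/
def Rel (u u' : PreHom p m n) : Prop :=
  ∃ j : ℤ, (∀ l, u'.toFun l = u.toFun l + j * (n + 1)) ∧
    ∃ c : unitInterval → 𝔾, Continuous c ∧ c 0 = u'.elt ∧ c 1 = u.elt ∧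
      ∀ t, p (c t) = rotation (2 * Real.pi * j * t) * p u'.elt

theorem Rel.sign_eq {u u' : PreHom p m n} (h : Rel u u') : u.sign = u'.sign := by
  obtain ⟨j, hj, -⟩ := h
  have h1 := u.periodic 0
  have h2 := u'.periodic 0
  rw [hj, hj, h1] at h2
  have h3 : ((u.sign : ℤ) - u'.sign) * (n + 1) = 0 := by linear_combination h2
  rcases mul_eq_zero.mp h3 with h4 | h4
  · exact Units.ext (by omega)
  · omega

variable [IsTopologicalGroup 𝔾]

theorem Rel.refl (u : PreHom p m n) : Rel u u :=
  ⟨0, by simp, fun _ => u.elt, continuous_const, rfl, rfl, by simp [rotation_zero]⟩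

theorem Rel.symm {u u' : PreHom p m n} (h : Rel u u') : Rel u' u := by
  have hs := h.sign_eq
  obtain ⟨j, hj, c, hc, h0, h1, hp⟩ := h
  refine ⟨-j, fun l => by rw [hj]; ring, fun t => c (unitInterval.symm t),
    hc.comp unitInterval.continuous_symm, by simpa using h1, by simpa using h0, fun t => ?_⟩
  rw [hp, u.map_elt, u'.map_elt, hs]
  have h2 : p (c 1) = rotation (2 * Real.pi * j * (1 : unitInterval)) * p u'.elt := hp 1
  rw [h1, u.map_elt, u'.map_elt, hs] at h2
  have h3 : rotation (2 * Real.pi * j) = 1 := by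
    simpa using h2
  rw [unitInterval.coe_symm_eq,
    show 2 * Real.pi * j * (1 - (t : ℝ)) = 2 * Real.pi * ((-j : ℤ) : ℝ) * t + 2 * Real.pi * j by
      push_cast; ring, rotation_add, h3, mul_one]

theorem Rel.trans {u u' u'' : PreHom p m n} (h : Rel u u') (h' : Rel u' u'') : Rel u u'' := by
  have hs' := h'.sign_eq
  obtain ⟨j, hj, c, hc, h0, h1, hp⟩ := h
  obtain ⟨j', hj', c', hc', h0', h1', hp'⟩ := h'
  refine ⟨j + j', fun l => by rw [hj', hj]; ring, fun t => c t * (u'.elt)⁻¹ * c' t,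
    by fun_prop, by simp [h0, h0'], by simp [h1, h1'], fun t => ?_⟩
  simp only [map_mul, map_inv, hp, hp', mul_inv_cancel_right]
  rw [← mul_assoc, ← rotation_add]
  congr 2
  push_cast; ring

/-- Morphisms `[m] → [n]` are classes of representatives. -/
def setoid (p : 𝔾 →* GL (Fin 2) ℝ) (m n : ℕ) : Setoid (PreHom p m n) where
  r := Rel
  iseqv := ⟨Rel.refl, Rel.symm, Rel.trans⟩

theorem Rel.comp {u u' : PreHom p n k} {v v' : PreHom p m n} (h : Rel u u') (h' : Rel v v') :
    Rel (u.comp v) (u'.comp v') := by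
  obtain ⟨j, hj, c, hc, h0, h1, hp⟩ := h
  obtain ⟨j', hj', c', hc', h0', h1', hp'⟩ := h'
  refine ⟨j + u'.sign * j', fun l => ?_, fun t => c t * c' t, by fun_prop,
    by simp [h0, h0', PreHom.comp], by simp [h1, h1', PreHom.comp], fun t => ?_⟩
  · simp only [PreHom.comp]
    rw [hj', u'.periodic_mul, hj]; ring
  · simp only [PreHom.comp, map_mul, hp, hp', u'.map_elt]
    have h2 : 2 * Real.pi * ((j + u'.sign * j' : ℤ) : ℝ) * t =
        2 * Real.pi * j * t + ((u'.sign : ℤ) : ℝ) * (2 * Real.pi * j' * t) := by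
      push_cast; ring
    rw [h2, rotation_add]
    simp only [mul_assoc]
    rw [← mul_assoc (reflection _), reflection_mul_rotation]
    simp only [mul_assoc]

end PreHom

variable [IsTopologicalGroup 𝔾]

/-- The objects `[n]`, `n ≥ 0`, of the crossed simplicial group `ΔG`. -/
@[ext]
structure DeltaG (p : 𝔾 →* GL (Fin 2) ℝ) where
  /-- the number `n` in `[n]` -/
  len : ℕ

namespace DeltaG

variable {p : 𝔾 →* GL (Fin 2) ℝ}

instance : Category (DeltaG p) where
  Hom X Y := Quotient (PreHom.setoid p X.len Y.len)
  id X := Quotient.mk _ (PreHom.id p X.len)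
  comp v u := Quotient.map₂ (fun v u => PreHom.comp u v)
    (fun _ _ h _ _ h' => PreHom.Rel.comp h' h) v u
  id_comp u := by
    induction u using Quotient.inductionOn with
    | h u => simp [PreHom.comp, PreHom.id]
  comp_id u := by
    induction u using Quotient.inductionOn with
    | h u => simp [PreHom.comp, PreHom.id]
  assoc u v w := by
    induction u using Quotient.inductionOn
    induction v using Quotient.inductionOn
    induction w using Quotient.inductionOn
    simp [PreHom.comp, mul_assoc]

/-- The morphism with a given representative. -/
def homMk {X Y : DeltaG p} (u : PreHom p X.len Y.len) : X ⟶ Y :=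
  Quotient.mk (PreHom.setoid p X.len Y.len) u

/-- The vertex of `[n]` given by an integer modulo `n + 1`. -/
def vertex (n : ℕ) (l : ℤ) : Fin (n + 1) :=
  ⟨(l % (n + 1)).toNat, by
    have h1 := Int.emod_nonneg l (show ((n : ℤ) + 1) ≠ 0 by omega)
    have h2 := Int.emod_lt_of_pos l (show 0 < ((n : ℤ) + 1) by omega)
    omega⟩

theorem vertex_add_mul (n : ℕ) (l j : ℤ) : vertex n (l + j * (n + 1)) = vertex n l := by
  simp [vertex]

theorem vertex_coe (n : ℕ) (i : Fin (n + 1)) : vertex n (i : ℕ) = i := by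
  ext
  have h := i.isLt
  simp only [vertex]
  rw [Int.emod_eq_of_lt (by omega) (by omega)]
  simp

theorem toFun_vertex {m n : ℕ} (u : PreHom p m n) (l : ℤ) :
    vertex n (u.toFun (vertex m l : ℕ)) = vertex n (u.toFun l) := by
  have h1 := Int.emod_nonneg l (show ((m : ℤ) + 1) ≠ 0 by omega)
  have h2 : (((vertex m l : Fin (m + 1)) : ℕ) : ℤ) = l % (m + 1) := by
    simp only [vertex]; omega
  have h3 : l = l % (m + 1) + (l / (m + 1)) * (m + 1) := by
    have := Int.emod_add_mul_ediv l (m + 1)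
    linear_combination -this
  rw [h2]
  conv_rhs => rw [h3, u.periodic_mul, vertex_add_mul]

/-- The functor `λ : ΔG → Set`, `[n] ↦ {0, …, n}`, on morphisms. -/
def vertexMap {X Y : DeltaG p} (u : X ⟶ Y) (i : Fin (X.len + 1)) : Fin (Y.len + 1) :=
  Quotient.liftOn u (fun w => vertex Y.len (w.toFun (i : ℕ))) (by
    rintro w w' ⟨j, hj, -⟩
    simp only [hj, vertex_add_mul])

theorem vertexMap_id (X : DeltaG p) (i) : vertexMap (𝟙 X) i = i := vertex_coe _ _

theorem vertexMap_comp {X Y Z : DeltaG p} (u : X ⟶ Y) (w : Y ⟶ Z) (i) :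
    vertexMap (u ≫ w) i = vertexMap w (vertexMap u i) := by
  induction u using Quotient.inductionOn with | h u => ?_
  induction w using Quotient.inductionOn with | h w => ?_
  exact (toFun_vertex w _).symm

/-- The periodic extension of a monotone map `[m] → [n]`. -/
def ofMonotone (p : 𝔾 →* GL (Fin 2) ℝ) {m n : ℕ} (φ : Fin (m + 1) →o Fin (n + 1)) :
    PreHom p m n where
  sign := 1
  toFun l := (φ (vertex m l) : ℕ) + (l / (m + 1)) * (n + 1)
  monotone := by
    intro x y h
    simp only [Units.val_one, one_mul]
    have hm : (0 : ℤ) < m + 1 := by omega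
    have hx := (φ (vertex m x)).isLt
    rcases (Int.ediv_le_ediv hm h).eq_or_lt with hq | hq
    · have hv : vertex m x ≤ vertex m y := by
        have e1 := Int.emod_add_mul_ediv x (m + 1)
        have e2 := Int.emod_add_mul_ediv y (m + 1)
        rw [hq] at e1
        have : x % (m + 1) ≤ y % (m + 1) := by linarith
        rw [Fin.le_def]
        simp only [vertex]
        omega
      have h2 : ((φ (vertex m x) : ℕ) : ℤ) ≤ (φ (vertex m y) : ℕ) := by
        exact_mod_cast φ.monotone hv
      rw [hq]; linarith
    · have h3 : (x / (m + 1) + 1) * ((n : ℤ) + 1) ≤ y / (m + 1) * (n + 1) :=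
        mul_le_mul_of_nonneg_right hq (by omega)
      have h4 : (0 : ℤ) ≤ (φ (vertex m y) : ℕ) := by positivity
      have h5 : ((φ (vertex m x) : ℕ) : ℤ) < n + 1 := by exact_mod_cast hx
      linarith
  periodic l := by
    have h := vertex_add_mul m l 1
    rw [one_mul] at h
    have h2 : (l + (m + 1)) / ((m : ℤ) + 1) = l / (m + 1) + 1 :=
      Int.add_ediv_of_dvd_right (dvd_refl _) |>.trans (by rw [Int.ediv_self (by omega)])
    rw [h, h2]; push_cast; ring
  elt := 1
  map_elt := by simp

/-- The embedding `Δ → ΔG`. -/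
def simplexInclusion (p : 𝔾 →* GL (Fin 2) ℝ) : SimplexCategory ⥤ DeltaG p where
  obj X := ⟨X.len⟩
  map φ := homMk (ofMonotone p φ.toOrderHom)
  map_id X := by
    refine congrArg (Quotient.mk _) (PreHom.ext rfl ?_ rfl)
    funext l
    simp only [ofMonotone, PreHom.id]
    have h1 := Int.emod_nonneg l (show ((X.len : ℤ) + 1) ≠ 0 by omega)
    have h2 := Int.emod_add_mul_ediv l (X.len + 1)
    simp only [SimplexCategory.id_toOrderHom, OrderHom.id_coe, id_eq, vertex,
      Int.toNat_of_nonneg h1]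
    linarith
  map_comp {X Y Z} φ ψ := by
    refine congrArg (Quotient.mk _) (PreHom.ext (mul_one _).symm ?_ (mul_one _).symm)
    funext l
    simp only [ofMonotone, PreHom.comp]
    set i := φ.toOrderHom (vertex X.len l) with hi
    have hlt : ((i : ℕ) : ℤ) < Y.len + 1 := by exact_mod_cast i.isLt
    rw [vertex_add_mul, vertex_coe, Int.add_mul_ediv_right _ _ (by omega),
      Int.ediv_eq_zero_of_lt (by omega) hlt, zero_add]
    rfl

/-- The morphism `[m] → [n]` of `Δ` that fixes `0` and sends all other elements to `n`. -/
def collapse (p : 𝔾 →* GL (Fin 2) ℝ) (m n : ℕ) : (⟨m⟩ : DeltaG p) ⟶ ⟨n⟩ :=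
  (simplexInclusion p).map (X := SimplexCategory.mk m) (Y := SimplexCategory.mk n)
    (SimplexCategory.mkHom
    { toFun := fun i => if i = 0 then 0 else Fin.last n
      monotone' := by
        intro i j h
        by_cases hi : i = 0
        · simp [hi]
        · have hj : j ≠ 0 := fun hj => hi (le_antisymm (hj ▸ h) (Fin.zero_le _))
          simp [hi, hj] })

/-- The automorphism `l ↦ l + 1` of `[n]`. -/
def rotate (p : 𝔾 →* GL (Fin 2) ℝ) (n : ℕ) : (⟨n⟩ : DeltaG p) ≅ ⟨n⟩ where
  hom := homMk
    { PreHom.id p n with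
      toFun := fun l => l + 1
      monotone := by intro x y h; simpa [PreHom.id] using h
      periodic := by intro l; simp only [PreHom.id]; push_cast; ring }
  inv := homMk
    { PreHom.id p n with
      toFun := fun l => l - 1
      monotone := by intro x y h; simpa [PreHom.id] using h
      periodic := by intro l; simp only [PreHom.id]; push_cast; ring }
  hom_inv_id := congrArg (Quotient.mk _) (by simp [PreHom.comp, PreHom.id])
  inv_hom_id := congrArg (Quotient.mk _) (by simp [PreHom.comp, PreHom.id])

/-- The automorphism of `[n]` given by an element of `G₀ = p⁻¹(O(1))`, acting on `ℤ` by
`l ↦ ± l`. -/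
def reflect (n : ℕ) (ε : ℤˣ) (x : 𝔾) (hx : p x = reflection ε) : (⟨n⟩ : DeltaG p) ≅ ⟨n⟩ where
  hom := homMk
    { sign := ε
      toFun := fun l => ε * l
      monotone := by
        intro s t h
        simpa [← mul_assoc, ← Units.val_mul] using h
      periodic := by intro l; ring
      elt := x
      map_elt := hx }
  inv := homMk
    { sign := ε
      toFun := fun l => ε * l
      monotone := by
        intro s t h
        simpa [← mul_assoc, ← Units.val_mul] using h
      periodic := by intro l; ring
      elt := x⁻¹
      map_elt := by rw [map_inv, hx, ← map_inv, Int.units_inv_eq_self] }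
  hom_inv_id := congrArg (Quotient.mk _) (by
    simp [PreHom.comp, PreHom.id, ← mul_assoc, ← Units.val_mul])
  inv_hom_id := congrArg (Quotient.mk _) (by
    simp [PreHom.comp, PreHom.id, ← mul_assoc, ← Units.val_mul])

end DeltaG

/-! ### Structured sets -/

/-- A `ΔG`-structured set: a nonempty finite set `I` with `n + 1` elements, a right torsor `𝒪(I)`
over the group of automorphisms of `[n]` in `ΔG` and a map from `𝒪(I)` to the bijections
`{0, …, n} → I` that is equivariant along the homomorphism from that group to `S_{n+1}`. -/
structure StructuredSet (p : 𝔾 →* GL (Fin 2) ℝ) where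
  /-- the underlying set -/
  carrier : Type b
  /-- the number `n` -/
  len : ℕ
  /-- the set `𝒪(I)` of structured frames -/
  Frame : Type c
  frame_nonempty : Nonempty Frame
  /-- the right action -/
  act : Frame → ((⟨len⟩ : DeltaG p) ≅ ⟨len⟩) → Frame
  act_refl : ∀ o, act o (Iso.refl _) = o
  -- the product `x y` of the group is `x ∘ y`
  act_trans : ∀ o x y, act o (y ≪≫ x) = act (act o x) y
  existsUnique_act : ∀ o o', ∃! x, act o x = o'
  /-- the bijection of a structured frame -/
  label : Frame → Fin (len + 1) ≃ carrier
  label_act : ∀ o x i, label (act o x) i = label o (DeltaG.vertexMap x.hom i)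

namespace StructuredSet

variable {p : 𝔾 →* GL (Fin 2) ℝ}

/-- The standard object `[n]` isomorphic to a structured set. -/
abbrev std (X : StructuredSet.{a, b, c} p) : DeltaG p := ⟨X.len⟩

/-- A morphism `ψ : I' → I` is a family `ψ_{f, f'} : [n'] → [n]` with
`ψ_{f x, f' x'} = x⁻¹ ∘ ψ_{f, f'} ∘ x'`. -/
@[ext]
structure Hom (X' X : StructuredSet.{a, b, c} p) where
  /-- the family -/
  app : X.Frame → X'.Frame → (X'.std ⟶ X.std)
  app_act : ∀ f f' (x : X.std ≅ X.std) (x' : X'.std ≅ X'.std),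
    app (X.act f x) (X'.act f' x') = x'.hom ≫ app f f' ≫ x.inv

/-- The automorphism that takes one frame to another. -/
def diff (X : StructuredSet.{a, b, c} p) (o o' : X.Frame) : X.std ≅ X.std :=
  (X.existsUnique_act o o').choose

theorem act_diff (X : StructuredSet.{a, b, c} p) (o o' : X.Frame) : X.act o (X.diff o o') = o' :=
  (X.existsUnique_act o o').choose_spec.1

theorem eq_diff (X : StructuredSet.{a, b, c} p) {o o' : X.Frame} {x : X.std ≅ X.std}
    (h : X.act o x = o') : x = X.diff o o' :=
  (X.existsUnique_act o o').choose_spec.2 x h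

theorem Hom.app_act_left {X' X : StructuredSet.{a, b, c} p} (ψ : Hom X' X) (f f')
    (x : X.std ≅ X.std) : ψ.app (X.act f x) f' = ψ.app f f' ≫ x.inv := by
  have h := ψ.app_act f f' x (Iso.refl _)
  rwa [X'.act_refl, Iso.refl_hom, Category.id_comp] at h

theorem Hom.app_act_right {X' X : StructuredSet.{a, b, c} p} (ψ : Hom X' X) (f f')
    (x' : X'.std ≅ X'.std) : ψ.app f (X'.act f' x') = x'.hom ≫ ψ.app f f' := by
  have h := ψ.app_act f f' (Iso.refl _) x'
  rwa [X.act_refl, Iso.refl_inv, Category.comp_id] at h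

/-- The composite of the families does not depend on the intermediate frame. -/
theorem Hom.comp_indep {X'' X' X : StructuredSet.{a, b, c} p} (ψ' : Hom X'' X') (ψ : Hom X' X)
    (f'' f) (f₁ f₂ : X'.Frame) :
    ψ'.app f₁ f'' ≫ ψ.app f f₁ = ψ'.app f₂ f'' ≫ ψ.app f f₂ := by
  obtain ⟨x, rfl⟩ : ∃ x, X'.act f₁ x = f₂ := ⟨_, X'.act_diff f₁ f₂⟩
  rw [ψ'.app_act_left, ψ.app_act_right]
  simp

instance : Category (StructuredSet.{a, b, c} p) where
  Hom X' X := Hom X' X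
  id X :=
    { app := fun f f' => (X.diff f f').hom
      app_act := by
        intro f f' x x'
        have h : x' ≪≫ X.diff f f' ≪≫ x.symm = X.diff (X.act f x) (X.act f' x') := by
          apply X.eq_diff
          rw [← X.act_trans, Iso.trans_assoc, Iso.trans_assoc, Iso.symm_self_id, Iso.trans_refl,
            X.act_trans, X.act_diff]
        rw [← h]
        rfl }
  comp {X'' X' X} ψ' ψ :=
    { app := fun f f'' =>
        ψ'.app (Classical.choice X'.frame_nonempty) f'' ≫
          ψ.app f (Classical.choice X'.frame_nonempty)
      app_act := by
        intro f f'' x x''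
        rw [ψ'.app_act_right, ψ.app_act_left]
        simp }
  id_comp {X Y} ψ := by
    apply Hom.ext
    funext f f'
    refine (ψ.app_act_right _ _ _).symm.trans ?_
    rw [X.act_diff]
  comp_id {X Y} ψ := by
    apply Hom.ext
    funext f f'
    have h := ψ.app_act_left f f' (Y.diff f (Classical.choice Y.frame_nonempty))
    rw [Y.act_diff] at h
    change ψ.app _ f' ≫ (Y.diff f _).hom = _
    rw [h, Category.assoc, Iso.inv_hom_id, Category.comp_id]
  assoc ψ ψ' ψ'' := by
    apply Hom.ext
    funext f f'
    exact Category.assoc _ _ _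

/-- The family of a morphism. -/
def comps {X' X : StructuredSet.{a, b, c} p} (ψ : X' ⟶ X) :
    X.Frame → X'.Frame → (X'.std ⟶ X.std) := Hom.app ψ

theorem comps_id (X : StructuredSet.{a, b, c} p) (f f' : X.Frame) :
    comps (𝟙 X) f f' = (X.diff f f').hom := rfl

theorem comps_comp {X'' X' X : StructuredSet.{a, b, c} p} (ψ' : X'' ⟶ X') (ψ : X' ⟶ X)
    (f f' f'') : comps (ψ' ≫ ψ) f f'' = comps ψ' f' f'' ≫ comps ψ f f' :=
  Hom.comp_indep ψ' ψ f'' f _ _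

/-- The map of underlying sets, computed in a pair of frames. -/
def under {X' X : StructuredSet.{a, b, c} p} (ψ : X' ⟶ X) (f : X.Frame) (f' : X'.Frame)
    (i : X'.carrier) : X.carrier :=
  X.label f (DeltaG.vertexMap (comps ψ f f') ((X'.label f').symm i))

theorem under_indep {X' X : StructuredSet.{a, b, c} p} (ψ : X' ⟶ X) (f₁ f₂ : X.Frame)
    (f₁' f₂' : X'.Frame) (i : X'.carrier) : under ψ f₁ f₁' i = under ψ f₂ f₂' i := by
  obtain ⟨x, rfl⟩ : ∃ x, X.act f₁ x = f₂ := ⟨_, X.act_diff f₁ f₂⟩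
  obtain ⟨x', rfl⟩ : ∃ x, X'.act f₁' x = f₂' := ⟨_, X'.act_diff f₁' f₂'⟩
  obtain ⟨k, rfl⟩ := (X'.label (X'.act f₁' x')).surjective i
  have h : comps ψ (X.act f₁ x) (X'.act f₁' x') = x'.hom ≫ comps ψ f₁ f₁' ≫ x.inv :=
    Hom.app_act ψ _ _ _ _
  rw [under, under, Equiv.symm_apply_apply, X'.label_act, Equiv.symm_apply_apply, X.label_act, h,
    ← DeltaG.vertexMap_comp, ← DeltaG.vertexMap_comp]
  simp

/-- The forgetful functor to sets. -/
def forget (p : 𝔾 →* GL (Fin 2) ℝ) : StructuredSet.{a, b, c} p ⥤ Type b where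
  obj X := X.carrier
  map {X' X} ψ := TypeCat.ofHom
    (under ψ (Classical.choice X.frame_nonempty) (Classical.choice X'.frame_nonempty))
  map_id X := by
    ext i
    have h : X.diff (Classical.choice X.frame_nonempty) (Classical.choice X.frame_nonempty) =
        Iso.refl _ := (X.eq_diff (X.act_refl _)).symm
    change under (𝟙 X) _ _ i = i
    rw [under, comps_id, h, Iso.refl_hom, DeltaG.vertexMap_id, Equiv.apply_symm_apply]
  map_comp {X'' X' X} ψ' ψ := by
    ext i
    change under (ψ' ≫ ψ) _ _ i = under ψ _ _ (under ψ' _ _ i)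
    rw [under, under, under, comps_comp ψ' ψ _ (Classical.choice X'.frame_nonempty),
      DeltaG.vertexMap_comp, Equiv.symm_apply_apply]

end StructuredSet

end DeltaG

/-! ### Graphs -/

/-- A compact graph: half-edges, vertices, an involution without fixed points (every half-edge is
internal) and the map sending a half-edge to its vertex. -/
structure Graph where
  /-- half-edges -/
  H : Type d
  /-- vertices -/
  V : Type e
  /-- the involution -/
  τ : H → H
  τ_τ : ∀ h, τ (τ h) = h
  τ_ne : ∀ h, τ h ≠ h
  /-- the vertex of a half-edge -/
  src : H → V

namespace Graph

variable (Γ : Graph.{d, e})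

/-- Edges are the orbits `{h, τ h}`. -/
def Edge : Type d := {x : Sym2 Γ.H // ∃ h, x = s(h, Γ.τ h)}

/-- The edge of a half-edge. -/
def edgeOf (h : Γ.H) : Γ.Edge := ⟨s(h, Γ.τ h), h, rfl⟩

/-- The objects of the incidence category: vertices and edges. -/
inductive Cell : Type (max d e)
  | vert (v : Γ.V) : Cell
  | edge (x : Γ.Edge) : Cell

/-- The morphisms of the incidence category: identities and one morphism from `s(h)` to
`{h, τ h}` for each half-edge `h`. -/
inductive CellHom : Γ.Cell → Γ.Cell → Type (max d e)
  | id (X : Γ.Cell) : CellHom X X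
  | inc (h : Γ.H) : CellHom (Cell.vert (Γ.src h)) (Cell.edge (Γ.edgeOf h))

variable {Γ}

/-- Composition in the incidence category. -/
def CellHom.comp : ∀ {X Y Z : Γ.Cell}, Γ.CellHom X Y → Γ.CellHom Y Z → Γ.CellHom X Z
  | _, _, _, .id _, u => u
  | _, _, _, .inc h, .id _ => .inc h

instance : Category Γ.Cell where
  Hom := Γ.CellHom
  id := CellHom.id
  comp := CellHom.comp
  id_comp _ := rfl
  comp_id u := by cases u <;> rfl
  assoc u v w := by cases u <;> cases v <;> rfl

variable (Γ)

/-- The morphism `s(h) → {h, τ h}`. -/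
def inc (h : Γ.H) : (Cell.vert (Γ.src h) : Γ.Cell) ⟶ Cell.edge (Γ.edgeOf h) := CellHom.inc h

/-- The half-edges at a vertex, or of an edge. -/
def star : Γ.Cell → Type d
  | .vert v => {h : Γ.H // Γ.src h = v}
  | .edge x => {h : Γ.H // h ∈ x.1}

open Classical in
/-- The incidence map of `h`: it sends `h` to `τ h` and every other half-edge at `s(h)` to `h`. -/
def incidence (h : Γ.H) (x : {h' : Γ.H // Γ.src h' = Γ.src h}) :
    {h' : Γ.H // h' ∈ (Γ.edgeOf h).1} :=
  if x.1 = h then ⟨Γ.τ h, Sym2.mem_mk_right _ _⟩ else ⟨h, Sym2.mem_mk_left _ _⟩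

variable {Γ} in
/-- The incidence diagram on morphisms. -/
def CellHom.onStar : ∀ {X Y : Γ.Cell}, Γ.CellHom X Y → Γ.star X → Γ.star Y
  | _, _, .id _ => fun x => x
  | _, _, .inc h => Γ.incidence h

theorem CellHom.onStar_comp {Γ : Graph.{d, e}} {X Y Z : Γ.Cell} (u : Γ.CellHom X Y)
    (v : Γ.CellHom Y Z) (x : Γ.star X) : (u.comp v).onStar x = v.onStar (u.onStar x) := by
  cases u <;> cases v <;> rfl

/-- The incidence diagram. -/
def incidenceDiagram : Γ.Cell ⥤ Type d where
  obj := Γ.star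
  map u := TypeCat.ofHom (CellHom.onStar u)
  map_id _ := rfl
  map_comp u v := by
    ext x
    exact CellHom.onStar_comp u v x

/-- The cells glued to the realization: a point for each vertex and each edge of the graph, and an
interval for each half-edge. -/
abbrev PreRealization := (Σ _ : Γ.Cell, Unit) ⊕ (Σ _ : Γ.H, unitInterval)

/-- The interval of `h` is attached to `s(h)` at `0` and to the midpoint of `{h, τ h}` at `1`. -/
inductive Glue : Γ.PreRealization → Γ.PreRealization → Prop
  | start (h : Γ.H) : Glue (.inr ⟨h, 0⟩) (.inl ⟨.vert (Γ.src h), ()⟩)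
  | finish (h : Γ.H) : Glue (.inr ⟨h, 1⟩) (.inl ⟨.edge (Γ.edgeOf h), ()⟩)

/-- The geometric realization of (the nerve of) the incidence category, whose non-degenerate
simplices are the objects and the non-identity morphisms. It carries the quotient topology. -/
def Realization := Quot Γ.Glue

instance : TopologicalSpace Γ.Realization := inferInstanceAs (TopologicalSpace (Quot Γ.Glue))

/-- The `0`-cell of a vertex or an edge. -/
def point (X : Γ.Cell) : Γ.Realization := Quot.mk _ (.inl ⟨X, ()⟩)

/-- The `1`-cell of a half-edge. -/
def segment (h : Γ.H) (t : unitInterval) : Γ.Realization := Quot.mk _ (.inr ⟨h, t⟩)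

/-- The set of `1`-valent vertices. -/
def boundary : Set Γ.Realization :=
  {z | ∃ v, Nat.card {h : Γ.H // Γ.src h = v} = 1 ∧ z = Γ.point (.vert v)}

end Graph

/-- A `ΔG`-structure on a graph: a lift of the incidence diagram to `ΔG`-structured sets. -/
structure GraphStructure {𝔾 : Type a} [Group 𝔾] [TopologicalSpace 𝔾] [IsTopologicalGroup 𝔾]
    (p : 𝔾 →* GL (Fin 2) ℝ) (Γ : Graph.{d, e}) where
  /-- the lift -/
  lift : Γ.Cell ⥤ StructuredSet.{a, d, c} p
  lift_forget : lift ⋙ StructuredSet.forget p = Γ.incidenceDiagram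

theorem GraphStructure.carrier_eq {𝔾 : Type a} [Group 𝔾] [TopologicalSpace 𝔾]
    [IsTopologicalGroup 𝔾] {p : 𝔾 →* GL (Fin 2) ℝ} {Γ : Graph.{d, e}}
    (L : GraphStructure.{a, c, d, e} p Γ) (X : Γ.Cell) : (L.lift.obj X).carrier = Γ.star X :=
  Functor.congr_obj L.lift_forget X

/-! ### Structured surfaces -/

section Surface

variable {S : Type b} [TopologicalSpace S] [ChartedSpace (EuclideanHalfSpace 2) S]

/-- Two (nonzero) tangent vectors are at the same point and have the same direction. -/
def SameDirection (u w : TangentBundle (𝓡∂ 2) S) : Prop :=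
  ∃ r : ℝ, 0 < r ∧ u = ⟨w.proj, r • w.snd⟩

variable (S) in
/-- A frame of the tangent bundle of a surface. -/
@[ext]
structure Frame where
  /-- the point -/
  pt : S
  /-- the basis of the tangent space -/
  vec : Fin 2 → TangentSpace (𝓡∂ 2) pt
  linearIndependent : LinearIndependent ℝ vec

namespace Frame

/-- The first vector of a frame. -/
def first (x : Frame S) : TangentBundle (𝓡∂ 2) S := ⟨x.pt, x.vec 0⟩

/-- The second vector of a frame. -/
def second (x : Frame S) : TangentBundle (𝓡∂ 2) S := ⟨x.pt, x.vec 1⟩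

/-- The right action of `GL(2, ℝ)`: the `j`-th vector of `x A` is `∑ i, A i j • x i`. -/
def act (x : Frame S) (A : GL (Fin 2) ℝ) : Frame S where
  pt := x.pt
  vec j := ∑ i, (A : Matrix (Fin 2) (Fin 2) ℝ) i j • x.vec i
  linearIndependent := by
    rw [Fintype.linearIndependent_iff]
    intro g hg
    have h1 : ∑ i, ((A : Matrix (Fin 2) (Fin 2) ℝ).mulVec g) i • x.vec i = 0 := by
      rw [← hg]
      simp only [Matrix.mulVec, dotProduct, Finset.sum_smul, Finset.smul_sum, smul_smul]
      rw [Finset.sum_comm]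
      simp only [mul_comm]
    have h2 := (Fintype.linearIndependent_iff.mp x.linearIndependent) _ h1
    have h3 : (A : Matrix (Fin 2) (Fin 2) ℝ).mulVec g = 0 := funext h2
    have h4 : g = 0 := by
      have := congrArg ((A⁻¹ : GL (Fin 2) ℝ) : Matrix (Fin 2) (Fin 2) ℝ).mulVec h3
      rwa [Matrix.mulVec_mulVec, ← Units.val_mul, inv_mul_cancel, Units.val_one,
        Matrix.one_mulVec, Matrix.mulVec_zero] at this
    exact fun i => congrFun h4 i

end Frame

variable [IsManifold (𝓡∂ 2) ∞ S]

/-- The topology of the frame bundle, as a subspace of the square of the tangent bundle. -/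
instance : TopologicalSpace (Frame S) :=
  haveI : IsManifold (𝓡∂ 2) 1 S := .of_le (n := ∞) (by exact_mod_cast le_top)
  TopologicalSpace.induced (fun x => (x.first, x.second)) inferInstance

/-- A reduction `ρ : F → Fr_S` of the structure group of the frame bundle along `p`: a principal
bundle `F` with a `p`-equivariant map to the frame bundle. As `p` is a covering, so is `ρ`, and the
smooth structure of `F` is the one pulled back from `Fr_S`; it need not be specified. -/
structure GStructure {𝔾 : Type a} [Group 𝔾] [TopologicalSpace 𝔾] (p : 𝔾 →* GL (Fin 2) ℝ)
    (S : Type b) [TopologicalSpace S] [ChartedSpace (EuclideanHalfSpace 2) S]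
    [IsManifold (𝓡∂ 2) ∞ S] where
  /-- the total space -/
  F : Type c
  [topology : TopologicalSpace F]
  /-- the right action -/
  act : F → 𝔾 → F
  continuous_act : Continuous fun x : F × 𝔾 => act x.1 x.2
  act_one : ∀ f, act f 1 = f
  act_mul : ∀ f x y, act f (x * y) = act (act f x) y
  /-- the map to the frame bundle -/
  ρ : F → Frame S
  continuous_ρ : Continuous ρ
  ρ_act : ∀ f x, ρ (act f x) = (ρ f).act (p x)
  locally_trivial : ∀ x : S, ∃ U : Set S, IsOpen U ∧ x ∈ U ∧
    ∃ φ : U × 𝔾 ≃ₜ {f : F // (ρ f).pt ∈ U},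
      (∀ y g, (ρ (φ (y, g)).1).pt = y) ∧ ∀ y g g', (φ (y, g * g')).1 = act (φ (y, g)).1 g'

attribute [instance] GStructure.topology

/-! ### Embedded graphs -/

/-- The path in `S` given by a map `|Γ| → S` and a half-edge, from the vertex (at time `0`) to the
midpoint of the edge (at time `1`). -/
def halfEdgePath {Γ : Graph.{d, e}} (γ : Γ.Realization → S) (h : Γ.H) (t : ℝ) : S :=
  γ (Γ.segment h (Set.projIcc 0 1 zero_le_one t))

/-- Its velocity. -/
def velocity {Γ : Graph.{d, e}} (γ : Γ.Realization → S) (h : Γ.H) (t : ℝ) :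
    TangentBundle (𝓡∂ 2) S :=
  ⟨halfEdgePath γ h t,
    mfderivWithin 𝓘(ℝ, ℝ) (𝓡∂ 2) (halfEdgePath γ h) (Set.Icc 0 1) t (1 : ℝ)⟩

/-- The tangent vector of the germ of `h` leaving the midpoint of its edge. -/
def midpointGerm {Γ : Graph.{d, e}} (γ : Γ.Realization → S) (h : Γ.H) :
    TangentBundle (𝓡∂ 2) S :=
  ⟨(velocity γ h 1).proj, -(velocity γ h 1).snd⟩

/-- The tangent vectors of the germs of edges of `|Γ|` that leave a `0`-cell. -/
def germ {Γ : Graph.{d, e}} (γ : Γ.Realization → S) :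
    ∀ X : Γ.Cell, Γ.star X → TangentBundle (𝓡∂ 2) S
  | .vert _, h => velocity γ h.1 0
  | .edge _, h => midpointGerm γ h.1

/-- An embedding of a graph into a surface. -/
structure IsEmbedded {Γ : Graph.{d, e}} (γ : Γ.Realization → S) : Prop where
  continuous : Continuous γ
  injective : Function.Injective γ
  interior : ∀ z, z ∉ Γ.boundary → γ z ∈ (𝓡∂ 2).interior S
  boundary : ∀ z, z ∈ Γ.boundary → γ z ∈ (𝓡∂ 2).boundary S
  smooth : ∀ h, ContMDiffOn 𝓘(ℝ, ℝ) (𝓡∂ 2) ∞ (halfEdgePath γ h) (Set.Icc 0 1)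
  regular : ∀ h, ∀ t ∈ Set.Icc (0 : ℝ) 1, (velocity γ h t).snd ≠ 0
  distinct : ∀ (X : Γ.Cell) (i j : Γ.star X), SameDirection (germ γ X i) (germ γ X j) → i = j

/-! ### The structure induced on an embedded graph -/

variable {𝔾 : Type a} [Group 𝔾] [TopologicalSpace 𝔾] {p : 𝔾 →* GL (Fin 2) ℝ}

/-- The points `f` of `F` whose frame `ρ(f)` has a first vector pointing along one of the germs
leaving the `0`-cell `X`. -/
def MarkedFrame (Q : GStructure.{a, b, c} p S) {Γ : Graph.{d, e}} (γ : Γ.Realization → S)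
    (X : Γ.Cell) : Type c :=
  {f : Q.F // ∃ i : Γ.star X, SameDirection (Q.ρ f).first (germ γ X i)}

instance (Q : GStructure.{a, b, c} p S) {Γ : Graph.{d, e}} (γ : Γ.Realization → S) (X : Γ.Cell) :
    TopologicalSpace (MarkedFrame Q γ X) :=
  instTopologicalSpaceSubtype

/-- The set of structured frames that the surface puts on the germs leaving a `0`-cell: `π₀` of the
space of marked frames. Since the group of upper triangular matrices with positive diagonal is
contractible, this is the set of points over the given directions in the covering of the (oriented)
circle of directions defined by the `𝔾`-structure. -/
abbrev FrameClass (Q : GStructure.{a, b, c} p S) {Γ : Graph.{d, e}} (γ : Γ.Realization → S)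
    (X : Γ.Cell) : Type c := ZerothHomotopy (MarkedFrame Q γ X)

/-- The class of a marked frame. -/
def frameClass {Q : GStructure.{a, b, c} p S} {Γ : Graph.{d, e}} {γ : Γ.Realization → S}
    {X : Γ.Cell} (f : MarkedFrame Q γ X) : FrameClass Q γ X := Quotient.mk _ f

/-- `f'` is obtained from `f` by turning, in the sense from the first vector of `f` to the second
one, until the first vector meets one of the germs again. -/
def IsNext {Q : GStructure.{a, b, c} p S} {Γ : Graph.{d, e}} {γ : Γ.Realization → S}
    {X : Γ.Cell} (f f' : MarkedFrame Q γ X) : Prop :=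
  ∃ θ : ℝ, 0 < θ ∧ θ ≤ 2 * Real.pi ∧ ∃ r : unitInterval → 𝔾, Continuous r ∧ r 0 = 1 ∧
    (∀ t, p (r t) = rotation (θ * t)) ∧ f'.1 = Q.act f.1 (r 1) ∧
    ∀ t, 0 < t → t < 1 → ∀ i, ¬ SameDirection (Q.ρ (Q.act f.1 (r t))).first (germ γ X i)

/-- `f'` is the parallel transport of `f` along the half-edge `h`: the first vector follows the
velocity of `h`, and then, at the midpoint of the edge, it is moved to the direction of `τ h`
without crossing the direction of `h`. -/
def IsTransport {Q : GStructure.{a, b, c} p S} {Γ : Graph.{d, e}} {γ : Γ.Realization → S}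
    (h : Γ.H) (f : MarkedFrame Q γ (.vert (Γ.src h)))
    (f' : MarkedFrame Q γ (.edge (Γ.edgeOf h))) : Prop :=
  ∃ k k' : unitInterval → Q.F, Continuous k ∧ Continuous k' ∧
    k 0 = f.1 ∧ (∀ t, SameDirection (Q.ρ (k t)).first (velocity γ h t)) ∧
    k' 0 = k 1 ∧ (∀ t, (Q.ρ (k' t)).pt = γ (Γ.point (.edge (Γ.edgeOf h))) ∧
      ¬ SameDirection (Q.ρ (k' t)).first (midpointGerm γ h)) ∧ k' 1 = f'.1

/-- The `ΔG`-structure `L` is the one induced by the surface, where `β` identifies the structured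
frames of `L` with the classes of marked frames. -/
structure IsInduced [IsTopologicalGroup 𝔾] (Q : GStructure.{a, b, c} p S) {Γ : Graph.{d, e}}
    (γ : Γ.Realization → S) (L : GraphStructure.{a, c, d, e} p Γ)
    (β : ∀ X : Γ.Cell, (L.lift.obj X).Frame ≃ FrameClass Q γ X) : Prop where
  /-- the half-edge numbered `0` by a frame is the one along which the first vector points -/
  label_zero : ∀ X o (f : MarkedFrame Q γ X), β X o = frameClass f →
    SameDirection (Q.ρ f.1).first (germ γ X (cast (L.carrier_eq X) ((L.lift.obj X).label o 0)))
  /-- elements of `p⁻¹(O(1))` act through the action on `F` -/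
  reflect : ∀ X o (f f' : MarkedFrame Q γ X) ε x (hx : p x = reflection ε),
    β X o = frameClass f → f'.1 = Q.act f.1 x →
      β X ((L.lift.obj X).act o (DeltaG.reflect _ ε x hx)) = frameClass f'
  /-- the automorphism `l ↦ l + 1` acts by turning to the next half-edge -/
  rotate : ∀ X o (f f' : MarkedFrame Q γ X), β X o = frameClass f → IsNext f f' →
    β X ((L.lift.obj X).act o (DeltaG.rotate p _)) = frameClass f'
  /-- in frames that correspond under parallel transport along `h`, the morphism of `h` is the
  morphism `0 ↦ 0`, `i ↦ 1` (`i > 0`) of `Δ` -/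
  transport : ∀ h o o' (f : MarkedFrame Q γ (.vert (Γ.src h)))
    (f' : MarkedFrame Q γ (.edge (Γ.edgeOf h))),
    β _ o = frameClass f → β _ o' = frameClass f' → IsTransport h f f' →
      StructuredSet.comps (L.lift.map (Γ.inc h)) o' o = DeltaG.collapse p _ _

/-- An isomorphism of `ΔG`-structures on `Γ` that lies over the identity of the incidence diagram
and matches the frames identified with the same classes of marked frames. -/
structure IsCanonicalIso [IsTopologicalGroup 𝔾] {Q : GStructure.{a, b, c} p S} {Γ : Graph.{d, e}}
    {γ : Γ.Realization → S} {L L' : GraphStructure.{a, c, d, e} p Γ}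
    (β : ∀ X : Γ.Cell, (L.lift.obj X).Frame ≃ FrameClass Q γ X)
    (β' : ∀ X : Γ.Cell, (L'.lift.obj X).Frame ≃ FrameClass Q γ X)
    (η : L.lift ≅ L'.lift) : Prop where
  forget_eq : Functor.whiskerRight η.hom (StructuredSet.forget p) =
    eqToHom (L.lift_forget.trans L'.lift_forget.symm)
  frames : ∀ X o o', β X o = β' X o' →
    ∃ hn : (L.lift.obj X).len = (L'.lift.obj X).len,
      StructuredSet.comps (η.hom.app X) o' o = eqToHom (congrArg DeltaG.mk hn)

end Surface

end

end PlanarGraph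

open PlanarGraph

/-!
A covering `𝔾 → GL(2, ℝ)` lifts the decomposition of a matrix into a rotation, an upper triangular
matrix with positive diagonal and a reflection `diag(1, ±1)`, the last factor becoming an element
`y` of `p⁻¹(O(1))`. Fix a point of `F` over the image of a cell and number by `ℤ` the angles of the
germs leaving that cell. As there are finitely many germs and triangular matrices form a
contractible space, the class of a marked frame amounts to the number `k` of its direction together
with `y`, where passing from `k` to `k + n + 1` multiplies `y` by the lift of a full turn. These
are the data of an automorphism `l ↦ k + ε l` of `[n]`, so the classes of marked frames form a
torsor.

Transport along a half-edge is unique up to `p⁻¹(O(1))`, whose action the map `0 ↦ 0`, `i ↦ 1` to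
`[1]` intertwines; this gives the lift on morphisms. Conversely, reflections and the rotation
generate the automorphisms, so the two conditions on an induced structure determine the action and
all the labels, and an isomorphism that respects the frames has identity components.
-/

namespace PlanarGraph

noncomputable section

universe a b c d e

/-! ### Polar decomposition of `GL(2, ℝ)` -/

/-- `w` is a nonzero complex number and `α` is one of its arguments. -/
def HasAngle (w : ℂ) (α : ℝ) : Prop := ∃ r : ℝ, 0 < r ∧ w = r * Complex.exp (α * Complex.I)

namespace HasAngle

variable {w w' : ℂ} {α α' : ℝ}

theorem ne_zero (h : HasAngle w α) : w ≠ 0 := by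
  obtain ⟨r, hr, rfl⟩ := h
  exact mul_ne_zero (by exact_mod_cast hr.ne') (Complex.exp_ne_zero _)

theorem coe_arg (h : HasAngle w α) : (w.arg : Real.Angle) = α := by
  obtain ⟨r, hr, rfl⟩ := h
  rw [Complex.arg_real_mul _ hr, Complex.arg_exp_mul_I, Real.Angle.coe_toIocMod]

theorem add_two_pi_mul_int (h : HasAngle w α) (j : ℤ) : HasAngle w (α + 2 * Real.pi * j) := by
  obtain ⟨r, hr, rfl⟩ := h
  refine ⟨r, hr, congrArg _ (Complex.exp_eq_exp_iff_exists_int.mpr ⟨-j, ?_⟩)⟩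
  push_cast
  ring

theorem exists_int_eq (h : HasAngle w α) (h' : HasAngle w α') :
    ∃ j : ℤ, α' = α + 2 * Real.pi * j := by
  obtain ⟨j, hj⟩ := Real.Angle.angle_eq_iff_two_pi_dvd_sub.mp (h'.coe_arg.symm.trans h.coe_arg)
  exact ⟨j, by linarith⟩

theorem arg_eq (h : HasAngle w α) (hα : α ∈ Set.Ioc (-Real.pi) Real.pi) : w.arg = α := by
  obtain ⟨r, hr, rfl⟩ := h
  rw [Complex.exp_mul_I, Complex.arg_mul_cos_add_sin_mul_I hr hα]

theorem ofReal_mul (h : HasAngle w α) {s : ℝ} (hs : 0 < s) : HasAngle (s * w) α := by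
  obtain ⟨r, hr, rfl⟩ := h
  exact ⟨s * r, mul_pos hs hr, by push_cast; ring⟩

theorem exp_mul (h : HasAngle w α) (β : ℝ) :
    HasAngle (Complex.exp (β * Complex.I) * w) (β + α) := by
  obtain ⟨r, hr, rfl⟩ := h
  refine ⟨r, hr, ?_⟩
  push_cast
  rw [add_mul, Complex.exp_add]
  ring

theorem exists_eq_ofReal_mul (h : HasAngle w α) (h' : HasAngle w' α) :
    ∃ r : ℝ, 0 < r ∧ w = r * w' := by
  obtain ⟨r, hr, rfl⟩ := h
  obtain ⟨r', hr', rfl⟩ := h'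
  have hr0 : (r' : ℂ) ≠ 0 := by exact_mod_cast hr'.ne'
  refine ⟨r / r', div_pos hr hr', ?_⟩
  push_cast
  field_simp

end HasAngle

theorem hasAngle_arg {w : ℂ} (h : w ≠ 0) : HasAngle w w.arg :=
  ⟨‖w‖, norm_pos_iff.mpr h, (Complex.norm_mul_exp_arg_mul_I w).symm⟩

theorem hasAngle_one : HasAngle 1 0 := ⟨1, one_pos, by simp⟩

theorem hasAngle_neg_one : HasAngle (-1) Real.pi := ⟨1, one_pos, by simp⟩

theorem mem_slitPlane_of_not_hasAngle_pi {w : ℂ} (h0 : w ≠ 0) (h : ¬HasAngle w Real.pi) :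
    w ∈ Complex.slitPlane :=
  Complex.mem_slitPlane_iff_arg.mpr ⟨fun harg => h (harg ▸ hasAngle_arg h0), h0⟩

theorem hasAngle_iff_re_im {w : ℂ} {α : ℝ} : HasAngle w α ↔
    ∃ r : ℝ, 0 < r ∧ w.re = r * Real.cos α ∧ w.im = r * Real.sin α := by
  simp only [HasAngle, Complex.ext_iff, Complex.re_ofReal_mul, Complex.im_ofReal_mul,
    Complex.exp_ofReal_mul_I_re, Complex.exp_ofReal_mul_I_im]

theorem coe_units_mul_self (ε : ℤˣ) : ((ε : ℤ) : ℝ) * ((ε : ℤ) : ℝ) = 1 := by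
  exact_mod_cast Int.units_coe_mul_self ε

theorem reflection_injective : Function.Injective reflection := by
  intro ε ε' h
  have h11 : ((ε : ℤ) : ℝ) = ((ε' : ℤ) : ℝ) :=
    congrArg (fun A : GL (Fin 2) ℝ => (A : Matrix (Fin 2) (Fin 2) ℝ) 1 1) h
  exact Units.ext (by exact_mod_cast h11)

theorem rotation_neg_mul_rotation (α : ℝ) : rotation (-α) * rotation α = 1 := by
  rw [← rotation_add, neg_add_cancel, rotation_zero]

theorem rotation_mul_rotation_neg (α : ℝ) : rotation α * rotation (-α) = 1 := by
  rw [← rotation_add, add_neg_cancel, rotation_zero]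

theorem rotation_two_pi_mul_int (j : ℤ) : rotation (2 * Real.pi * j) = 1 := by
  have hcos : Real.cos (2 * Real.pi * j) = 1 := by
    rw [mul_comm]; exact Real.cos_int_mul_two_pi j
  have hsin : Real.sin (2 * Real.pi * j) = 0 := by
    rw [mul_comm, ← zero_add ((j : ℝ) * _), Real.sin_add_int_mul_two_pi, Real.sin_zero]
  ext i k
  fin_cases i <;> fin_cases k <;> simp [rotation, hcos, hsin]

theorem continuous_rotation : Continuous rotation := by
  rw [Units.continuous_iff]
  constructor <;> refine continuous_matrix fun i j => ?_ <;> fin_cases i <;> fin_cases j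
  exacts [Real.continuous_cos, Real.continuous_sin.neg, Real.continuous_sin, Real.continuous_cos,
    Real.continuous_cos, Real.continuous_sin, Real.continuous_sin.neg, Real.continuous_cos]

/-- The upper triangular matrices with positive diagonal, in coordinates that make them a copy
of `ℝ³`: the logarithms of the diagonal entries and the entry above the diagonal. -/
def upper (x : ℝ × ℝ × ℝ) : GL (Fin 2) ℝ where
  val := !![Real.exp x.1, x.2.1; 0, Real.exp x.2.2]
  inv := !![Real.exp (-x.1), -x.2.1 * Real.exp (-x.1) * Real.exp (-x.2.2); 0, Real.exp (-x.2.2)]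
  val_inv := by
    have h1 : Real.exp x.1 * Real.exp (-x.1) = 1 := by rw [← Real.exp_add]; simp
    have h2 : Real.exp x.2.2 * Real.exp (-x.2.2) = 1 := by rw [← Real.exp_add]; simp
    ext i j
    fin_cases i <;> fin_cases j <;> simp [Matrix.mul_apply, Fin.sum_univ_two, h1, h2]
    linear_combination (-x.2.1 * Real.exp (-x.2.2)) * h1
  inv_val := by
    have h1 : Real.exp x.1 * Real.exp (-x.1) = 1 := by rw [← Real.exp_add]; simp
    have h2 : Real.exp x.2.2 * Real.exp (-x.2.2) = 1 := by rw [← Real.exp_add]; simp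
    ext i j
    fin_cases i <;> fin_cases j <;> simp [Matrix.mul_apply, Fin.sum_univ_two]
    · linear_combination h1
    · linear_combination (-x.2.1 * Real.exp (-x.1)) * h2
    · linear_combination h2

theorem upper_zero : upper 0 = 1 := by
  ext i j; fin_cases i <;> fin_cases j <;> simp [upper]

theorem continuous_upper : Continuous upper := by
  have h11 : Continuous fun x : ℝ × ℝ × ℝ => Real.exp x.1 := by fun_prop
  have h12 : Continuous fun x : ℝ × ℝ × ℝ => x.2.1 := by fun_prop
  have h22 : Continuous fun x : ℝ × ℝ × ℝ => Real.exp x.2.2 := by fun_prop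
  have h11' : Continuous fun x : ℝ × ℝ × ℝ => Real.exp (-x.1) := by fun_prop
  have h22' : Continuous fun x : ℝ × ℝ × ℝ => Real.exp (-x.2.2) := by fun_prop
  rw [Units.continuous_iff]
  constructor <;> refine continuous_matrix fun i j => ?_ <;> fin_cases i <;> fin_cases j
  exacts [h11, h12, continuous_const, h22, h11', (h12.neg.mul h11').mul h22', continuous_const,
    h22']

/-- The first column of a matrix, as a complex number: for a frame `x A` it is the coordinate of
the first vector in the frame `x`. -/
def firstCol (A : GL (Fin 2) ℝ) : ℂ :=
  ⟨(A : Matrix (Fin 2) (Fin 2) ℝ) 0 0, (A : Matrix (Fin 2) (Fin 2) ℝ) 1 0⟩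

theorem continuous_firstCol : Continuous firstCol := by
  have hval : Continuous fun A : GL (Fin 2) ℝ => (A : Matrix (Fin 2) (Fin 2) ℝ) :=
    Units.continuous_val
  exact Complex.equivRealProdCLM.symm.continuous.comp
    ((hval.matrix_elem 0 0).prodMk (hval.matrix_elem 1 0))

theorem firstCol_ne_zero (A : GL (Fin 2) ℝ) : firstCol A ≠ 0 := by
  intro h
  have hdet : (A : Matrix (Fin 2) (Fin 2) ℝ).det ≠ 0 :=
    ((Matrix.isUnit_iff_isUnit_det _).mp A.isUnit).ne_zero
  simp only [firstCol, Complex.ext_iff, Complex.zero_re, Complex.zero_im] at h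
  exact hdet (by rw [Matrix.det_fin_two, h.1, h.2]; ring)

theorem firstCol_mul (A B : GL (Fin 2) ℝ) : firstCol (A * B) =
    ⟨(A : Matrix (Fin 2) (Fin 2) ℝ) 0 0 * (firstCol B).re +
      (A : Matrix (Fin 2) (Fin 2) ℝ) 0 1 * (firstCol B).im,
     (A : Matrix (Fin 2) (Fin 2) ℝ) 1 0 * (firstCol B).re +
      (A : Matrix (Fin 2) (Fin 2) ℝ) 1 1 * (firstCol B).im⟩ := by
  simp [firstCol, Matrix.mul_apply, Fin.sum_univ_two]

theorem firstCol_one : firstCol 1 = 1 := by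
  apply Complex.ext <;> simp [firstCol]

theorem firstCol_rotation_mul (α : ℝ) (A : GL (Fin 2) ℝ) :
    firstCol (rotation α * A) = Complex.exp (α * Complex.I) * firstCol A := by
  rw [firstCol_mul]
  apply Complex.ext <;>
    simp only [rotation, Matrix.of_apply, Matrix.cons_val', Matrix.cons_val_zero,
      Matrix.cons_val_one, Matrix.cons_val_fin_one, Complex.mul_re, Complex.mul_im,
      Complex.exp_ofReal_mul_I_re, Complex.exp_ofReal_mul_I_im]
  · ring
  · ring

theorem firstCol_rotation (α : ℝ) : firstCol (rotation α) = Complex.exp (α * Complex.I) := by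
  simpa only [mul_one, firstCol_one] using firstCol_rotation_mul α 1

theorem firstCol_mul_reflection (A : GL (Fin 2) ℝ) (ε : ℤˣ) :
    firstCol (A * reflection ε) = firstCol A := by
  rw [firstCol_mul]
  simp [firstCol, reflection]

theorem firstCol_mul_upper (A : GL (Fin 2) ℝ) (x : ℝ × ℝ × ℝ) :
    firstCol (A * upper x) = Real.exp x.1 * firstCol A := by
  rw [firstCol_mul]
  apply Complex.ext <;> simp [firstCol, upper, mul_comm, -Complex.ofReal_exp]

theorem hasAngle_firstCol_polar (α : ℝ) (x : ℝ × ℝ × ℝ) (ε : ℤˣ) :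
    HasAngle (firstCol (rotation α * upper x * reflection ε)) α := by
  rw [firstCol_mul_reflection, firstCol_mul_upper, firstCol_rotation]
  exact ⟨_, Real.exp_pos _, rfl⟩

/-- The matrix `A` turned by the angle `-α`. It is upper triangular with positive upper left entry
if `α` is an angle of the first column of `A`. -/
def unrotate (α : ℝ) (A : GL (Fin 2) ℝ) : Matrix (Fin 2) (Fin 2) ℝ :=
  ((rotation (-α) * A : GL (Fin 2) ℝ) : Matrix (Fin 2) (Fin 2) ℝ)

theorem continuous_unrotate : Continuous fun z : ℝ × GL (Fin 2) ℝ => unrotate z.1 z.2 :=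
  Units.continuous_val.comp
    ((continuous_rotation.comp continuous_fst.neg).mul continuous_snd)

theorem unrotate_polar (α : ℝ) (x : ℝ × ℝ × ℝ) (ε : ℤˣ) :
    unrotate α (rotation α * upper x * reflection ε) =
      !![Real.exp x.1, ((ε : ℤ) : ℝ) * x.2.1; 0, ((ε : ℤ) : ℝ) * Real.exp x.2.2] := by
  rw [unrotate, mul_assoc, ← mul_assoc, rotation_neg_mul_rotation, one_mul]
  ext i j
  fin_cases i <;> fin_cases j <;>
    simp [upper, reflection, Matrix.mul_apply, Fin.sum_univ_two, mul_comm]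

namespace HasAngle

variable {α : ℝ} {A : GL (Fin 2) ℝ}

theorem unrotate_firstCol (h : HasAngle (firstCol A) α) :
    0 < unrotate α A 0 0 ∧ unrotate α A 1 0 = 0 := by
  obtain ⟨r, hr, hcol⟩ := h.exp_mul (-α)
  rw [← firstCol_rotation_mul, neg_add_cancel, Complex.ofReal_zero, zero_mul, Complex.exp_zero,
    mul_one] at hcol
  have h00 : unrotate α A 0 0 = r := congrArg Complex.re hcol
  have h10 : unrotate α A 1 0 = 0 := congrArg Complex.im hcol
  exact ⟨h00 ▸ hr, h10⟩

theorem unrotate_one_one_ne_zero (h : HasAngle (firstCol A) α) : unrotate α A 1 1 ≠ 0 := by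
  intro h11
  have hdet : (unrotate α A).det ≠ 0 :=
    ((Matrix.isUnit_iff_isUnit_det _).mp (rotation (-α) * A).isUnit).ne_zero
  rw [Matrix.det_fin_two, h11, h.unrotate_firstCol.2] at hdet
  simp at hdet

end HasAngle

/-- The coordinates of the triangular factor `upper x` in a decomposition
`A = rotation α * upper x * reflection ε`. -/
def upperCoords (α : ℝ) (ε : ℤˣ) (A : GL (Fin 2) ℝ) : ℝ × ℝ × ℝ :=
  (Real.log (unrotate α A 0 0), ((ε : ℤ) : ℝ) * unrotate α A 0 1,
    Real.log (((ε : ℤ) : ℝ) * unrotate α A 1 1))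

theorem polar_upperCoords {α : ℝ} {ε : ℤˣ} {A : GL (Fin 2) ℝ} (h : HasAngle (firstCol A) α)
    (hε : 0 < ((ε : ℤ) : ℝ) * unrotate α A 1 1) :
    rotation α * upper (upperCoords α ε A) * reflection ε = A := by
  obtain ⟨h00, h10⟩ := h.unrotate_firstCol
  have hsq := coe_units_mul_self ε
  have htri : upper (upperCoords α ε A) * reflection ε = rotation (-α) * A := by
    apply Units.ext
    change _ = unrotate α A
    ext i j
    fin_cases i <;> fin_cases j <;>
      simp [upper, reflection, upperCoords, Matrix.mul_apply, Fin.sum_univ_two, Real.exp_log h00,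
        Real.exp_log hε, h10]
    · linear_combination unrotate α A 0 1 * hsq
    · linear_combination unrotate α A 1 1 * hsq
  rw [mul_assoc, htri, ← mul_assoc, rotation_mul_rotation_neg, one_mul]

theorem upperCoords_polar (α : ℝ) (x : ℝ × ℝ × ℝ) (ε : ℤˣ) :
    upperCoords α ε (rotation α * upper x * reflection ε) = x := by
  have hsq := coe_units_mul_self ε
  simp [upperCoords, unrotate_polar, ← mul_assoc, hsq]

theorem exists_polar_eq {α : ℝ} {A : GL (Fin 2) ℝ} (h : HasAngle (firstCol A) α) :
    ∃ x ε, rotation α * upper x * reflection ε = A := by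
  obtain ⟨ε, hε⟩ : ∃ ε : ℤˣ, 0 < ((ε : ℤ) : ℝ) * unrotate α A 1 1 := by
    rcases lt_or_gt_of_ne h.unrotate_one_one_ne_zero with hneg | hpos
    · exact ⟨-1, by simpa using hneg⟩
    · exact ⟨1, by simpa using hpos⟩
  exact ⟨_, ε, polar_upperCoords h hε⟩

theorem eq_of_upper_mul_reflection_eq {x x' : ℝ × ℝ × ℝ} {ε ε' : ℤˣ}
    (h : upper x * reflection ε = upper x' * reflection ε') : ε = ε' := by
  have h11 : Real.exp x.2.2 * ((ε : ℤ) : ℝ) = Real.exp x'.2.2 * ((ε' : ℤ) : ℝ) := by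
    simpa [upper, reflection, Matrix.mul_apply, Fin.sum_univ_two] using
      congrArg (fun A : GL (Fin 2) ℝ => (A : Matrix (Fin 2) (Fin 2) ℝ) 1 1) h
  have hx := Real.exp_pos x.2.2
  have hx' := Real.exp_pos x'.2.2
  rcases Int.units_eq_one_or ε with rfl | rfl <;> rcases Int.units_eq_one_or ε' with rfl | rfl <;>
    first | rfl | (push_cast at h11; linarith)

section Families

variable {T : Type*} [TopologicalSpace T] {A : T → GL (Fin 2) ℝ} {α : T → ℝ} {ε : ℤˣ}

theorem mul_unrotate_one_one_pos [PreconnectedSpace T] (hA : Continuous A) (hα : Continuous α)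
    (h : ∀ t, HasAngle (firstCol (A t)) (α t)) {t₀ : T}
    (h₀ : 0 < ((ε : ℤ) : ℝ) * unrotate (α t₀) (A t₀) 1 1) (t : T) :
    0 < ((ε : ℤ) : ℝ) * unrotate (α t) (A t) 1 1 := by
  by_contra! hle
  have hcont : Continuous fun t => ((ε : ℤ) : ℝ) * unrotate (α t) (A t) 1 1 :=
    continuous_const.mul ((continuous_unrotate.comp (hα.prodMk hA)).matrix_elem 1 1)
  obtain ⟨s, hs⟩ := mem_range_of_exists_le_of_exists_ge hcont ⟨t, hle⟩ ⟨t₀, h₀.le⟩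
  exact mul_ne_zero (left_ne_zero_of_mul_eq_one (coe_units_mul_self ε))
    (h s).unrotate_one_one_ne_zero hs

theorem continuous_upperCoords (hA : Continuous A) (hα : Continuous α)
    (h : ∀ t, HasAngle (firstCol (A t)) (α t))
    (hpos : ∀ t, 0 < ((ε : ℤ) : ℝ) * unrotate (α t) (A t) 1 1) :
    Continuous fun t => upperCoords (α t) ε (A t) := by
  have hentry : ∀ i j, Continuous fun t => unrotate (α t) (A t) i j :=
    (continuous_unrotate.comp (hα.prodMk hA)).matrix_elem
  exact ((hentry 0 0).log fun t => (h t).unrotate_firstCol.1.ne').prodMk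
    ((continuous_const.mul (hentry 0 1)).prodMk
      ((continuous_const.mul (hentry 1 1)).log fun t => (hpos t).ne'))

end Families

/-! ### Turning a frame -/

theorem firstCol_upper_mul_rotation (x : ℝ × ℝ × ℝ) (ψ : ℝ) :
    firstCol (upper x * rotation ψ) =
      ⟨Real.exp x.1 * Real.cos ψ + x.2.1 * Real.sin ψ, Real.exp x.2.2 * Real.sin ψ⟩ := by
  rw [firstCol_mul, firstCol_rotation]
  simp [upper, Complex.exp_ofReal_mul_I_re, Complex.exp_ofReal_mul_I_im]

/-- A triangular matrix with positive diagonal has no negative eigenvalue, so it takes no direction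
to the opposite one. -/
theorem exp_neg_mul_firstCol_mem_slitPlane (x : ℝ × ℝ × ℝ) (ψ : ℝ) :
    Complex.exp (((-ψ : ℝ) : ℂ) * Complex.I) * firstCol (upper x * rotation ψ) ∈
      Complex.slitPlane := by
  have hsq := Real.sin_sq_add_cos_sq ψ
  have hre : (Complex.exp (((-ψ : ℝ) : ℂ) * Complex.I) * firstCol (upper x * rotation ψ)).re =
      Real.exp x.1 * Real.cos ψ ^ 2 + x.2.1 * Real.sin ψ * Real.cos ψ +
        Real.exp x.2.2 * Real.sin ψ ^ 2 := by
    rw [firstCol_upper_mul_rotation, Complex.mul_re, Complex.exp_ofReal_mul_I_re,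
      Complex.exp_ofReal_mul_I_im, Real.cos_neg, Real.sin_neg]
    ring
  have him : (Complex.exp (((-ψ : ℝ) : ℂ) * Complex.I) * firstCol (upper x * rotation ψ)).im =
      Real.sin ψ * ((Real.exp x.2.2 - Real.exp x.1) * Real.cos ψ - x.2.1 * Real.sin ψ) := by
    rw [firstCol_upper_mul_rotation, Complex.mul_im, Complex.exp_ofReal_mul_I_re,
      Complex.exp_ofReal_mul_I_im, Real.cos_neg, Real.sin_neg]
    ring
  rw [Complex.mem_slitPlane_iff, or_iff_not_imp_right, not_not, hre, him]
  intro hzero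
  rcases mul_eq_zero.mp hzero with hsin | hfactor
  · have hcos : Real.cos ψ ^ 2 = 1 := by rw [hsin] at hsq; linarith
    simpa [hsin, hcos] using Real.exp_pos x.1
  · have heq : Real.exp x.1 * Real.cos ψ ^ 2 + x.2.1 * Real.sin ψ * Real.cos ψ +
        Real.exp x.2.2 * Real.sin ψ ^ 2 = Real.exp x.2.2 := by
      linear_combination Real.exp x.2.2 * hsq - Real.cos ψ * hfactor
    rw [heq]
    exact Real.exp_pos _

/-- The angle to which the matrix `upper x` takes the direction of angle `ψ`, in the continuous
determination that differs from `ψ` by less than `π`. -/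
def turnAngle (x : ℝ × ℝ × ℝ) (ψ : ℝ) : ℝ :=
  ψ + (Complex.exp (((-ψ : ℝ) : ℂ) * Complex.I) * firstCol (upper x * rotation ψ)).arg

theorem continuous_turnAngle (x : ℝ × ℝ × ℝ) : Continuous (turnAngle x) := by
  have hcol : Continuous fun ψ => firstCol (upper x * rotation ψ) :=
    continuous_firstCol.comp (continuous_const.mul continuous_rotation)
  refine continuous_id.add (continuous_iff_continuousAt.mpr fun ψ => ?_)
  exact (Complex.continuousAt_arg (exp_neg_mul_firstCol_mem_slitPlane x ψ)).comp_of_eq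
    (Continuous.continuousAt (by fun_prop)) rfl

theorem turnAngle_zero (x : ℝ × ℝ × ℝ) : turnAngle x 0 = 0 := by
  have hcol : firstCol (upper x * rotation 0) = (Real.exp x.1 : ℝ) := by
    rw [firstCol_upper_mul_rotation]
    apply Complex.ext <;> simp [-Complex.ofReal_exp]
  rw [turnAngle, hcol]
  simp only [neg_zero, Complex.ofReal_zero, zero_mul, Complex.exp_zero, one_mul, zero_add]
  exact Complex.arg_ofReal_of_nonneg (Real.exp_pos _).le

theorem hasAngle_turnAngle (x : ℝ × ℝ × ℝ) (ψ : ℝ) :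
    HasAngle (firstCol (upper x * rotation ψ)) (turnAngle x ψ) := by
  have h := (hasAngle_arg
    (Complex.slitPlane_ne_zero (exp_neg_mul_firstCol_mem_slitPlane x ψ))).exp_mul ψ
  rw [← mul_assoc, ← Complex.exp_add] at h
  simpa [turnAngle] using h

theorem abs_turnAngle_sub_lt (x : ℝ × ℝ × ℝ) (ψ : ℝ) : |turnAngle x ψ - ψ| < Real.pi := by
  rw [turnAngle, add_sub_cancel_left]
  exact lt_of_le_of_ne (Complex.abs_arg_le_pi _) fun h =>
    (Complex.mem_slitPlane_iff_arg.mp (exp_neg_mul_firstCol_mem_slitPlane x ψ)).1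
      ((abs_eq Real.pi_pos.le).mp h |>.resolve_right (Complex.neg_pi_lt_arg _).ne')

theorem exists_sin_turnAngle_eq (x : ℝ × ℝ × ℝ) (ψ : ℝ) :
    ∃ r : ℝ, 0 < r ∧ Real.sin ψ = r * Real.sin (turnAngle x ψ) := by
  obtain ⟨r, hr, -, him⟩ := hasAngle_iff_re_im.mp (hasAngle_turnAngle x ψ)
  rw [firstCol_upper_mul_rotation] at him
  refine ⟨r / Real.exp x.2.2, div_pos hr (Real.exp_pos _), ?_⟩
  rw [div_mul_eq_mul_div, eq_div_iff (Real.exp_pos _).ne', ← him, mul_comm]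

theorem turnAngle_pos (x : ℝ × ℝ × ℝ) {ψ : ℝ} (hψ : 0 < ψ) : 0 < turnAngle x ψ := by
  have hdist := (abs_lt.mp (abs_turnAngle_sub_lt x ψ)).1
  rcases le_or_gt Real.pi ψ with hπ | hπ
  · linarith
  · obtain ⟨r, hr, hsin⟩ := exists_sin_turnAngle_eq x ψ
    by_contra! hle
    have hsin_nonpos := Real.sin_nonpos_of_nonpos_of_neg_pi_le hle (by linarith)
    nlinarith [Real.sin_pos_of_pos_of_lt_pi hψ hπ]

theorem turnAngle_neg (x : ℝ × ℝ × ℝ) {ψ : ℝ} (hψ : ψ < 0) : turnAngle x ψ < 0 := by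
  have hdist := (abs_lt.mp (abs_turnAngle_sub_lt x ψ)).2
  rcases le_or_gt ψ (-Real.pi) with hπ | hπ
  · linarith
  · obtain ⟨r, hr, hsin⟩ := exists_sin_turnAngle_eq x ψ
    by_contra! hle
    have hsin_nonneg := Real.sin_nonneg_of_nonneg_of_le_pi hle (by linarith)
    nlinarith [Real.sin_neg_of_neg_of_neg_pi_lt hψ hπ]

/-! ### Polar decomposition in a covering of `GL(2, ℝ)` -/

section PolarLift

variable {𝔾 : Type a} [Group 𝔾] [TopologicalSpace 𝔾]

/-- Lifts to `𝔾` of the group of rotations and of the contractible space of upper triangular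
matrices with positive diagonal. They give every element of `𝔾` a decomposition
`rot α * tri x * y` with `y` over a reflection. -/
structure PolarLift (p : 𝔾 →* GL (Fin 2) ℝ) where
  isCoveringMap : IsCoveringMap p
  rot : ℝ → 𝔾
  continuous_rot : Continuous rot
  rot_zero : rot 0 = 1
  map_rot : ∀ θ, p (rot θ) = rotation θ
  tri : ℝ × ℝ × ℝ → 𝔾
  continuous_tri : Continuous tri
  tri_zero : tri 0 = 1
  map_tri : ∀ x, p (tri x) = upper x

theorem exists_polarLift (p : 𝔾 →* GL (Fin 2) ℝ) (hp : IsCoveringMap p) :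
    Nonempty (PolarLift p) := by
  obtain ⟨R, ⟨hR0, hR⟩, -⟩ := hp.existsUnique_continuousMap_lifts ⟨rotation, continuous_rotation⟩
    (0 : ℝ) 1 (by simp [rotation_zero])
  obtain ⟨U, ⟨hU0, hU⟩, -⟩ := hp.existsUnique_continuousMap_lifts ⟨upper, continuous_upper⟩
    (0 : ℝ × ℝ × ℝ) 1 (by simp [upper_zero])
  exact ⟨⟨hp, R, R.continuous, hR0, congrFun hR, U, U.continuous, hU0, congrFun hU⟩⟩

namespace PolarLift

variable {p : 𝔾 →* GL (Fin 2) ℝ} (P : PolarLift p)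

include P in
theorem eq_of_map_eq {T : Type*} [TopologicalSpace T] [PreconnectedSpace T] {g g' : T → 𝔾}
    (hg : Continuous g) (hg' : Continuous g') (h : ∀ t, p (g t) = p (g' t)) (t₀ : T)
    (h₀ : g t₀ = g' t₀) (t : T) : g t = g' t :=
  congrFun (P.isCoveringMap.eq_of_comp_eq hg hg' (funext h) t₀ h₀) t

theorem map_polar {y : 𝔾} {ε : ℤˣ} (hy : p y = reflection ε) (α : ℝ) (x : ℝ × ℝ × ℝ) :
    p (P.rot α * P.tri x * y) = rotation α * upper x * reflection ε := by
  rw [map_mul, map_mul, P.map_rot, P.map_tri, hy]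

theorem hasAngle_polar {y : 𝔾} {ε : ℤˣ} (hy : p y = reflection ε) (α : ℝ) (x : ℝ × ℝ × ℝ) :
    HasAngle (firstCol (p (P.rot α * P.tri x * y))) α := by
  rw [P.map_polar hy]
  exact hasAngle_firstCol_polar α x ε

theorem exists_polar {g : 𝔾} {α : ℝ} (h : HasAngle (firstCol (p g)) α) :
    ∃ x ε y, p y = reflection ε ∧ g = P.rot α * P.tri x * y := by
  obtain ⟨x, ε, hx⟩ := exists_polar_eq h
  refine ⟨x, ε, (P.rot α * P.tri x)⁻¹ * g, ?_, by group⟩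
  rw [map_mul, map_inv, map_mul, P.map_rot, P.map_tri, ← hx]
  group

theorem exists_angle_mul_rot {α : ℝ} {x : ℝ × ℝ × ℝ} {y : 𝔾} {ε : ℤˣ} (hy : p y = reflection ε) :
    ∃ A : ℝ → ℝ, Continuous A ∧ A 0 = α ∧
      (∀ φ, 0 < φ → 0 < ((ε : ℤ) : ℝ) * (A φ - α)) ∧
      ∀ φ, HasAngle (firstCol (p (P.rot α * P.tri x * y * P.rot φ))) (A φ) := by
  refine ⟨fun φ => α + turnAngle x (((ε : ℤ) : ℝ) * φ), ?_, ?_, ?_, ?_⟩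
  · exact continuous_const.add ((continuous_turnAngle x).comp (continuous_const.mul continuous_id))
  · simp [turnAngle_zero]
  · intro φ hφ
    rw [add_sub_cancel_left]
    rcases Int.units_eq_one_or ε with rfl | rfl
    · simpa using turnAngle_pos x hφ
    · simpa using turnAngle_neg x (neg_lt_zero.mpr hφ)
  · intro φ
    rw [map_mul, P.map_polar hy, P.map_rot, mul_assoc, reflection_mul_rotation, ← mul_assoc,
      firstCol_mul_reflection, mul_assoc, firstCol_rotation_mul]
    exact (hasAngle_turnAngle x _).exp_mul α

variable [IsTopologicalGroup 𝔾]

theorem rot_add (α β : ℝ) : P.rot (α + β) = P.rot α * P.rot β := by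
  have hrot := P.continuous_rot
  refine P.eq_of_map_eq (g := fun β => P.rot (α + β)) (g' := fun β => P.rot α * P.rot β)
    (by fun_prop) (by fun_prop) (fun t => ?_) 0 (by simp [P.rot_zero]) β
  simp [P.map_rot, rotation_add]

theorem mul_rot {y : 𝔾} {ε : ℤˣ} (hy : p y = reflection ε) (θ : ℝ) :
    y * P.rot θ = P.rot (((ε : ℤ) : ℝ) * θ) * y := by
  have hrot := P.continuous_rot
  refine P.eq_of_map_eq (g := fun θ => y * P.rot θ)
    (g' := fun θ => P.rot (((ε : ℤ) : ℝ) * θ) * y)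
    (by fun_prop) (by fun_prop) (fun t => ?_) 0 (by simp [P.rot_zero]) θ
  simp [P.map_rot, hy, reflection_mul_rotation]

theorem rot_two_pi_mul_int_mul_tri (j : ℤ) (x : ℝ × ℝ × ℝ) :
    P.rot (2 * Real.pi * j) * P.tri x = P.tri x * P.rot (2 * Real.pi * j) := by
  have htri := P.continuous_tri
  refine P.eq_of_map_eq (g := fun x => P.rot (2 * Real.pi * j) * P.tri x)
    (g' := fun x => P.tri x * P.rot (2 * Real.pi * j))
    (by fun_prop) (by fun_prop) (fun t => ?_) 0 (by simp [P.tri_zero]) x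
  simp [P.map_rot, rotation_two_pi_mul_int]

theorem exists_int_of_polar_eq {α α' : ℝ} {x x' : ℝ × ℝ × ℝ} {y y' : 𝔾} {ε ε' : ℤˣ}
    (hy : p y = reflection ε) (hy' : p y' = reflection ε')
    (h : P.rot α * P.tri x * y = P.rot α' * P.tri x' * y') :
    ∃ j : ℤ, α' = α + 2 * Real.pi * j ∧ y = P.rot (2 * Real.pi * j) * y' := by
  obtain ⟨j, rfl⟩ := (P.hasAngle_polar hy α x).exists_int_eq (h ▸ P.hasAngle_polar hy' α' x')
  refine ⟨j, rfl, ?_⟩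
  rw [P.rot_add, mul_assoc, mul_assoc (P.rot α), mul_assoc (P.rot α), mul_right_inj,
    P.rot_two_pi_mul_int_mul_tri] at h
  have hp := congrArg p h
  simp only [map_mul, P.map_rot, rotation_two_pi_mul_int, mul_one, P.map_tri, hy, hy'] at hp
  obtain rfl := eq_of_upper_mul_reflection_eq hp
  have hcoords : x = x' := by
    rw [← upperCoords_polar 0 x ε, mul_assoc, hp, ← mul_assoc, upperCoords_polar]
  rwa [hcoords, mul_assoc, mul_right_inj] at h

theorem polar_continuation {T : Type*} [TopologicalSpace T] [PreconnectedSpace T] {g : T → 𝔾}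
    {α : T → ℝ} (hg : Continuous g) (hα : Continuous α)
    (h : ∀ t, HasAngle (firstCol (p (g t))) (α t)) {y : 𝔾} {ε : ℤˣ} (hy : p y = reflection ε)
    {t₀ : T} {x₀ : ℝ × ℝ × ℝ} (h₀ : g t₀ = P.rot (α t₀) * P.tri x₀ * y) (t : T) :
    ∃ x, g t = P.rot (α t) * P.tri x * y := by
  have hpg : Continuous fun t => p (g t) := P.isCoveringMap.continuous.comp hg
  have hpos := mul_unrotate_one_one_pos (ε := ε) hpg hα h (t₀ := t₀) (by
    rw [h₀, P.map_polar hy, unrotate_polar]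
    simp [← mul_assoc, coe_units_mul_self, Real.exp_pos])
  have hcoords := continuous_upperCoords hpg hα h hpos
  refine ⟨upperCoords (α t) ε (p (g t)), P.eq_of_map_eq
    (g' := fun t => P.rot (α t) * P.tri (upperCoords (α t) ε (p (g t))) * y) hg
    (((P.continuous_rot.comp hα).mul (P.continuous_tri.comp hcoords)).mul continuous_const)
    (fun t => ?_) t₀ ?_ t⟩
  · rw [P.map_polar hy, polar_upperCoords (h t) (hpos t)]
  · simp only [h₀, P.map_polar hy, upperCoords_polar]

end PolarLift

end PolarLift

/-! ### Automorphisms in the crossed simplicial group -/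

theorem eq_add_of_bijective_of_monotone {F : ℤ → ℤ} {ε : ℤˣ} (hF : Function.Bijective F)
    (hmono : Monotone fun l => (ε : ℤ) * F l) (l : ℤ) : F l = F 0 + ε * l := by
  have hsq := Int.units_coe_mul_self ε
  have hbij : Function.Bijective fun l => (ε : ℤ) * F l :=
    (Units.mulLeft_bijective ε).comp hF
  let e : ℤ ≃o ℤ :=
    (hmono.strictMono_of_injective hbij.injective).orderIsoOfSurjective _ hbij.surjective
  have hsucc : ∀ k, (ε : ℤ) * F (k + 1) = ε * F k + 1 := fun k => e.map_succ k
  have hstep : ∀ k, F (k + 1) = F k + ε := fun k => by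
    linear_combination (ε : ℤ) * hsucc k - (F (k + 1) - F k) * hsq
  induction l using Int.induction_on with
  | zero => simp
  | succ i ih => rw [hstep, ih]; ring
  | pred i ih =>
    have hprev := hstep (-(i : ℤ) - 1)
    rw [sub_add_cancel, ih] at hprev
    linear_combination -hprev

section Automorphisms

variable {𝔾 : Type a} [Group 𝔾] {p : 𝔾 →* GL (Fin 2) ℝ}

/-- The representative `(l ↦ k + ε l, y)`. -/
def PreHom.affine (n : ℕ) (k : ℤ) (ε : ℤˣ) (y : 𝔾) (hy : p y = reflection ε) : PreHom p n n where
  sign := ε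
  toFun l := k + ε * l
  monotone := by
    intro s t h
    simp only [mul_add, ← mul_assoc, Int.units_coe_mul_self]
    linarith
  periodic l := by ring
  elt := y
  map_elt := hy

theorem map_inv_eq_reflection {y : 𝔾} {ε : ℤˣ} (hy : p y = reflection ε) :
    p y⁻¹ = reflection ε := by
  rw [map_inv, hy, ← map_inv, Int.units_inv_eq_self]

theorem map_mul_eq_reflection {y y' : 𝔾} {ε ε' : ℤˣ} (hy : p y = reflection ε)
    (hy' : p y' = reflection ε') : p (y * y') = reflection (ε * ε') := by
  rw [map_mul, hy, hy', map_mul]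

theorem map_one_eq_reflection (p : 𝔾 →* GL (Fin 2) ℝ) : p 1 = reflection 1 := by
  rw [map_one, map_one]

variable [TopologicalSpace 𝔾] [IsTopologicalGroup 𝔾]

theorem PolarLift.rel_iff (P : PolarLift p) {m n : ℕ} {u u' : PreHom p m n} :
    PreHom.Rel u u' ↔ ∃ j : ℤ, (∀ l, u'.toFun l = u.toFun l + j * (n + 1)) ∧
      u.elt = P.rot (2 * Real.pi * j) * u'.elt := by
  have hrot := P.continuous_rot
  constructor
  · rintro ⟨j, hj, c, hc, hc₀, hc₁, hpc⟩
    refine ⟨j, hj, ?_⟩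
    have hlift := P.eq_of_map_eq (g := c)
      (g' := fun t : unitInterval => P.rot (2 * Real.pi * j * t) * u'.elt) hc
      (by fun_prop) (fun t => by rw [hpc, map_mul, P.map_rot]) 0 (by simp [hc₀, P.rot_zero]) 1
    rw [← hc₁, hlift, Set.Icc.coe_one, mul_one]
  · rintro ⟨j, hj, h⟩
    exact ⟨j, hj, fun t => P.rot (2 * Real.pi * j * t) * u'.elt, by fun_prop,
      by simp [P.rot_zero], by simp [h], fun t => by rw [map_mul, P.map_rot]⟩

namespace DeltaG

/-- The automorphism of `[n]` with representative `(l ↦ k + ε l, y)`. -/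
def affine (n : ℕ) (k : ℤ) (ε : ℤˣ) (y : 𝔾) (hy : p y = reflection ε) :
    (⟨n⟩ : DeltaG p) ≅ ⟨n⟩ where
  hom := homMk (PreHom.affine n k ε y hy)
  inv := homMk (PreHom.affine n (-(ε * k)) ε y⁻¹ (map_inv_eq_reflection hy))
  hom_inv_id := congrArg (Quotient.mk _) (by
    refine PreHom.ext (Int.units_mul_self ε) (funext fun l => ?_) (inv_mul_cancel y)
    change -(ε * k) + ε * (k + ε * l) = l
    linear_combination l * Int.units_coe_mul_self ε)
  inv_hom_id := congrArg (Quotient.mk _) (by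
    refine PreHom.ext (Int.units_mul_self ε) (funext fun l => ?_) (mul_inv_cancel y)
    change k + ε * (-(ε * k) + ε * l) = l
    linear_combination (l - k) * Int.units_coe_mul_self ε)

theorem affine_congr {n : ℕ} {k k' : ℤ} {ε ε' : ℤˣ} {y y' : 𝔾} {hy : p y = reflection ε}
    {hy' : p y' = reflection ε'} (hk : k = k') (hε : ε = ε') (h : y = y') :
    affine n k ε y hy = affine n k' ε' y' hy' := by
  subst hk hε h
  rfl

theorem affine_trans (n : ℕ) {k k' : ℤ} {ε ε' : ℤˣ} {y y' : 𝔾} (hy : p y = reflection ε)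
    (hy' : p y' = reflection ε') :
    affine n k' ε' y' hy' ≪≫ affine n k ε y hy =
      affine n (k + ε * k') (ε * ε') (y * y') (map_mul_eq_reflection hy hy') := by
  ext
  refine congrArg (Quotient.mk _) (PreHom.ext rfl (funext fun l => ?_) rfl)
  change k + ε * (k' + ε' * l) = k + ε * k' + ((ε * ε' : ℤˣ) : ℤ) * l
  push_cast
  ring

theorem rotate_eq_affine (n : ℕ) : rotate p n = affine n 1 1 1 (map_one_eq_reflection p) := by
  ext
  refine congrArg (Quotient.mk _) (PreHom.ext rfl (funext fun l => ?_) rfl)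
  change l + 1 = 1 + ((1 : ℤˣ) : ℤ) * l
  rw [Units.val_one, one_mul, add_comm]

theorem reflect_eq_affine (n : ℕ) {ε : ℤˣ} {x : 𝔾} (hx : p x = reflection ε) :
    reflect n ε x hx = affine n 0 ε x hx := by
  ext
  exact congrArg (Quotient.mk _) (PreHom.ext rfl (funext fun l => (zero_add _).symm) rfl)

theorem vertexMap_affine (n : ℕ) (k : ℤ) {ε : ℤˣ} {y : 𝔾} (hy : p y = reflection ε)
    (i : Fin (n + 1)) : vertexMap (affine n k ε y hy).hom i = vertex n (k + ε * (i : ℕ)) := rfl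

theorem bijective_toFun_of_homMk_eq {m n : ℕ} (u : (⟨m⟩ : DeltaG p) ≅ ⟨n⟩) {v : PreHom p m n}
    (hv : homMk v = u.hom) : Function.Bijective v.toFun := by
  obtain ⟨w, hw⟩ := Quotient.exists_rep u.inv
  have hhom := u.hom_inv_id
  have hinv := u.inv_hom_id
  rw [← hv, ← hw] at hhom hinv
  obtain ⟨i, hi, -⟩ := Quotient.exact hhom
  obtain ⟨j, hj, -⟩ := Quotient.exact hinv
  change ∀ l, l = w.toFun (v.toFun l) + i * (m + 1) at hi
  change ∀ l, l = v.toFun (w.toFun l) + j * (n + 1) at hj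
  constructor
  · intro s t hst
    rw [hi s, hi t, hst]
  · intro s
    refine ⟨w.toFun (s + j * (n + 1)), ?_⟩
    linarith [hj (s + j * (n + 1))]

theorem exists_eq_affine {n : ℕ} (u : (⟨n⟩ : DeltaG p) ≅ ⟨n⟩) :
    ∃ k ε y, ∃ hy : p y = reflection ε, u = affine n k ε y hy := by
  obtain ⟨v, hv⟩ := Quotient.exists_rep u.hom
  refine ⟨v.toFun 0, v.sign, v.elt, v.map_elt, ?_⟩
  ext
  rw [← hv]
  exact congrArg (Quotient.mk _) (PreHom.ext rfl (funext (eq_add_of_bijective_of_monotone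
    (bijective_toFun_of_homMk_eq u hv) v.monotone)) rfl)

theorem affine_hom_comp_eqToHom {n n' : ℕ} (hn : n = n') (k : ℤ) {ε : ℤˣ} {y : 𝔾}
    (hy : p y = reflection ε) (h : (⟨n⟩ : DeltaG p) = ⟨n'⟩) :
    (affine n k ε y hy).hom ≫ eqToHom h ≫ (affine n' k ε y hy).inv = eqToHom h := by
  subst hn
  simp

theorem collapse_comp_eqToHom {m m' n n' : ℕ} (hm : m = m') (hn : n = n')
    (h : (⟨m⟩ : DeltaG p) = ⟨m'⟩) (h' : (⟨n⟩ : DeltaG p) = ⟨n'⟩) :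
    collapse p m n ≫ eqToHom h' = eqToHom h ≫ collapse p m' n' := by
  subst hm hn
  simp

theorem vertexMap_eqToHom {n n' : ℕ} (hn : n = n') (h : (⟨n⟩ : DeltaG p) = ⟨n'⟩)
    (i : Fin (n + 1)) : vertexMap (eqToHom h) i = Fin.cast (by rw [hn]) i := by
  subst hn
  exact vertexMap_id _ i

theorem vertexMap_collapse (m n : ℕ) (i : Fin (m + 1)) :
    vertexMap (collapse p m n) i = if i = 0 then 0 else Fin.last n := by
  change vertex n (((if vertex m (i : ℕ) = 0 then 0 else Fin.last n : Fin (n + 1)) : ℕ) +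
    ((i : ℕ) : ℤ) / (m + 1) * (n + 1)) = _
  rw [vertex_add_mul, vertex_coe, vertex_coe]

theorem vertex_eq_zero_iff (n : ℕ) (l : ℤ) : vertex n l = 0 ↔ (n : ℤ) + 1 ∣ l := by
  have hnonneg := Int.emod_nonneg l (show ((n : ℤ) + 1) ≠ 0 by omega)
  rw [Fin.ext_iff, Int.dvd_iff_emod_eq_zero]
  simp only [vertex, Fin.val_zero]
  omega

/-- This is `⌊l / (m + 1)⌋ + ⌈l / (m + 1)⌉`, hence an odd function of `l`. -/
theorem ofMonotone_collapse_eq (m : ℕ) (l : ℤ) :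
    (((if vertex m l = 0 then 0 else Fin.last 1 : Fin (1 + 1)) : ℕ) : ℤ) + l / (m + 1) * (1 + 1) =
      l / (m + 1) - -l / (m + 1) := by
  have hsign : Int.sign ((m : ℤ) + 1) = 1 := Int.sign_eq_one_of_pos (by omega)
  rw [Int.neg_ediv, hsign]
  by_cases hl : (m : ℤ) + 1 ∣ l
  · rw [if_pos ((vertex_eq_zero_iff m l).mpr hl), if_pos hl, Fin.val_zero, Nat.cast_zero]
    ring
  · rw [if_neg (hl ∘ (vertex_eq_zero_iff m l).mp), if_neg hl, Fin.val_last, Nat.cast_one]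
    ring

theorem reflect_comp_collapse (m : ℕ) {n : ℕ} (hn : n = 1) {ε : ℤˣ} {x : 𝔾}
    (hx : p x = reflection ε) :
    (reflect m ε x hx).hom ≫ collapse p m n ≫ (reflect n ε x hx).inv = collapse p m n := by
  subst hn
  refine congrArg (Quotient.mk _) (PreHom.ext ?_ (funext fun l => ?_) ?_)
  · change ε * 1 * ε = 1
    rw [mul_one, Int.units_mul_self]
  · change ε * ((((if vertex m (ε * l) = 0 then 0 else Fin.last 1 : Fin (1 + 1)) : ℕ) : ℤ) +
      ε * l / (m + 1) * (1 + 1)) =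
        (((if vertex m l = 0 then 0 else Fin.last 1 : Fin (1 + 1)) : ℕ) : ℤ) + l / (m + 1) * (1 + 1)
    rw [ofMonotone_collapse_eq, ofMonotone_collapse_eq]
    rcases Int.units_eq_one_or ε with rfl | rfl
    · simp
    · simp
  · change x⁻¹ * 1 * x = 1
    rw [mul_one, inv_mul_cancel]

end DeltaG

/-! ### Morphisms of structured sets -/

namespace StructuredSet

variable {X' X : StructuredSet.{a, b, c} p}

theorem diff_act (X : StructuredSet.{a, b, c} p) (o o' : X.Frame) (x : X.std ≅ X.std) :
    X.diff o (X.act o' x) = x ≪≫ X.diff o o' :=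
  (X.eq_diff (by rw [X.act_trans, X.act_diff])).symm

theorem diff_self (X : StructuredSet.{a, b, c} p) (o : X.Frame) : X.diff o o = Iso.refl _ :=
  (X.eq_diff (X.act_refl o)).symm

theorem act_injective (X : StructuredSet.{a, b, c} p) (x : X.std ≅ X.std) :
    Function.Injective (X.act · x) := by
  intro o o' h
  have hact := congrArg (X.act · x.symm) h
  simpa only [← X.act_trans, Iso.symm_self_id, X.act_refl] using hact

theorem act_affine_add_one (X : StructuredSet.{a, b, c} p) (o : X.Frame) (m : ℤ) :
    X.act o (DeltaG.affine _ (m + 1) 1 1 (map_one_eq_reflection p)) =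
      X.act (X.act o (DeltaG.affine _ m 1 1 (map_one_eq_reflection p))) (DeltaG.rotate p _) := by
  rw [← X.act_trans, DeltaG.rotate_eq_affine, DeltaG.affine_trans]
  exact congrArg _ (DeltaG.affine_congr (by simp) (by simp) (by simp))

theorem act_affine_eq (X : StructuredSet.{a, b, c} p) (o : X.Frame) (m : ℤ) {ε : ℤˣ} {y : 𝔾}
    (hy : p y = reflection ε) :
    X.act o (DeltaG.affine _ m ε y hy) =
      X.act (X.act o (DeltaG.affine _ m 1 1 (map_one_eq_reflection p)))
        (DeltaG.reflect _ ε y hy) := by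
  rw [← X.act_trans, DeltaG.reflect_eq_affine, DeltaG.affine_trans]
  exact congrArg _ (DeltaG.affine_congr (by simp) (by simp) (by simp))

theorem label_act_affine (X : StructuredSet.{a, b, c} p) (o : X.Frame) (i : Fin (X.len + 1)) :
    X.label (X.act o (DeltaG.affine _ (i : ℕ) 1 1 (map_one_eq_reflection p))) 0 = X.label o i := by
  rw [X.label_act, DeltaG.vertexMap_affine, Fin.val_zero, Nat.cast_zero, mul_zero, add_zero,
    DeltaG.vertex_coe]

/-- The automorphisms are generated by `reflect` and `rotate`. The torsor property of `Y` gives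
equivariance under the inverse of `rotate`. -/
theorem map_act_affine {X : StructuredSet.{a, b, c} p} {Y : StructuredSet.{a, d, e} p}
    {φ : X.Frame → Y.Frame}
    (hreflect : ∀ o ε x (hx : p x = reflection ε),
      φ (X.act o (DeltaG.reflect _ ε x hx)) = Y.act (φ o) (DeltaG.reflect _ ε x hx))
    (hrotate : ∀ o, φ (X.act o (DeltaG.rotate p _)) = Y.act (φ o) (DeltaG.rotate p _))
    (o : X.Frame) (m : ℤ) {ε : ℤˣ} {y : 𝔾} (hy : p y = reflection ε) :
    φ (X.act o (DeltaG.affine _ m ε y hy)) = Y.act (φ o) (DeltaG.affine _ m ε y hy) := by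
  have hone : φ (X.act o (DeltaG.affine _ m 1 1 (map_one_eq_reflection p))) =
      Y.act (φ o) (DeltaG.affine _ m 1 1 (map_one_eq_reflection p)) := by
    induction m using Int.induction_on with
    | zero => rw [← DeltaG.reflect_eq_affine, ← DeltaG.reflect_eq_affine, hreflect]
    | succ i ih => rw [act_affine_add_one, hrotate, ih, act_affine_add_one]
    | pred i ih =>
      rw [← sub_add_cancel (-(i : ℤ)) 1, act_affine_add_one, act_affine_add_one, hrotate] at ih
      exact Y.act_injective _ ih
  rw [act_affine_eq, hreflect, hone, ← act_affine_eq]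

/-- The morphism whose component in the frames `f` and `f'` is `u`. -/
def homOfComp (f : X.Frame) (f' : X'.Frame) (u : X'.std ⟶ X.std) : X' ⟶ X :=
  ({ app := fun g g' => (X'.diff f' g').hom ≫ u ≫ (X.diff f g).inv
     app_act := by
      intro g g' x x'
      rw [diff_act, diff_act]
      simp } : Hom X' X)

theorem comps_homOfComp (f : X.Frame) (f' : X'.Frame) (u : X'.std ⟶ X.std) :
    comps (homOfComp f f' u) f f' = u := by
  change (X'.diff f' f').hom ≫ u ≫ (X.diff f f).inv = u
  simp [diff_self]

theorem comps_act (ψ : X' ⟶ X) (f : X.Frame) (f' : X'.Frame) (x : X.std ≅ X.std)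
    (x' : X'.std ≅ X'.std) :
    comps ψ (X.act f x) (X'.act f' x') = x'.hom ≫ comps ψ f f' ≫ x.inv := Hom.app_act ψ f f' x x'

theorem hom_ext_comp {ψ φ : X' ⟶ X} (f : X.Frame) (f' : X'.Frame)
    (h : comps ψ f f' = comps φ f f') : ψ = φ := by
  refine Hom.ext (funext fun g => funext fun g' => ?_)
  rw [← X.act_diff f g, ← X'.act_diff f' g']
  change comps ψ _ _ = comps φ _ _
  rw [comps_act, comps_act, h]

/-- The isomorphism that matches two given frames. -/
def isoOfFrames (h : X'.std = X.std) (f : X.Frame) (f' : X'.Frame) : X' ≅ X where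
  hom := homOfComp f f' (eqToHom h)
  inv := homOfComp f' f (eqToHom h.symm)
  hom_inv_id := hom_ext_comp f' f' (by
    rw [comps_comp _ _ _ f, comps_homOfComp, comps_homOfComp, comps_id, diff_self]
    simp)
  inv_hom_id := hom_ext_comp f f (by
    rw [comps_comp _ _ _ f', comps_homOfComp, comps_homOfComp, comps_id, diff_self]
    simp)

theorem under_id (X : StructuredSet.{a, b, c} p) (f f' : X.Frame) (i : X.carrier) :
    under (𝟙 X) f f' i = i := by
  rw [under_indep _ _ f _ f, under, comps_id, diff_self, Iso.refl_hom, DeltaG.vertexMap_id,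
    Equiv.apply_symm_apply]

theorem under_homOfComp (f : X.Frame) (f' : X'.Frame) (u : X'.std ⟶ X.std) (g : X.Frame)
    (g' : X'.Frame) (i : X'.carrier) :
    under (homOfComp f f' u) g g' i = X.label f (DeltaG.vertexMap u ((X'.label f').symm i)) := by
  rw [under_indep _ _ f _ f', under, comps_homOfComp]

theorem under_collapse_of_eq (f : X.Frame) (f' : X'.Frame) (g : X.Frame) (g' : X'.Frame)
    {i : X'.carrier} (hi : i = X'.label f' 0) :
    under (homOfComp f f' (DeltaG.collapse p _ _)) g g' i = X.label f 0 := by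
  rw [under_homOfComp, DeltaG.vertexMap_collapse, if_pos ((Equiv.symm_apply_eq _).mpr hi)]

theorem under_collapse_of_ne (f : X.Frame) (f' : X'.Frame) (g : X.Frame) (g' : X'.Frame)
    {i : X'.carrier} (hi : i ≠ X'.label f' 0) :
    under (homOfComp f f' (DeltaG.collapse p _ _)) g g' i = X.label f (Fin.last _) := by
  rw [under_homOfComp, DeltaG.vertexMap_collapse,
    if_neg fun h => hi ((Equiv.symm_apply_eq _).mp h)]

theorem comps_collapse_of_act_reflect (hX : X.len = 1) {f g : X.Frame} {f' g' : X'.Frame} {ε : ℤˣ}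
    {x : 𝔾} (hx : p x = reflection ε) (h : X.act f (DeltaG.reflect _ ε x hx) = g)
    (h' : X'.act f' (DeltaG.reflect _ ε x hx) = g') :
    comps (homOfComp f f' (DeltaG.collapse p _ _)) g g' = DeltaG.collapse p _ _ := by
  rw [← h, ← h', comps_act, comps_homOfComp]
  exact DeltaG.reflect_comp_collapse _ hX hx

end StructuredSet

end Automorphisms

/-! ### Tangent directions -/

section Surface

variable {S : Type b} [TopologicalSpace S] [ChartedSpace (EuclideanHalfSpace 2) S]

namespace SameDirection

variable {u v w : TangentBundle (𝓡∂ 2) S}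

theorem proj_eq (h : SameDirection u w) : u.proj = w.proj := by
  obtain ⟨r, -, rfl⟩ := h
  rfl

theorem symm (h : SameDirection u w) : SameDirection w u := by
  obtain ⟨r, hr, rfl⟩ := h
  refine ⟨r⁻¹, inv_pos.mpr hr, ?_⟩
  simp only [smul_smul, inv_mul_cancel₀ hr.ne', one_smul]

theorem trans (h : SameDirection u v) (h' : SameDirection v w) : SameDirection u w := by
  obtain ⟨r, hr, rfl⟩ := h
  obtain ⟨s, hs, rfl⟩ := h'
  exact ⟨r * s, mul_pos hr hs, by simp only [smul_smul]⟩

end SameDirection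

theorem sameDirection_mk_iff {x : S} {v w : TangentSpace (𝓡∂ 2) x} :
    SameDirection (⟨x, v⟩ : TangentBundle (𝓡∂ 2) S) ⟨x, w⟩ ↔ ∃ r : ℝ, 0 < r ∧ v = r • w := by
  simp [SameDirection]

namespace Frame

/-- A frame as a basis of the tangent space. -/
def basis (x : Frame S) : Module.Basis (Fin 2) ℝ (TangentSpace (𝓡∂ 2) x.pt) :=
  basisOfLinearIndependentOfCardEqFinrank x.linearIndependent
    (finrank_euclideanSpace (𝕜 := ℝ) (ι := Fin 2)).symm

theorem basis_apply (x : Frame S) (i : Fin 2) : x.basis i = x.vec i :=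
  congrFun (coe_basisOfLinearIndependentOfCardEqFinrank _ _) i

/-- The identification of `ℂ` with the tangent space that takes `(1, i)` to a given frame. -/
def comb (x : Frame S) : ℂ ≃ₗ[ℝ] TangentSpace (𝓡∂ 2) x.pt :=
  Complex.basisOneI.equivFun ≪≫ₗ x.basis.equivFun.symm

theorem comb_apply (x : Frame S) (z : ℂ) : x.comb z = z.re • x.vec 0 + z.im • x.vec 1 := by
  simp [comb, Module.Basis.equivFun_symm_apply, Fin.sum_univ_two, basis_apply]

theorem first_act (x : Frame S) (A : GL (Fin 2) ℝ) :
    (x.act A).first = ⟨x.pt, x.comb (firstCol A)⟩ := by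
  simp only [first, act, comb_apply, firstCol, Fin.sum_univ_two]

theorem first_eq (x : Frame S) : x.first = ⟨x.pt, x.comb 1⟩ := by
  simp [first, comb_apply]

theorem sameDirection_comb_iff (x : Frame S) {z w : ℂ} {α : ℝ} (hw : HasAngle w α) :
    SameDirection (⟨x.pt, x.comb z⟩ : TangentBundle (𝓡∂ 2) S) ⟨x.pt, x.comb w⟩ ↔
      HasAngle z α := by
  have hsmul : ∀ r : ℝ, x.comb z = r • x.comb w ↔ z = r * w := fun r => by
    rw [← map_smul, x.comb.injective.eq_iff, Complex.real_smul]
  simp only [sameDirection_mk_iff, hsmul]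
  exact ⟨fun ⟨r, hr, hz⟩ => hz ▸ hw.ofReal_mul hr, fun hz => hz.exists_eq_ofReal_mul hw⟩

theorem exists_comb_eq (x : Frame S) {u : TangentBundle (𝓡∂ 2) S} (hu : u.proj = x.pt)
    (h0 : u.snd ≠ 0) : ∃ z : ℂ, z ≠ 0 ∧ u = ⟨x.pt, x.comb z⟩ := by
  obtain ⟨y, v⟩ := u
  obtain rfl : y = x.pt := hu
  obtain ⟨z, rfl⟩ := x.comb.surjective v
  exact ⟨z, fun hz => h0 (by simp [hz]), rfl⟩

end Frame

/-! ### Germs of edges -/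

section Germs

theorem Graph.edgeOf_eq {Γ : Graph.{d, e}} {x : Γ.Edge} {h : Γ.H} (hx : h ∈ x.1) :
    Γ.edgeOf h = x := by
  obtain ⟨_, h', rfl⟩ := x
  apply Subtype.ext
  simp only [Graph.edgeOf]
  rcases Sym2.mem_iff.mp hx with rfl | rfl
  · rfl
  · rw [Γ.τ_τ, Sym2.eq_swap]

variable {Γ : Graph.{d, e}}

theorem halfEdgePath_zero {S : Type b} (γ : Γ.Realization → S) (h : Γ.H) :
    halfEdgePath γ h 0 = γ (Γ.point (.vert (Γ.src h))) := by
  rw [halfEdgePath, Set.projIcc_left]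
  exact congrArg γ (Quot.sound (Graph.Glue.start h))

theorem halfEdgePath_one {S : Type b} (γ : Γ.Realization → S) (h : Γ.H) :
    halfEdgePath γ h 1 = γ (Γ.point (.edge (Γ.edgeOf h))) := by
  rw [halfEdgePath, Set.projIcc_right]
  exact congrArg γ (Quot.sound (Graph.Glue.finish h))

theorem germ_proj (γ : Γ.Realization → S) (X : Γ.Cell) (i : Γ.star X) :
    (germ γ X i).proj = γ (Γ.point X) := by
  cases X with
  | vert v =>
    obtain ⟨h, rfl⟩ := i
    exact halfEdgePath_zero γ h
  | edge x =>
    obtain ⟨h, hx⟩ := i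
    obtain rfl := Graph.edgeOf_eq hx
    exact halfEdgePath_one γ h

/-- An immersion of class `C¹` of a graph: every segment is a regular curve, and the germs leaving
a given `0`-cell have distinct directions. Points of the graph may be identified, and `1`-valent
vertices may lie in the interior of the surface. -/
structure IsImmersed (γ : Γ.Realization → S) : Prop where
  contMDiffOn : ∀ h, ContMDiffOn 𝓘(ℝ, ℝ) (𝓡∂ 2) 1 (halfEdgePath γ h) (Set.Icc 0 1)
  regular : ∀ h, ∀ t ∈ Set.Icc (0 : ℝ) 1, (velocity γ h t).snd ≠ 0
  distinct : ∀ (X : Γ.Cell) (i j : Γ.star X), SameDirection (germ γ X i) (germ γ X j) → i = j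

theorem IsEmbedded.isImmersed {γ : Γ.Realization → S} (hγ : IsEmbedded γ) : IsImmersed γ where
  contMDiffOn h := (hγ.smooth h).of_le (by exact_mod_cast le_top)
  regular := hγ.regular
  distinct := hγ.distinct

theorem IsImmersed.germ_ne_zero {γ : Γ.Realization → S} (hγ : IsImmersed γ) (X : Γ.Cell)
    (i : Γ.star X) : (germ γ X i).snd ≠ 0 := by
  cases X with
  | vert v => exact hγ.regular i.1 0 (by simp)
  | edge x => exact neg_ne_zero.mpr (hγ.regular i.1 1 (by simp))

end Germs

/-! ### Principal bundles -/

variable [IsManifold (𝓡∂ 2) ∞ S]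

theorem isManifold_one : IsManifold (𝓡∂ 2) 1 S := .of_le (n := ∞) (by exact_mod_cast le_top)

theorem Frame.continuous_first_second :
    letI : IsManifold (𝓡∂ 2) 1 S := isManifold_one
    Continuous fun x : Frame S => (x.first, x.second) :=
  continuous_induced_dom

theorem Frame.continuous_pt : Continuous (Frame.pt : Frame S → S) := by
  have : IsManifold (𝓡∂ 2) 1 S := isManifold_one
  exact (FiberBundle.continuous_proj (EuclideanSpace ℝ (Fin 2))
    (TangentSpace (𝓡∂ 2) : S → Type _)).comp
    (continuous_fst.comp Frame.continuous_first_second)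

namespace GStructure

variable {𝔾 : Type a} [Group 𝔾] [TopologicalSpace 𝔾] {p : 𝔾 →* GL (Fin 2) ℝ}
  (Q : GStructure.{a, b, c} p S)

theorem pt_act (f : Q.F) (x : 𝔾) : (Q.ρ (Q.act f x)).pt = (Q.ρ f).pt := by
  rw [Q.ρ_act]
  rfl

theorem continuous_pt : Continuous fun f => (Q.ρ f).pt :=
  Frame.continuous_pt.comp Q.continuous_ρ

theorem exists_pt_eq (y : S) : ∃ f, (Q.ρ f).pt = y := by
  obtain ⟨U, -, hy, φ, hφ, -⟩ := Q.locally_trivial y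
  exact ⟨_, hφ ⟨y, hy⟩ 1⟩

theorem first_act (f : Q.F) (x : 𝔾) :
    (Q.ρ (Q.act f x)).first = ⟨(Q.ρ f).pt, (Q.ρ f).comb (firstCol (p x))⟩ := by
  rw [Q.ρ_act, Frame.first_act]

/-- A section of the principal bundle over `U`, with the trivialization that it defines. -/
structure LocalSection (U : Set S) where
  σ : U → Q.F
  continuous_σ : Continuous σ
  pt_σ : ∀ z, (Q.ρ (σ z)).pt = z
  coord : {f : Q.F // (Q.ρ f).pt ∈ U} → 𝔾
  continuous_coord : Continuous coord
  act_coord : ∀ f, Q.act (σ ⟨_, f.2⟩) (coord f) = f.1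
  coord_act : ∀ z x (hz : (Q.ρ (Q.act (σ z) x)).pt ∈ U), coord ⟨_, hz⟩ = x

theorem exists_localSection (y : S) :
    ∃ U : Set S, IsOpen U ∧ y ∈ U ∧ Nonempty (Q.LocalSection U) := by
  obtain ⟨U, hU, hy, φ, hpt, hmul⟩ := Q.locally_trivial y
  have hact : ∀ z x, (φ (z, x)).1 = Q.act (φ (z, 1)).1 x := fun z x => by rw [← hmul, one_mul]
  have hfst : ∀ f, (φ.symm f).1 = ⟨(Q.ρ f.1).pt, f.2⟩ := fun f => Subtype.ext (by
    rw [← hpt (φ.symm f).1 (φ.symm f).2]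
    simp)
  refine ⟨U, hU, hy, ⟨{
    σ := fun z => (φ (z, 1)).1
    continuous_σ := by fun_prop
    pt_σ := fun z => hpt z 1
    coord := fun f => (φ.symm f).2
    continuous_coord := by fun_prop
    act_coord := fun f => by
      rw [← hfst, ← hact]
      simp
    coord_act := fun z x hz => by
      have h : (⟨_, hz⟩ : {f : Q.F // (Q.ρ f).pt ∈ U}) = φ (z, x) := Subtype.ext (hact z x).symm
      rw [h]
      simp }⟩⟩

variable {Q} in
theorem LocalSection.eq_act {U : Set S} (s : Q.LocalSection U)
    (f f' : {f : Q.F // (Q.ρ f).pt ∈ U}) (h : (Q.ρ f'.1).pt = (Q.ρ f.1).pt) :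
    f'.1 = Q.act f.1 ((s.coord f)⁻¹ * s.coord f') := by
  have hz : (⟨_, f'.2⟩ : U) = ⟨_, f.2⟩ := Subtype.ext h
  calc f'.1 = Q.act (s.σ ⟨_, f'.2⟩) (s.coord f') := (s.act_coord f').symm
    _ = Q.act (s.σ ⟨_, f.2⟩) (s.coord f * ((s.coord f)⁻¹ * s.coord f')) := by
      rw [hz, mul_inv_cancel_left]
    _ = Q.act f.1 ((s.coord f)⁻¹ * s.coord f') := by rw [Q.act_mul, s.act_coord]

theorem exists_act_eq {f f' : Q.F} (h : (Q.ρ f').pt = (Q.ρ f).pt) : ∃ x, f' = Q.act f x := by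
  obtain ⟨U, -, hy, ⟨s⟩⟩ := Q.exists_localSection (Q.ρ f).pt
  exact ⟨_, s.eq_act ⟨f, hy⟩ ⟨f', h ▸ hy⟩ h⟩

theorem act_injective (f : Q.F) : Function.Injective (Q.act f) := by
  obtain ⟨U, -, hy, ⟨s⟩⟩ := Q.exists_localSection (Q.ρ f).pt
  have hf := s.act_coord ⟨f, hy⟩
  have hU : ∀ x, (Q.ρ (Q.act (s.σ ⟨_, hy⟩) x)).pt ∈ U := fun x => by
    rw [Q.pt_act, s.pt_σ]
    exact hy
  have hinj : Function.Injective (Q.act (s.σ ⟨_, hy⟩)) := fun x x' h => by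
    rw [← s.coord_act _ x (hU x), ← s.coord_act _ x' (hU x')]
    exact congrArg s.coord (Subtype.ext h)
  intro x x' h
  dsimp only at hf
  rw [← hf, ← Q.act_mul, ← Q.act_mul] at h
  exact mul_left_cancel (hinj h)

theorem exists_continuous_act_eq [IsTopologicalGroup 𝔾] {T : Type*} [TopologicalSpace T]
    {k k' : T → Q.F} (hk : Continuous k) (hk' : Continuous k')
    (h : ∀ t, (Q.ρ (k' t)).pt = (Q.ρ (k t)).pt) :
    ∃ g : T → 𝔾, Continuous g ∧ ∀ t, k' t = Q.act (k t) (g t) := by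
  choose g hg using fun t => Q.exists_act_eq (h t)
  refine ⟨g, continuous_iff_continuousAt.mpr fun t₀ => ?_, hg⟩
  obtain ⟨U, hU, hy, ⟨s⟩⟩ := Q.exists_localSection (Q.ρ (k t₀)).pt
  have hV : IsOpen {t | (Q.ρ (k t)).pt ∈ U} := hU.preimage (Q.continuous_pt.comp hk)
  refine ContinuousOn.continuousAt (s := {t | (Q.ρ (k t)).pt ∈ U}) ?_ (hV.mem_nhds hy)
  rw [continuousOn_iff_continuous_domRestrict]
  have hlocal : {t | (Q.ρ (k t)).pt ∈ U}.domRestrict g = fun t =>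
      (s.coord ⟨k t.1, t.2⟩)⁻¹ * s.coord ⟨k' t.1, by rw [h]; exact t.2⟩ := funext fun t =>
    Q.act_injective (k t.1) ((hg t.1).symm.trans (s.eq_act ⟨k t.1, t.2⟩ ⟨k' t.1, _⟩ (h t.1)))
  rw [hlocal]
  exact (s.continuous_coord.comp (by fun_prop)).inv.mul (s.continuous_coord.comp (by fun_prop))

end GStructure

end Surface

/-! ### Cyclically ordered directions -/

theorem hasAngle_iff_inv_norm_mul_eq {w : ℂ} (hw : w ≠ 0) {α : ℝ} :
    HasAngle w α ↔ (‖w‖ : ℂ)⁻¹ * w = Complex.exp (α * Complex.I) := by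
  rw [inv_mul_eq_iff_eq_mul₀ (by simpa using hw)]
  constructor
  · rintro ⟨r, hr, rfl⟩
    rw [norm_mul, Complex.norm_exp_ofReal_mul_I, mul_one, Complex.norm_real,
      Real.norm_of_nonneg hr.le]
  · exact fun h => ⟨_, norm_pos_iff.mpr hw, h⟩

theorem hasAngle_of_finite_directions {T ι : Type*} [TopologicalSpace T] [PreconnectedSpace T]
    {w : T → ℂ} (hw : Continuous w) {A : ι → ℝ}
    (hA : (Set.range fun l => Complex.exp (A l * Complex.I)).Finite)
    (h : ∀ t, ∃ l, HasAngle (w t) (A l)) {t₀ : T} {α : ℝ} (h₀ : HasAngle (w t₀) α) (t : T) :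
    HasAngle (w t) α := by
  have hne : ∀ t, w t ≠ 0 := fun t => (h t).choose_spec.ne_zero
  have hu : Continuous fun t => (‖w t‖ : ℂ)⁻¹ * w t :=
    (Continuous.inv₀ (by fun_prop) fun t => by simpa using hne t).mul hw
  have hconst : (‖w t‖ : ℂ)⁻¹ * w t = (‖w t₀‖ : ℂ)⁻¹ * w t₀ :=
    isPreconnected_univ.constant_of_mapsTo hA.isDiscrete hu.continuousOn
      (fun s _ => (h s).imp fun l hl => ((hasAngle_iff_inv_norm_mul_eq (hne s)).mp hl).symm)
      (Set.mem_univ _) (Set.mem_univ _)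
  rwa [hasAngle_iff_inv_norm_mul_eq (hne t), hconst, ← hasAngle_iff_inv_norm_mul_eq (hne t₀)]

theorem DeltaG.vertex_eq_vertex_iff {n : ℕ} {l l' : ℤ} :
    DeltaG.vertex n l = DeltaG.vertex n l' ↔ ∃ j : ℤ, l' = l + j * (n + 1) := by
  constructor
  · intro h
    have hn : (n : ℤ) + 1 ≠ 0 := by omega
    have hl := Int.emod_nonneg l hn
    have hl' := Int.emod_nonneg l' hn
    have hval := congrArg Fin.val h
    simp only [DeltaG.vertex] at hval
    have hmod : l % (n + 1) = l' % (n + 1) := by omega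
    refine ⟨l' / (n + 1) - l / (n + 1), ?_⟩
    linear_combination Int.emod_add_mul_ediv l (n + 1) - Int.emod_add_mul_ediv l' (n + 1) - hmod
  · rintro ⟨j, rfl⟩
    rw [DeltaG.vertex_add_mul]

/-- The extension of a sequence of angles `s 0, …, s n` to `ℤ` that gains `2π` in each period. -/
def periodicAngle {n : ℕ} (s : Fin (n + 1) → ℝ) (l : ℤ) : ℝ :=
  s (DeltaG.vertex n l) + 2 * Real.pi * ((l / (n + 1) : ℤ) : ℝ)

section PeriodicAngle

variable {n : ℕ} (s : Fin (n + 1) → ℝ)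

theorem periodicAngle_coe (i : Fin (n + 1)) : periodicAngle s ((i : ℕ) : ℤ) = s i := by
  rw [periodicAngle, DeltaG.vertex_coe, Int.ediv_eq_zero_of_lt (by omega)
    (by exact_mod_cast i.isLt), Int.cast_zero, mul_zero, add_zero]

theorem periodicAngle_add (l : ℤ) :
    periodicAngle s (l + (n + 1)) = periodicAngle s l + 2 * Real.pi := by
  have hvertex := DeltaG.vertex_add_mul n l 1
  rw [one_mul] at hvertex
  rw [periodicAngle, hvertex, Int.add_ediv_of_dvd_right (dvd_refl _), Int.ediv_self (by omega),
    periodicAngle]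
  push_cast
  ring

variable {s}

theorem strictMono_periodicAngle (hs : StrictMono s)
    (hmem : ∀ i, s i ∈ Set.Ioc (-Real.pi) Real.pi) : StrictMono (periodicAngle s) := by
  intro x y h
  have hn : (0 : ℤ) < n + 1 := by omega
  rw [periodicAngle, periodicAngle]
  rcases (Int.ediv_le_ediv hn h.le).eq_or_lt with hq | hq
  · have hv : DeltaG.vertex n x < DeltaG.vertex n y := by
      have hx := Int.emod_add_mul_ediv x (n + 1)
      have hy := Int.emod_add_mul_ediv y (n + 1)
      rw [hq] at hx
      have hmod : x % (n + 1) < y % (n + 1) := by linarith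
      have hnonneg := Int.emod_nonneg x hn.ne'
      exact Fin.lt_def.mpr ((Int.toNat_lt_toNat (hnonneg.trans_lt hmod)).mpr hmod)
    rw [hq]
    linarith [hs hv]
  · have hq' : ((x / (n + 1) : ℤ) : ℝ) + 1 ≤ ((y / (n + 1) : ℤ) : ℝ) := by exact_mod_cast hq
    have hgap := mul_le_mul_of_nonneg_left hq' (by positivity : 0 ≤ 2 * Real.pi)
    linarith [(hmem (DeltaG.vertex n y)).1, (hmem (DeltaG.vertex n x)).2]

theorem exists_hasAngle_periodicAngle_iff {w : ℂ} {i : Fin (n + 1)} :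
    (∃ l, DeltaG.vertex n l = i ∧ HasAngle w (periodicAngle s l)) ↔ HasAngle w (s i) := by
  constructor
  · rintro ⟨l, rfl, h⟩
    have hshift := h.add_two_pi_mul_int (-(l / (n + 1)))
    rwa [periodicAngle, Int.cast_neg, mul_neg, add_neg_cancel_right] at hshift
  · exact fun h => ⟨(i : ℕ), DeltaG.vertex_coe n i, by rwa [periodicAngle_coe]⟩

end PeriodicAngle

/-! ### Polar decompositions of marked frames -/

section Cells

variable {S : Type b} [TopologicalSpace S] [ChartedSpace (EuclideanHalfSpace 2) S]
  [IsManifold (𝓡∂ 2) ∞ S] {𝔾 : Type a} [Group 𝔾] [TopologicalSpace 𝔾] {p : 𝔾 →* GL (Fin 2) ℝ}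

/-- A point of `F` over the image of a `0`-cell, and the increasing sequence of the angles of the
germs leaving that cell in its frame. The sequence is indexed by `ℤ` and gains `2π` in each turn. -/
structure CellFrame (Q : GStructure.{a, b, c} p S) {Γ : Graph.{d, e}} (γ : Γ.Realization → S)
    (X : Γ.Cell) where
  base : Q.F
  base_pt : (Q.ρ base).pt = γ (Γ.point X)
  /-- the number of germs, minus one -/
  len : ℕ
  label : Fin (len + 1) ≃ Γ.star X
  angle : ℤ → ℝ
  strictMono_angle : StrictMono angle
  angle_add : ∀ l, angle (l + (len + 1)) = angle l + 2 * Real.pi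
  sameDirection_iff : ∀ x i, SameDirection (Q.ρ (Q.act base x)).first (germ γ X i) ↔
    ∃ l, label (DeltaG.vertex len l) = i ∧ HasAngle (firstCol (p x)) (angle l)

theorem exists_cellFrame (Q : GStructure.{a, b, c} p S) {Γ : Graph.{d, e}}
    {γ : Γ.Realization → S} (hγ : IsImmersed γ) (X : Γ.Cell) [Finite (Γ.star X)]
    [Nonempty (Γ.star X)] : Nonempty (CellFrame Q γ X) := by
  obtain ⟨f, hf⟩ := Q.exists_pt_eq (γ (Γ.point X))
  choose z hz0 hz using fun i => (Q.ρ f).exists_comb_eq (u := germ γ X i)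
    ((germ_proj γ X i).trans hf.symm) (hγ.germ_ne_zero X i)
  have hangle : ∀ i, HasAngle (z i) (z i).arg := fun i => hasAngle_arg (hz0 i)
  have hinj : Function.Injective fun i => (z i).arg := by
    intro i j hij
    apply hγ.distinct X
    rw [hz i, hz j, (Q.ρ f).sameDirection_comb_iff (hangle j),
      ← show (z i).arg = (z j).arg from hij]
    exact hangle i
  let _ : LinearOrder (Γ.star X) := LinearOrder.lift' _ hinj
  let _ : Fintype (Γ.star X) := Fintype.ofFinite _
  let σ := monoEquivOfFin (Γ.star X) (Nat.sub_add_cancel Fintype.card_pos).symm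
  have hmono : StrictMono fun i => (z (σ i)).arg := fun i j hij => σ.strictMono hij
  refine ⟨{ base := f
            base_pt := hf
            len := Fintype.card (Γ.star X) - 1
            label := σ.toEquiv
            angle := periodicAngle fun i => (z (σ i)).arg
            strictMono_angle := strictMono_periodicAngle hmono fun i => Complex.arg_mem_Ioc _
            angle_add := periodicAngle_add _
            sameDirection_iff := fun x i => ?_ }⟩
  obtain ⟨i, rfl⟩ := σ.surjective i
  rw [Q.first_act, hz, (Q.ρ f).sameDirection_comb_iff (hangle _),
    ← exists_hasAngle_periodicAngle_iff (s := fun i => (z (σ i)).arg)]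
  simp only [RelIso.coe_fn_toEquiv, EmbeddingLike.apply_eq_iff_eq]

theorem sameDirection_polar (Q : GStructure.{a, b, c} p S) (P : PolarLift p) {y : 𝔾} {ε : ℤˣ}
    (hy : p y = reflection ε) (f : Q.F) (α : ℝ) (x x' : ℝ × ℝ × ℝ) :
    SameDirection (Q.ρ (Q.act f (P.rot α * P.tri x * y))).first
      (Q.ρ (Q.act f (P.rot α * P.tri x' * y))).first := by
  rw [Q.first_act, Q.first_act, Frame.sameDirection_comb_iff _ (P.hasAngle_polar hy α x')]
  exact P.hasAngle_polar hy α x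

theorem frameClass_eq_of_polar [IsTopologicalGroup 𝔾] {Q : GStructure.{a, b, c} p S}
    {Γ : Graph.{d, e}} {γ : Γ.Realization → S} {X : Γ.Cell} (P : PolarLift p)
    {f f' : MarkedFrame Q γ X} {f₀ : Q.F} {α : ℝ} {x x' : ℝ × ℝ × ℝ} {y : 𝔾} {ε : ℤˣ}
    (hy : p y = reflection ε) (h : f.1 = Q.act f₀ (P.rot α * P.tri x * y))
    (h' : f'.1 = Q.act f₀ (P.rot α * P.tri x' * y)) : frameClass f = frameClass f' := by
  have htri := P.continuous_tri
  have hpath : Continuous fun t : unitInterval =>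
      Q.act f₀ (P.rot α * P.tri (x + (t : ℝ) • (x' - x)) * y) := by
    refine Q.continuous_act.comp (Continuous.prodMk continuous_const ?_)
    fun_prop
  have hmarked : ∀ t : unitInterval, ∃ i, SameDirection
      (Q.ρ (Q.act f₀ (P.rot α * P.tri (x + (t : ℝ) • (x' - x)) * y))).first (germ γ X i) := by
    intro t
    obtain ⟨i, hi⟩ := f.2
    rw [h] at hi
    exact ⟨i, (sameDirection_polar Q P hy f₀ α _ x).trans hi⟩
  refine Quotient.sound ⟨⟨⟨fun t => ⟨_, hmarked t⟩, Continuous.subtype_mk hpath _⟩,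
    Subtype.ext ?_, Subtype.ext ?_⟩⟩
  · simp [h]
  · simp [h']

namespace CellFrame

variable {Q : GStructure.{a, b, c} p S} {Γ : Graph.{d, e}} {γ : Γ.Realization → S} {X : Γ.Cell}

section

variable (D : CellFrame Q γ X)

theorem angle_add_mul (l j : ℤ) :
    D.angle (l + j * (D.len + 1)) = D.angle l + 2 * Real.pi * j := by
  induction j using Int.induction_on with
  | zero => simp
  | succ i ih =>
    rw [show l + ((i : ℤ) + 1) * (D.len + 1) = l + i * (D.len + 1) + (D.len + 1) by ring,
      D.angle_add, ih]
    push_cast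
    ring
  | pred i ih =>
    have h := D.angle_add (l + (-(i : ℤ) - 1) * (D.len + 1))
    rw [show l + (-(i : ℤ) - 1) * (D.len + 1) + (D.len + 1) = l + -(i : ℤ) * (D.len + 1) by ring,
      ih] at h
    push_cast at h ⊢
    linarith

/-- The periodic extension of the numbering of the germs. -/
def cyclicLabel (l : ℤ) : Γ.star X := D.label (DeltaG.vertex D.len l)

theorem marked_iff (x : 𝔾) : (∃ i, SameDirection (Q.ρ (Q.act D.base x)).first (germ γ X i)) ↔
    ∃ l, HasAngle (firstCol (p x)) (D.angle l) := by
  simp only [D.sameDirection_iff]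
  exact ⟨fun ⟨_, l, _, h⟩ => ⟨l, h⟩, fun ⟨l, h⟩ => ⟨_, l, rfl, h⟩⟩

theorem pt_eq (f : MarkedFrame Q γ X) : (Q.ρ f.1).pt = (Q.ρ D.base).pt := by
  obtain ⟨f, i, h⟩ := f
  rw [D.base_pt, ← germ_proj γ X i]
  exact h.proj_eq

theorem finite_directions : (Set.range fun l => Complex.exp (D.angle l * Complex.I)).Finite := by
  refine (Set.finite_range fun i : Fin (D.len + 1) =>
    Complex.exp (D.angle ((i : ℕ) : ℤ) * Complex.I)).subset ?_
  rintro _ ⟨l, rfl⟩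
  obtain ⟨j, hj⟩ :=
    DeltaG.vertex_eq_vertex_iff.mp (DeltaG.vertex_coe D.len (DeltaG.vertex D.len l))
  have hangle := D.angle_add_mul ((DeltaG.vertex D.len l : ℕ) : ℤ) j
  rw [← hj] at hangle
  refine ⟨DeltaG.vertex D.len l, Complex.exp_eq_exp_iff_exists_int.mpr ⟨-j, ?_⟩⟩
  rw [hangle]
  push_cast
  ring

variable (P : PolarLift p)

/-- The first vector of the marked frame `f` points along the germ with number `k`, and `y` is the
remaining component, over a reflection, of the polar decomposition of `f`. The triangular factor,
which does not change the class of `f`, is left unspecified. -/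
def HasPolar (f : MarkedFrame Q γ X) (k : ℤ) (y : 𝔾) : Prop :=
  ∃ x, f.1 = Q.act D.base (P.rot (D.angle k) * P.tri x * y)

/-- The marked frame with a given polar decomposition. -/
def polarFrame (k : ℤ) {ε : ℤˣ} {y : 𝔾} (hy : p y = reflection ε) (x : ℝ × ℝ × ℝ) :
    MarkedFrame Q γ X :=
  ⟨Q.act D.base (P.rot (D.angle k) * P.tri x * y),
    (D.marked_iff _).mpr ⟨k, P.hasAngle_polar hy _ _⟩⟩

theorem hasPolar_polarFrame (k : ℤ) {ε : ℤˣ} {y : 𝔾} (hy : p y = reflection ε) (x : ℝ × ℝ × ℝ) :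
    D.HasPolar P (D.polarFrame P k hy x) k y := ⟨x, rfl⟩

theorem exists_hasPolar (f : MarkedFrame Q γ X) :
    ∃ k ε y, p y = reflection ε ∧ D.HasPolar P f k y := by
  obtain ⟨g, hg⟩ := Q.exists_act_eq (D.pt_eq f)
  have hmarked := f.2
  rw [hg] at hmarked
  obtain ⟨k, hk⟩ := (D.marked_iff g).mp hmarked
  obtain ⟨x, ε, y, hy, hx⟩ := P.exists_polar hk
  exact ⟨k, ε, y, hy, x, by rw [hg, hx]⟩

end

namespace HasPolar

variable {D : CellFrame Q γ X} {P : PolarLift p} {f f' : MarkedFrame Q γ X} {k : ℤ} {y : 𝔾}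
  {ε : ℤˣ}

theorem sameDirection (h : D.HasPolar P f k y) (hy : p y = reflection ε) :
    SameDirection (Q.ρ f.1).first (germ γ X (D.cyclicLabel k)) := by
  obtain ⟨x, hx⟩ := h
  rw [hx, D.sameDirection_iff]
  exact ⟨k, rfl, P.hasAngle_polar hy _ _⟩

variable [IsTopologicalGroup 𝔾]

theorem exists_int_eq {k' : ℤ} {y' : 𝔾} {ε' : ℤˣ} (h : D.HasPolar P f k y)
    (h' : D.HasPolar P f k' y') (hy : p y = reflection ε) (hy' : p y' = reflection ε') :
    ∃ j : ℤ, k' = k + j * (D.len + 1) ∧ y = P.rot (2 * Real.pi * j) * y' := by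
  obtain ⟨x, hx⟩ := h
  obtain ⟨x', hx'⟩ := h'
  obtain ⟨j, hangle, hj⟩ :=
    P.exists_int_of_polar_eq hy hy' (Q.act_injective _ (hx.symm.trans hx'))
  refine ⟨j, D.strictMono_angle.injective ?_, hj⟩
  rw [hangle, D.angle_add_mul]

theorem shift {j : ℤ} {y' : 𝔾} (h : D.HasPolar P f k y) (hy : y = P.rot (2 * Real.pi * j) * y') :
    D.HasPolar P f (k + j * (D.len + 1)) y' := by
  obtain ⟨x, hx⟩ := h
  subst hy
  refine ⟨x, ?_⟩
  rw [hx, D.angle_add_mul, P.rot_add, ← mul_assoc, mul_assoc (P.rot _) (P.tri x),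
    ← P.rot_two_pi_mul_int_mul_tri, ← mul_assoc]

theorem frameClass_eq (hy : p y = reflection ε) (h : D.HasPolar P f k y)
    (h' : D.HasPolar P f' k y) : frameClass f = frameClass f' :=
  frameClass_eq_of_polar P hy h.choose_spec h'.choose_spec

/-- Along a path of marked frames the first vector keeps its direction, as there are only finitely
many germs. -/
theorem of_frameClass_eq (hy : p y = reflection ε) (h : D.HasPolar P f k y)
    (hf : frameClass f = frameClass f') : D.HasPolar P f' k y := by
  obtain ⟨π⟩ : Joined f f' := Quotient.exact hf
  have hπ : Continuous fun t => (π t).1 := continuous_subtype_val.comp π.continuous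
  obtain ⟨g, hg, hgπ⟩ := Q.exists_continuous_act_eq (k := fun _ => D.base) continuous_const hπ
    (fun t => D.pt_eq (π t))
  obtain ⟨x, hx⟩ := h
  have hg0 : g 0 = P.rot (D.angle k) * P.tri x * y := by
    apply Q.act_injective D.base
    rw [← hgπ, ← hx, π.source]
  have hmarked : ∀ t, ∃ l, HasAngle (firstCol (p (g t))) (D.angle l) := fun t => by
    rw [← D.marked_iff, ← hgπ]
    exact (π t).2
  have hangle₀ : HasAngle (firstCol (p (g 0))) (D.angle k) := by
    rw [hg0]
    exact P.hasAngle_polar hy _ _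
  have hangle : ∀ t, HasAngle (firstCol (p (g t))) (D.angle k) :=
    hasAngle_of_finite_directions (w := fun t => firstCol (p (g t)))
      (continuous_firstCol.comp (P.isCoveringMap.continuous.comp hg)) D.finite_directions hmarked
      hangle₀
  obtain ⟨x', hx'⟩ := P.polar_continuation hg continuous_const hangle hy hg0 1
  exact ⟨x', by rw [← hx', ← hgπ, π.target]⟩

end HasPolar

end CellFrame

end Cells

/-! ### The structured set of a cell -/

section StructuredCells

variable {S : Type b} [TopologicalSpace S] [ChartedSpace (EuclideanHalfSpace 2) S]
  [IsManifold (𝓡∂ 2) ∞ S] {𝔾 : Type a} [Group 𝔾] [TopologicalSpace 𝔾] {p : 𝔾 →* GL (Fin 2) ℝ}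

namespace CellFrame

variable {Q : GStructure.{a, b, c} p S} {Γ : Graph.{d, e}} {γ : Γ.Realization → S} {X : Γ.Cell}

section

variable (D : CellFrame Q γ X)

theorem marked_iff_exists_eq {x : 𝔾} {α : ℝ} (h : HasAngle (firstCol (p x)) α) :
    (∃ i, SameDirection (Q.ρ (Q.act D.base x)).first (germ γ X i)) ↔ ∃ l, α = D.angle l := by
  rw [D.marked_iff]
  constructor
  · rintro ⟨l, hl⟩
    obtain ⟨j, hj⟩ := hl.exists_int_eq h
    exact ⟨l + j * (D.len + 1), by rw [hj, D.angle_add_mul]⟩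
  · rintro ⟨l, rfl⟩
    exact ⟨l, h⟩

theorem angle_step_pos (k : ℤ) (ε : ℤˣ) :
    0 < ((ε : ℤ) : ℝ) * (D.angle (k + ε) - D.angle k) := by
  rcases Int.units_eq_one_or ε with rfl | rfl
  · simpa using D.strictMono_angle (show k < k + ((1 : ℤˣ) : ℤ) by simp)
  · simpa using D.strictMono_angle (show k + ((-1 : ℤˣ) : ℤ) < k by simp)

theorem angle_step_le (k : ℤ) (ε : ℤˣ) :
    ((ε : ℤ) : ℝ) * (D.angle (k + ε) - D.angle k) ≤ 2 * Real.pi := by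
  rcases Int.units_eq_one_or ε with rfl | rfl
  · have hle := D.strictMono_angle.monotone (show k + ((1 : ℤˣ) : ℤ) ≤ k + (D.len + 1) by simp)
    rw [D.angle_add] at hle
    simp only [Units.val_one, Int.cast_one, one_mul] at hle ⊢
    linarith
  · have hle := D.strictMono_angle.monotone
      (show k ≤ k + ((-1 : ℤˣ) : ℤ) + (D.len + 1) by
        simp only [Units.val_neg, Units.val_one]; omega)
    rw [D.angle_add] at hle
    simp only [Units.val_neg, Units.val_one, Int.cast_neg, Int.cast_one] at hle ⊢
    linarith

theorem eq_or_angle_step_lt {k l : ℤ} {ε : ℤˣ}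
    (h : 0 < ((ε : ℤ) : ℝ) * (D.angle l - D.angle k)) : l = k + ε ∨
      ((ε : ℤ) : ℝ) * (D.angle (k + ε) - D.angle k) <
        ((ε : ℤ) : ℝ) * (D.angle l - D.angle k) := by
  rcases Int.units_eq_one_or ε with rfl | rfl
  · simp only [Units.val_one, Int.cast_one, one_mul] at h ⊢
    have hlt : k < l := D.strictMono_angle.lt_iff_lt.mp (by linarith)
    rcases (show l = k + 1 ∨ k + 1 < l by omega) with heq | hlt
    · exact Or.inl heq
    · exact Or.inr (by linarith [D.strictMono_angle hlt])
  · simp only [Units.val_neg, Units.val_one, Int.cast_neg, Int.cast_one] at h ⊢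
    have hlt : l < k := D.strictMono_angle.lt_iff_lt.mp (by linarith)
    rcases (show l = k + -1 ∨ l < k + -1 by omega) with heq | hlt
    · exact Or.inl heq
    · exact Or.inr (by linarith [D.strictMono_angle hlt])

theorem angle_ne_of_lt_angle_step {k : ℤ} {ε : ℤˣ} {δ : ℝ} (hδ : 0 < δ)
    (hlt : δ < ((ε : ℤ) : ℝ) * (D.angle (k + ε) - D.angle k)) (l : ℤ) :
    D.angle k + ((ε : ℤ) : ℝ) * δ ≠ D.angle l := by
  intro hl
  have hstep : ((ε : ℤ) : ℝ) * (D.angle l - D.angle k) = δ := by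
    rw [← hl, add_sub_cancel_left, ← mul_assoc, coe_units_mul_self, one_mul]
  rcases D.eq_or_angle_step_lt (hδ.trans_eq hstep.symm) with rfl | h
  · linarith
  · linarith

theorem eq_add_of_forall_ne {A : ℝ → ℝ} (hA : Continuous A) {θ : ℝ} (hθ : 0 ≤ θ) {k l : ℤ}
    {ε : ℤˣ} (h₀ : A 0 = D.angle k) (h₁ : A θ = D.angle l)
    (hpos : 0 < ((ε : ℤ) : ℝ) * (A θ - D.angle k))
    (hne : ∀ φ ∈ Set.Ioo 0 θ, ∀ m, A φ ≠ D.angle m) : l = k + ε := by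
  rw [h₁] at hpos
  refine (D.eq_or_angle_step_lt hpos).resolve_right fun hlt => ?_
  obtain ⟨φ, hφ, hstep⟩ := intermediate_value_Ioo hθ
    (f := fun φ => ((ε : ℤ) : ℝ) * (A φ - D.angle k)) (by fun_prop)
    ⟨by simpa only [h₀, sub_self, mul_zero] using D.angle_step_pos k ε,
      by simpa only [h₁] using hlt⟩
  have hcancel := congrArg (((ε : ℤ) : ℝ) * ·) hstep
  simp only [← mul_assoc, coe_units_mul_self, one_mul] at hcancel
  exact hne φ hφ (k + ε) (sub_left_injective hcancel)

end

theorem HasPolar.act {D : CellFrame Q γ X} {P : PolarLift p} {f f' : MarkedFrame Q γ X}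
    {k : ℤ} {y x : 𝔾} (h : D.HasPolar P f k y) (hf : f'.1 = Q.act f.1 x) :
    D.HasPolar P f' k (y * x) := by
  obtain ⟨b, hb⟩ := h
  exact ⟨b, by rw [hf, hb, ← Q.act_mul, mul_assoc _ y]⟩

theorem exists_rot_of_isNext (P : PolarLift p) {f f' : MarkedFrame Q γ X} (hn : IsNext f f') :
    ∃ θ, 0 < θ ∧ f'.1 = Q.act f.1 (P.rot θ) ∧ ∀ φ ∈ Set.Ioo 0 θ, ∀ i,
      ¬ SameDirection (Q.ρ (Q.act f.1 (P.rot φ))).first (germ γ X i) := by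
  obtain ⟨θ, hθ, -, r, hr, hr0, hpr, hf', hno⟩ := hn
  have hrot := P.continuous_rot
  have hr_eq : ∀ t, r t = P.rot (θ * t) := P.eq_of_map_eq hr (by fun_prop)
    (fun t => by rw [hpr, P.map_rot]) 0 (by simp [hr0, P.rot_zero])
  refine ⟨θ, hθ, by rw [hf', hr_eq, Set.Icc.coe_one, mul_one], fun φ ⟨hφ, hφθ⟩ i => ?_⟩
  have hpos : 0 < φ / θ := div_pos hφ hθ
  have hlt : φ / θ < 1 := (div_lt_one hθ).mpr hφθ
  have hi := hno ⟨φ / θ, hpos.le, hlt.le⟩ (Subtype.mk_lt_mk.mpr hpos) (Subtype.mk_lt_mk.mpr hlt) i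
  rwa [hr_eq, mul_div_cancel₀ _ hθ.ne'] at hi

variable [IsTopologicalGroup 𝔾]

theorem HasPolar.of_isNext {D : CellFrame Q γ X} {P : PolarLift p} {f f' : MarkedFrame Q γ X}
    {k : ℤ} {y : 𝔾} {ε : ℤˣ} (hy : p y = reflection ε) (h : D.HasPolar P f k y)
    (hn : IsNext f f') : D.HasPolar P f' (k + ε) y := by
  obtain ⟨x, hx⟩ := h
  obtain ⟨θ, hθ, hf', hno⟩ := exists_rot_of_isNext P hn
  obtain ⟨A, hA, hA0, hApos, hAangle⟩ := P.exists_angle_mul_rot (α := D.angle k) (x := x) hy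
  have hrot := P.continuous_rot
  have hact : ∀ φ, Q.act f.1 (P.rot φ) =
      Q.act D.base (P.rot (D.angle k) * P.tri x * y * P.rot φ) := fun φ => by
    rw [hx, ← Q.act_mul]
  obtain ⟨l, hl⟩ : ∃ l, A θ = D.angle l := by
    rw [← D.marked_iff_exists_eq (hAangle θ), ← hact, ← hf']
    exact f'.2
  have hlk : l = k + ε := by
    refine D.eq_add_of_forall_ne hA hθ.le hA0 hl (hApos θ hθ) fun φ hφ m hm => ?_
    obtain ⟨i, hi⟩ := (D.marked_iff_exists_eq (hAangle φ)).mpr ⟨m, hm⟩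
    rw [← hact] at hi
    exact hno φ hφ i hi
  obtain ⟨x', hx'⟩ := P.polar_continuation
    (g := fun φ => P.rot (D.angle k) * P.tri x * y * P.rot φ) (by fun_prop) hA hAangle hy
    (t₀ := 0) (x₀ := x) (by rw [hA0, P.rot_zero, mul_one]) θ
  exact ⟨x', by rw [hf', hact, hx', hl, hlk]⟩

theorem isNext_polarFrame (D : CellFrame Q γ X) (P : PolarLift p) (k : ℤ) {y : 𝔾} {ε : ℤˣ}
    (hy : p y = reflection ε) :
    IsNext (D.polarFrame P k hy 0) (D.polarFrame P (k + ε) hy 0) := by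
  have hrot := P.continuous_rot
  have hact : ∀ φ, Q.act (D.polarFrame P k hy 0).1 (P.rot φ) =
      Q.act D.base (P.rot (D.angle k + ((ε : ℤ) : ℝ) * φ) * P.tri 0 * y) := by
    intro φ
    rw [polarFrame, ← Q.act_mul, mul_assoc _ y, P.mul_rot hy, P.rot_add, P.tri_zero]
    simp only [mul_one, mul_assoc]
  set θ := ((ε : ℤ) : ℝ) * (D.angle (k + ε) - D.angle k) with hθ
  have hθ0 : 0 < θ := D.angle_step_pos k ε
  refine ⟨θ, hθ0, D.angle_step_le k ε, fun t => P.rot (θ * t), by fun_prop,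
    by simp only [Set.Icc.coe_zero, mul_zero, P.rot_zero], fun t => P.map_rot _, ?_,
    fun t h0 h1 i hi => ?_⟩
  · rw [hact, Set.Icc.coe_one, mul_one, hθ, ← mul_assoc, coe_units_mul_self, one_mul,
      add_sub_cancel]
    rfl
  · rw [hact] at hi
    obtain ⟨l, hl⟩ := (D.marked_iff_exists_eq (P.hasAngle_polar hy _ _)).mp ⟨i, hi⟩
    exact D.angle_ne_of_lt_angle_step (mul_pos hθ0 h0) (mul_lt_of_lt_one_right hθ0 h1) l hl

variable (D : CellFrame Q γ X) (P : PolarLift p)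

/-- The orbit map of the torsor of classes of marked frames: the class of `(F, x)` is sent to the
class of the frames whose first vector points along the germ with number `F 0`, and whose component
over a reflection is `x`. -/
def frameMap (u : (⟨D.len⟩ : DeltaG p) ≅ ⟨D.len⟩) : FrameClass Q γ X :=
  Quotient.liftOn u.hom (fun w => frameClass (D.polarFrame P (w.toFun 0) w.map_elt 0)) (by
    intro w w' h
    obtain ⟨j, hj, he⟩ := P.rel_iff.mp h
    have hshift := (D.hasPolar_polarFrame P (w.toFun 0) w.map_elt 0).shift he
    rw [← hj 0] at hshift
    exact hshift.frameClass_eq w'.map_elt (D.hasPolar_polarFrame P _ _ _))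

theorem frameMap_affine {f : MarkedFrame Q γ X} {k : ℤ} {y : 𝔾} {ε : ℤˣ}
    (hy : p y = reflection ε) (h : D.HasPolar P f k y) :
    D.frameMap P (DeltaG.affine D.len k ε y hy) = frameClass f := by
  change frameClass (D.polarFrame P (k + ε * 0) hy 0) = _
  rw [mul_zero, add_zero]
  exact (D.hasPolar_polarFrame P k hy 0).frameClass_eq hy h

theorem frameMap_injective : Function.Injective (D.frameMap P) := by
  intro u u' h
  obtain ⟨k, ε, y, hy, rfl⟩ := DeltaG.exists_eq_affine u
  obtain ⟨k', ε', y', hy', rfl⟩ := DeltaG.exists_eq_affine u'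
  rw [D.frameMap_affine P hy (D.hasPolar_polarFrame P k hy 0),
    D.frameMap_affine P hy' (D.hasPolar_polarFrame P k' hy' 0)] at h
  obtain ⟨j, hj, he⟩ := ((D.hasPolar_polarFrame P k hy 0).of_frameClass_eq hy h).exists_int_eq
    (D.hasPolar_polarFrame P k' hy' 0) hy hy'
  have hε : ε = ε' := reflection_injective (by
    rw [← hy, ← hy', he, map_mul, P.map_rot, rotation_two_pi_mul_int, one_mul])
  subst hε
  ext
  refine Quotient.sound (P.rel_iff.mpr ⟨j, fun l => ?_, he⟩)
  change k' + ε * l = k + ε * l + j * (D.len + 1)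
  rw [hj]
  ring

theorem frameMap_surjective : Function.Surjective (D.frameMap P) := by
  intro o
  obtain ⟨f, rfl⟩ := Quotient.exists_rep o
  obtain ⟨k, ε, y, hy, h⟩ := D.exists_hasPolar P f
  exact ⟨_, D.frameMap_affine P hy h⟩

/-- The trivialization of the torsor of classes of marked frames by its orbit map. -/
def frameEquiv : ((⟨D.len⟩ : DeltaG p) ≅ ⟨D.len⟩) ≃ FrameClass Q γ X :=
  Equiv.ofBijective _ ⟨D.frameMap_injective P, D.frameMap_surjective P⟩

theorem frameEquiv_symm {f : MarkedFrame Q γ X} {k : ℤ} {y : 𝔾} {ε : ℤˣ}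
    (hy : p y = reflection ε) (h : D.HasPolar P f k y) :
    (D.frameEquiv P).symm (frameClass f) = DeltaG.affine D.len k ε y hy := by
  rw [Equiv.symm_apply_eq]
  exact (D.frameMap_affine P hy h).symm

/-- The structured set of the germs leaving a cell. Its frames are the classes of marked frames, on
which the automorphism group acts through `frameEquiv`. -/
def structuredSet : StructuredSet.{a, d, c} p where
  carrier := Γ.star X
  len := D.len
  Frame := FrameClass Q γ X
  frame_nonempty := ⟨D.frameEquiv P (Iso.refl _)⟩
  act o u := D.frameEquiv P (u ≪≫ (D.frameEquiv P).symm o)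
  act_refl o := by simp
  act_trans o u v := by simp
  existsUnique_act o o' := by
    refine ⟨(D.frameEquiv P).symm o' ≪≫ ((D.frameEquiv P).symm o).symm, ?_, fun u hu => ?_⟩
    · simp
    · rw [← hu]
      simp
  label o :=
    { toFun := fun i => D.label (DeltaG.vertexMap ((D.frameEquiv P).symm o).hom i)
      invFun := fun i => DeltaG.vertexMap ((D.frameEquiv P).symm o).inv (D.label.symm i)
      left_inv := fun i => by
        beta_reduce
        rw [Equiv.symm_apply_apply, ← DeltaG.vertexMap_comp, Iso.hom_inv_id, DeltaG.vertexMap_id]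
      right_inv := fun i => by
        beta_reduce
        rw [← DeltaG.vertexMap_comp, Iso.inv_hom_id, DeltaG.vertexMap_id,
          Equiv.apply_symm_apply] }
  label_act o u i := by
    simp only [Equiv.symm_apply_apply, Equiv.coe_fn_mk, Iso.trans_hom]
    rw [DeltaG.vertexMap_comp]

theorem structuredSet_act {f f' : MarkedFrame Q γ X} {k k' : ℤ} {y y' : 𝔾} {ε ε' : ℤˣ}
    (hy : p y = reflection ε) (hy' : p y' = reflection ε') (h : D.HasPolar P f k y)
    (h' : D.HasPolar P f' (k + ε * k') (y * y')) :
    (D.structuredSet P).act (frameClass f) (DeltaG.affine D.len k' ε' y' hy') = frameClass f' := by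
  change D.frameEquiv P (_ ≪≫ (D.frameEquiv P).symm (frameClass f)) = _
  rw [D.frameEquiv_symm P hy h, DeltaG.affine_trans]
  exact D.frameMap_affine P _ h'

theorem structuredSet_label {f : MarkedFrame Q γ X} {k : ℤ} {y : 𝔾} {ε : ℤˣ}
    (hy : p y = reflection ε) (h : D.HasPolar P f k y) (i : Fin (D.len + 1)) :
    (D.structuredSet P).label (frameClass f) i = D.cyclicLabel (k + ε * (i : ℕ)) := by
  change D.label (DeltaG.vertexMap ((D.frameEquiv P).symm (frameClass f)).hom i) = _
  rw [D.frameEquiv_symm P hy h, DeltaG.vertexMap_affine]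
  rfl

end CellFrame

end StructuredCells

/-! ### Uniqueness of transport -/

section Transport

variable {S : Type b} [TopologicalSpace S] [ChartedSpace (EuclideanHalfSpace 2) S]

theorem SameDirection.neg {u w : TangentBundle (𝓡∂ 2) S} (h : SameDirection u w) :
    SameDirection (⟨u.proj, -u.snd⟩ : TangentBundle (𝓡∂ 2) S) ⟨w.proj, -w.snd⟩ := by
  obtain ⟨r, hr, rfl⟩ := h
  exact sameDirection_mk_iff.mpr ⟨r, hr, by rw [smul_neg]⟩

variable [IsManifold (𝓡∂ 2) ∞ S] {𝔾 : Type a} [Group 𝔾] [TopologicalSpace 𝔾]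
  {p : 𝔾 →* GL (Fin 2) ℝ} {Q : GStructure.{a, b, c} p S}

section Directions

variable {f : Q.F} {u : TangentBundle (𝓡∂ 2) S} (hu : SameDirection (Q.ρ f).first u) (x : 𝔾)

include hu

theorem sameDirection_act_iff :
    SameDirection (Q.ρ (Q.act f x)).first u ↔ HasAngle (firstCol (p x)) 0 := by
  rw [Frame.first_eq] at hu
  rw [← (Q.ρ f).sameDirection_comb_iff hasAngle_one, Q.first_act]
  exact ⟨fun h => h.trans hu.symm, fun h => h.trans hu⟩

theorem sameDirection_act_neg_iff :
    SameDirection (Q.ρ (Q.act f x)).first ⟨u.proj, -u.snd⟩ ↔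
      HasAngle (firstCol (p x)) Real.pi := by
  have hneg := hu.neg
  rw [Frame.first_eq, ← map_neg] at hneg
  rw [← (Q.ρ f).sameDirection_comb_iff hasAngle_neg_one, Q.first_act]
  exact ⟨fun h => h.trans hneg.symm, fun h => h.trans hneg⟩

end Directions

variable {Γ : Graph.{d, e}} {γ : Γ.Realization → S}

theorem sameDirection_germ_tau {h : Γ.H} (f : MarkedFrame Q γ (.edge (Γ.edgeOf h)))
    (hf : ¬ SameDirection (Q.ρ f.1).first (midpointGerm γ h)) :
    SameDirection (Q.ρ f.1).first (midpointGerm γ (Γ.τ h)) := by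
  obtain ⟨f, ⟨h', hh'⟩, hi⟩ := f
  rcases Sym2.mem_iff.mp hh' with rfl | rfl
  · exact absurd hi hf
  · exact hi

namespace IsTransport

variable {h : Γ.H} {f : MarkedFrame Q γ (.vert (Γ.src h))}
  {f' : MarkedFrame Q γ (.edge (Γ.edgeOf h))}

theorem sameDirection_fst (ht : IsTransport h f f') :
    SameDirection (Q.ρ f.1).first (velocity γ h 0) := by
  obtain ⟨k, k', -, -, h0, hk, -⟩ := ht
  rw [← h0]
  exact hk 0

theorem sameDirection_snd (ht : IsTransport h f f') :
    SameDirection (Q.ρ f'.1).first (midpointGerm γ (Γ.τ h)) := by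
  obtain ⟨k, k', -, -, -, -, -, hk', h1⟩ := ht
  refine sameDirection_germ_tau f' ?_
  rw [← h1]
  exact (hk' 1).2

end IsTransport

theorem angle_eq_of_sameDirection (P : PolarLift p) {f : Q.F} {u : TangentBundle (𝓡∂ 2) S}
    {α α' : ℝ} {x x' : ℝ × ℝ × ℝ} {y y' : 𝔾} {ε ε' : ℤˣ} (hy : p y = reflection ε)
    (hy' : p y' = reflection ε') (hα : α ∈ Set.Ioc (-Real.pi) Real.pi)
    (hα' : α' ∈ Set.Ioc (-Real.pi) Real.pi)
    (h : SameDirection (Q.ρ (Q.act f (P.rot α * P.tri x * y))).first u)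
    (h' : SameDirection (Q.ρ (Q.act f (P.rot α' * P.tri x' * y'))).first u) : α = α' := by
  have hsame := h.trans h'.symm
  rw [Q.first_act, Q.first_act, Frame.sameDirection_comb_iff _ (P.hasAngle_polar hy' α' x')]
    at hsame
  rw [← (P.hasAngle_polar hy α x).arg_eq hα, hsame.arg_eq hα']

variable [IsTopologicalGroup 𝔾]

theorem exists_act_tri_mul_eq (P : PolarLift p) {k k' : unitInterval → Q.F} (hk : Continuous k)
    (hk' : Continuous k') {u : unitInterval → TangentBundle (𝓡∂ 2) S}
    (h : ∀ t, SameDirection (Q.ρ (k t)).first (u t))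
    (h' : ∀ t, SameDirection (Q.ρ (k' t)).first (u t)) :
    ∃ ε y, p y = reflection ε ∧ ∀ t, ∃ x, k' t = Q.act (k t) (P.tri x * y) := by
  obtain ⟨g, hg, hgk⟩ := Q.exists_continuous_act_eq hk hk'
    (fun t => (h' t).proj_eq.trans (h t).proj_eq.symm)
  have hangle : ∀ t, HasAngle (firstCol (p (g t))) 0 := fun t =>
    (sameDirection_act_iff (h t) _).mp (by rw [← hgk]; exact h' t)
  obtain ⟨x₀, ε, y, hy, hx₀⟩ := P.exists_polar (hangle 0)
  refine ⟨ε, y, hy, fun t => ?_⟩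
  obtain ⟨x, hx⟩ := P.polar_continuation hg (continuous_const (y := (0 : ℝ))) hangle hy hx₀ t
  exact ⟨x, by rw [hgk, hx, P.rot_zero, one_mul]⟩

/-- As the first vector avoids the direction opposite to `u`, the principal value of its angle is
continuous along the path. -/
theorem exists_act_rot_mul_tri_mul_eq (P : PolarLift p) {f : Q.F} {u : TangentBundle (𝓡∂ 2) S}
    (hu : SameDirection (Q.ρ f).first u) {k : unitInterval → Q.F} (hk : Continuous k)
    (hpt : ∀ t, (Q.ρ (k t)).pt = (Q.ρ f).pt)
    (hne : ∀ t, ¬ SameDirection (Q.ρ (k t)).first ⟨u.proj, -u.snd⟩) {x : ℝ × ℝ × ℝ} {y : 𝔾}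
    {ε : ℤˣ} (hy : p y = reflection ε) (h₀ : k 0 = Q.act f (P.tri x * y)) :
    ∃ α ∈ Set.Ioc (-Real.pi) Real.pi, ∃ x', k 1 = Q.act f (P.rot α * P.tri x' * y) := by
  obtain ⟨g, hg, hgk⟩ := Q.exists_continuous_act_eq (k := fun _ => f) continuous_const hk hpt
  have hfirst : Continuous fun t => firstCol (p (g t)) :=
    continuous_firstCol.comp (P.isCoveringMap.continuous.comp hg)
  have hslit : ∀ t, firstCol (p (g t)) ∈ Complex.slitPlane := fun t => by
    refine mem_slitPlane_of_not_hasAngle_pi (firstCol_ne_zero _) ?_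
    rw [← sameDirection_act_neg_iff hu, ← hgk]
    exact hne t
  have harg : Continuous fun t => (firstCol (p (g t))).arg :=
    continuous_iff_continuousAt.mpr fun t =>
      ContinuousAt.comp (g := Complex.arg) (Complex.continuousAt_arg (hslit t))
        hfirst.continuousAt
  have hg₀ : g 0 = P.rot 0 * P.tri x * y := by
    apply Q.act_injective f
    rw [← hgk, h₀, P.rot_zero, one_mul]
  have harg₀ : (firstCol (p (g 0))).arg = 0 := by
    rw [hg₀]
    exact (P.hasAngle_polar hy _ _).arg_eq ⟨neg_lt_zero.mpr Real.pi_pos, Real.pi_pos.le⟩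
  obtain ⟨x', hx'⟩ := P.polar_continuation hg harg (fun t => hasAngle_arg (firstCol_ne_zero _)) hy
    (hg₀.trans (by rw [harg₀])) 1
  exact ⟨_, Complex.arg_mem_Ioc _, x', by rw [hgk, ← hx']⟩

theorem IsTransport.unique (P : PolarLift p) {h : Γ.H}
    {f₁ f₂ : MarkedFrame Q γ (.vert (Γ.src h))} {f₁' f₂' : MarkedFrame Q γ (.edge (Γ.edgeOf h))}
    (ht₁ : IsTransport h f₁ f₁') (ht₂ : IsTransport h f₂ f₂') :
    ∃ ε x, p x = reflection ε ∧
      (∀ f : MarkedFrame Q γ (.vert (Γ.src h)), f.1 = Q.act f₁.1 x →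
        frameClass f = frameClass f₂) ∧
      ∀ f' : MarkedFrame Q γ (.edge (Γ.edgeOf h)), f'.1 = Q.act f₁'.1 x →
        frameClass f' = frameClass f₂' := by
  have hs₁ := ht₁.sameDirection_snd
  have hs₂ := ht₂.sameDirection_snd
  obtain ⟨k₁, k₁', hk₁, hk₁', h₁0, hd₁, h₁1, hd₁', h₁e⟩ := ht₁
  obtain ⟨k₂, k₂', hk₂, hk₂', h₂0, hd₂, h₂1, hd₂', h₂e⟩ := ht₂
  have hpt : γ (Γ.point (.edge (Γ.edgeOf h))) = (Q.ρ (k₁ 1)).pt := by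
    rw [← halfEdgePath_one γ h]
    exact (hd₁ 1).proj_eq.symm
  obtain ⟨ε, y, hy, hxy⟩ := exists_act_tri_mul_eq P hk₁ hk₂ hd₁ hd₂
  obtain ⟨x₀, hx₀⟩ := hxy 0
  obtain ⟨x₁, hx₁⟩ := hxy 1
  obtain ⟨α₁, hα₁, b₁, hb₁⟩ := exists_act_rot_mul_tri_mul_eq P (hd₁ 1) hk₁'
    (fun t => (hd₁' t).1.trans hpt) (fun t => (hd₁' t).2) (map_one_eq_reflection p) (x := 0)
    (by rw [h₁1, P.tri_zero, mul_one, Q.act_one])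
  obtain ⟨α₂, hα₂, b₂, hb₂⟩ := exists_act_rot_mul_tri_mul_eq P (hd₁ 1) hk₂'
    (fun t => (hd₂' t).1.trans hpt) (fun t => (hd₂' t).2) hy (h₂1.trans hx₁)
  have hα : α₁ = α₂ := by
    rw [← h₁e, hb₁] at hs₁
    rw [← h₂e, hb₂] at hs₂
    exact angle_eq_of_sameDirection P (map_one_eq_reflection p) hy hα₁ hα₂ hs₁ hs₂
  refine ⟨ε, y, hy, fun f hf => ?_, fun f' hf' => ?_⟩
  · refine frameClass_eq_of_polar P (f₀ := f₁.1) (α := 0) (x := 0) (x' := x₀) hy ?_ ?_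
    · rw [hf, P.rot_zero, P.tri_zero, one_mul, one_mul]
    · rw [← h₂0, hx₀, h₁0, P.rot_zero, one_mul]
  · refine frameClass_eq_of_polar P (f₀ := k₁ 1) (α := α₁) (x := b₁) (x' := b₂) hy ?_ ?_
    · rw [hf', ← h₁e, hb₁, ← Q.act_mul, mul_one]
    · rw [← h₂e, hb₂, hα]

end Transport

/-! ### Existence of transport -/

theorem det_ne_zero_of_linearIndependent {u w : EuclideanSpace ℝ (Fin 2)}
    (h : LinearIndependent ℝ ![u, w]) : u 0 * w 1 - u 1 * w 0 ≠ 0 := by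
  have hrows : LinearIndependent ℝ (Matrix.of ![u.ofLp, w.ofLp]).row := by
    have heq : (Matrix.of ![u.ofLp, w.ofLp]).row =
        WithLp.linearEquiv 2 ℝ (Fin 2 → ℝ) ∘ ![u, w] := by
      funext i
      fin_cases i <;> rfl
    rw [heq]
    exact h.map' (WithLp.linearEquiv 2 ℝ (Fin 2 → ℝ)).toLinearMap (LinearEquiv.ker _)
  have hdet := ((Matrix.isUnit_iff_isUnit_det _).mp
    (Matrix.linearIndependent_rows_iff_isUnit.mp hrows)).ne_zero
  rwa [Matrix.det_fin_two] at hdet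

theorem continuousAt_coeff_of_linearIndependent {T : Type*} [TopologicalSpace T]
    {a b w : T → EuclideanSpace ℝ (Fin 2)} {x y : T → ℝ} {t₀ : T} (ha : ContinuousAt a t₀)
    (hb : ContinuousAt b t₀) (hw : ContinuousAt w t₀)
    (hlin : ∀ᶠ t in 𝓝 t₀, LinearIndependent ℝ ![a t, b t])
    (h : ∀ᶠ t in 𝓝 t₀, w t = x t • a t + y t • b t) : ContinuousAt x t₀ := by
  have hcoord : ∀ {u : T → EuclideanSpace ℝ (Fin 2)} (i : Fin 2), ContinuousAt u t₀ →
      ContinuousAt (fun t => u t i) t₀ := fun i hu =>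
    (EuclideanSpace.proj (𝕜 := ℝ) i).continuous.continuousAt.comp hu
  have hcramer : ContinuousAt (fun t => (w t 0 * b t 1 - w t 1 * b t 0) /
      (a t 0 * b t 1 - a t 1 * b t 0)) t₀ :=
    (((hcoord 0 hw).mul (hcoord 1 hb)).sub ((hcoord 1 hw).mul (hcoord 0 hb))).div
      (((hcoord 0 ha).mul (hcoord 1 hb)).sub ((hcoord 1 ha).mul (hcoord 0 hb)))
      (det_ne_zero_of_linearIndependent hlin.self_of_nhds)
  refine hcramer.congr ?_
  filter_upwards [hlin, h] with t hli ht
  rw [div_eq_iff (det_ne_zero_of_linearIndependent hli), ht]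
  simp only [PiLp.add_apply, PiLp.smul_apply, smul_eq_mul]
  ring

theorem exists_continuous_hasAngle {z : unitInterval → ℂ} (hz : Continuous z)
    (h0 : ∀ t, z t ≠ 0) : ∃ A : unitInterval → ℝ, Continuous A ∧ ∀ t, HasAngle (z t) (A t) := by
  obtain ⟨w, hw, -⟩ := Complex.isCoveringMap_exp.exists_path_lifts
    ⟨fun t => (⟨z t, h0 t⟩ : {z : ℂ // z ≠ 0}), by fun_prop⟩ (Complex.log (z 0))
    (Subtype.ext (Complex.exp_log (h0 0)).symm)
  refine ⟨fun t => (w t).im, by fun_prop, fun t =>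
    ⟨Real.exp (w t).re, Real.exp_pos _, ?_⟩⟩
  have hexp : Complex.exp (w t) = z t := congrArg Subtype.val (congrFun hw t)
  rw [← hexp, Complex.ofReal_exp, ← Complex.exp_add, Complex.re_add_im]

section Surface

variable {S : Type b} [TopologicalSpace S] [ChartedSpace (EuclideanHalfSpace 2) S]
  [IsManifold (𝓡∂ 2) ∞ S]

theorem Frame.linearIndependent_trivialization (x : Frame S) {y : S} :
    letI : IsManifold (𝓡∂ 2) 1 S := isManifold_one
    let e := trivializationAt (EuclideanSpace ℝ (Fin 2)) (TangentSpace (𝓡∂ 2)) y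
    x.pt ∈ e.baseSet → LinearIndependent ℝ ![(e x.first).2, (e x.second).2] := by
  have : IsManifold (𝓡∂ 2) 1 S := isManifold_one
  intro e hx
  let L := e.continuousLinearEquivAt ℝ x.pt hx
  have heq : ![(e x.first).2, (e x.second).2] = L ∘ x.vec := by
    funext i
    fin_cases i <;> rfl
  rw [heq]
  exact x.linearIndependent.map' L.toLinearMap (LinearMap.ker_eq_bot.mpr L.injective)

theorem Frame.trivialization_comb (x : Frame S) (z : ℂ) {y : S} :
    letI : IsManifold (𝓡∂ 2) 1 S := isManifold_one
    let e := trivializationAt (EuclideanSpace ℝ (Fin 2)) (TangentSpace (𝓡∂ 2)) y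
    x.pt ∈ e.baseSet →
      (e ⟨x.pt, x.comb z⟩).2 = z.re • (e x.first).2 + z.im • (e x.second).2 := by
  have : IsManifold (𝓡∂ 2) 1 S := isManifold_one
  intro e hx
  have hL : ∀ w : TangentSpace (𝓡∂ 2) x.pt,
      (e ⟨x.pt, w⟩).2 = e.continuousLinearEquivAt ℝ x.pt hx w := fun w => rfl
  rw [hL, Frame.comb_apply, map_add, map_smul, map_smul]
  rfl

theorem continuous_coords {T : Type*} [TopologicalSpace T] {E : T → Frame S} {z : T → ℂ}
    (hE : Continuous E)
    (hz : letI : IsManifold (𝓡∂ 2) 1 S := isManifold_one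
      Continuous fun t => (⟨(E t).pt, (E t).comb (z t)⟩ : TangentBundle (𝓡∂ 2) S)) :
    Continuous z := by
  have : IsManifold (𝓡∂ 2) 1 S := isManifold_one
  refine continuous_iff_continuousAt.mpr fun t₀ => ?_
  have hfs : Continuous fun t => ((E t).first, (E t).second) :=
    Frame.continuous_first_second.comp hE
  have ha := ((FiberBundle.continuousAt_totalSpace _ _).mp
    ((continuous_fst.comp hfs).continuousAt (x := t₀))).2
  have hb := ((FiberBundle.continuousAt_totalSpace _ _).mp
    ((continuous_snd.comp hfs).continuousAt (x := t₀))).2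
  have hw := ((FiberBundle.continuousAt_totalSpace _ _).mp (hz.continuousAt (x := t₀))).2
  have hbase := (Frame.continuous_pt.comp hE).continuousAt.eventually
    ((trivializationAt (EuclideanSpace ℝ (Fin 2)) (TangentSpace (𝓡∂ 2))
      (E t₀).pt).open_baseSet.mem_nhds (FiberBundle.mem_baseSet_trivializationAt' _))
  have hlin := hbase.mono fun t => (E t).linearIndependent_trivialization
  have hcomb := hbase.mono fun t => (E t).trivialization_comb (z t)
  have hre := continuousAt_coeff_of_linearIndependent ha hb hw hlin hcomb
  have him := continuousAt_coeff_of_linearIndependent hb ha hw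
    (hlin.mono fun t => LinearIndependent.pair_symm_iff.mp)
    (hcomb.mono fun t ht => ht.trans (add_comm _ _))
  have heq : z = fun t => ((z t).re : ℂ) + (z t).im * Complex.I :=
    funext fun t => (Complex.re_add_im _).symm
  rw [heq]
  exact (Complex.continuous_ofReal.continuousAt.comp hre).add
    ((Complex.continuous_ofReal.continuousAt.comp him).mul continuousAt_const)

theorem IsImmersed.continuous_velocity {Γ : Graph.{d, e}} {γ : Γ.Realization → S}
    (hγ : IsImmersed γ) (h : Γ.H) : letI : IsManifold (𝓡∂ 2) 1 S := isManifold_one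
    Continuous fun t : unitInterval => velocity γ h t := by
  have : IsManifold (𝓡∂ 2) 1 S := isManifold_one
  have htangent := (hγ.contMDiffOn h).continuousOn_tangentMapWithin le_rfl
    (uniqueMDiffOn_iff_uniqueDiffOn.mpr (uniqueDiffOn_Icc (zero_lt_one (α := ℝ))))
  have hunit : Continuous fun t : unitInterval =>
      ((tangentBundleModelSpaceHomeomorph 𝓘(ℝ, ℝ)).symm ((t : ℝ), (1 : ℝ)) :
        TangentBundle 𝓘(ℝ, ℝ) ℝ) :=
    (tangentBundleModelSpaceHomeomorph 𝓘(ℝ, ℝ)).symm.continuous.comp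
      (continuous_subtype_val.prodMk continuous_const)
  exact htangent.comp_continuous hunit fun t => t.2

variable {𝔾 : Type a} [Group 𝔾] [TopologicalSpace 𝔾] {p : 𝔾 →* GL (Fin 2) ℝ}
  (Q : GStructure.{a, b, c} p S)

theorem GStructure.exists_lift_extend {y : unitInterval → S} (hy : Continuous y)
    {t₁ t₂ : unitInterval} (hle : t₁ ≤ t₂) {U : Set S} (s : Q.LocalSection U)
    (hU : ∀ t ∈ Set.Icc t₁ t₂, y t ∈ U) {k : unitInterval → Q.F} (hk : Continuous k)
    (hpt : ∀ t ≤ t₁, (Q.ρ (k t)).pt = y t) :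
    ∃ k' : unitInterval → Q.F, Continuous k' ∧ ∀ t ≤ t₂, (Q.ρ (k' t)).pt = y t := by
  let σ : unitInterval → Q.F := fun t =>
    s.σ ⟨y (Set.projIcc t₁ t₂ hle t), hU _ (Set.projIcc t₁ t₂ hle t).2⟩
  have hσ : Continuous σ := s.continuous_σ.comp
    ((hy.comp (continuous_subtype_val.comp continuous_projIcc)).subtype_mk _)
  have hσpt : ∀ t ∈ Set.Icc t₁ t₂, (Q.ρ (σ t)).pt = y t := fun t ht => by
    rw [s.pt_σ, Set.projIcc_of_mem hle ht]
  obtain ⟨x, hx⟩ := Q.exists_act_eq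
    ((hpt t₁ le_rfl).trans (hσpt t₁ (Set.left_mem_Icc.mpr hle)).symm)
  refine ⟨fun t => if t ≤ t₁ then k t else Q.act (σ t) x,
    hk.if_le (Q.continuous_act.comp (hσ.prodMk continuous_const)) continuous_id
      continuous_const fun t ht => by rwa [ht], fun t ht => ?_⟩
  dsimp only
  split_ifs with h
  · exact hpt t h
  · rw [Q.pt_act, hσpt t ⟨(not_le.mp h).le, ht⟩]

theorem GStructure.exists_path_lift {y : unitInterval → S} (hy : Continuous y) :
    ∃ k : unitInterval → Q.F, Continuous k ∧ ∀ t, (Q.ρ (k t)).pt = y t := by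
  choose U hU hmem s using fun t => Q.exists_localSection (y t)
  obtain ⟨τ, hτ₀, hτ, ⟨N, hN⟩, hτU⟩ := exists_monotone_Icc_subset_open_cover_unitInterval
    (fun t => (hU t).preimage hy) (fun t _ => Set.mem_iUnion.mpr ⟨t, hmem t⟩)
  have hlift : ∀ n, ∃ k : unitInterval → Q.F, Continuous k ∧
      ∀ t ≤ τ n, (Q.ρ (k t)).pt = y t := by
    intro n
    induction n with
    | zero =>
      obtain ⟨f, hf⟩ := Q.exists_pt_eq (y 0)
      refine ⟨fun _ => f, continuous_const, fun t ht => ?_⟩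
      rw [hτ₀] at ht
      rw [hf, le_antisymm ht unitInterval.nonneg']
    | succ n ih =>
      obtain ⟨k, hk, hpt⟩ := ih
      obtain ⟨i, hi⟩ := hτU n
      obtain ⟨s⟩ := s i
      exact Q.exists_lift_extend hy (hτ n.le_succ) s (fun t ht => hi ht) hk hpt
  obtain ⟨k, hk, hpt⟩ := hlift N
  rw [hN N le_rfl] at hpt
  exact ⟨k, hk, fun t => hpt t unitInterval.le_one'⟩

theorem PolarLift.hasAngle_rot (P : PolarLift p) (α : ℝ) : HasAngle (firstCol (p (P.rot α))) α := by
  rw [P.map_rot, firstCol_rotation]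
  exact ⟨1, one_pos, by simp⟩

theorem exists_lift_sameDirection (P : PolarLift p) {v : unitInterval → TangentBundle (𝓡∂ 2) S}
    (hv : letI : IsManifold (𝓡∂ 2) 1 S := isManifold_one; Continuous v)
    (hv0 : ∀ t, (v t).snd ≠ 0) :
    ∃ k : unitInterval → Q.F, Continuous k ∧ ∀ t, SameDirection (Q.ρ (k t)).first (v t) := by
  have : IsManifold (𝓡∂ 2) 1 S := isManifold_one
  obtain ⟨k, hk, hpt⟩ := Q.exists_path_lift ((FiberBundle.continuous_proj
    (EuclideanSpace ℝ (Fin 2)) (TangentSpace (𝓡∂ 2) : S → Type _)).comp hv)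
  choose z hz0 hz using fun t => (Q.ρ (k t)).exists_comb_eq (hpt t).symm (hv0 t)
  obtain rfl : v = _ := funext hz
  obtain ⟨A, hA, hzA⟩ :=
    exists_continuous_hasAngle (continuous_coords (Q.continuous_ρ.comp hk) hv) hz0
  refine ⟨fun t => Q.act (k t) (P.rot (A t)),
    Q.continuous_act.comp (hk.prodMk (P.continuous_rot.comp hA)), fun t => ?_⟩
  rw [Q.first_act, Frame.sameDirection_comb_iff _ (hzA t)]
  exact P.hasAngle_rot _

theorem PolarLift.not_hasAngle_pi_rot_mul (P : PolarLift p) {α : ℝ}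
    (hα : α ∈ Set.Ioo (-Real.pi) Real.pi) (t : unitInterval) :
    ¬ HasAngle (firstCol (p (P.rot (α * t)))) Real.pi := by
  have hlt : |α * t| < Real.pi := by
    rw [abs_mul, abs_of_nonneg t.2.1]
    exact (mul_le_of_le_one_right (abs_nonneg _) t.2.2).trans_lt (abs_lt.mpr hα)
  obtain ⟨hgt, hlt⟩ := abs_lt.mp hlt
  intro hpi
  have heq := (P.hasAngle_rot (α * t)).arg_eq ⟨hgt, hlt.le⟩
  rw [hpi.arg_eq ⟨by linarith [Real.pi_pos], le_rfl⟩] at heq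
  exact hlt.ne' heq

theorem exists_isTransport (P : PolarLift p) {Γ : Graph.{d, e}} {γ : Γ.Realization → S}
    (hγ : IsImmersed γ) (h : Γ.H) :
    ∃ (f : MarkedFrame Q γ (.vert (Γ.src h))) (f' : MarkedFrame Q γ (.edge (Γ.edgeOf h))),
      IsTransport h f f' := by
  obtain ⟨k, hk, hdir⟩ := exists_lift_sameDirection Q P (hγ.continuous_velocity h)
    (fun t => hγ.regular h t t.2)
  have hmid : SameDirection (Q.ρ (k 1)).first (velocity γ h 1) := hdir 1
  have hpt : (Q.ρ (k 1)).pt = γ (Γ.point (.edge (Γ.edgeOf h))) := by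
    rw [← halfEdgePath_one γ h]
    exact hmid.proj_eq
  let i : Γ.star (.edge (Γ.edgeOf h)) := ⟨Γ.τ h, Sym2.mem_mk_right _ _⟩
  let i₀ : Γ.star (.edge (Γ.edgeOf h)) := ⟨h, Sym2.mem_mk_left _ _⟩
  obtain ⟨z, hz0, hz⟩ := (Q.ρ (k 1)).exists_comb_eq (u := germ γ _ i)
    ((germ_proj γ _ i).trans hpt.symm) (hγ.germ_ne_zero _ i)
  have hend : SameDirection (Q.ρ (Q.act (k 1) (P.rot z.arg))).first (germ γ _ i) := by
    rw [hz, Q.first_act, Frame.sameDirection_comb_iff _ (hasAngle_arg hz0)]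
    exact P.hasAngle_rot _
  have hne : z.arg ≠ Real.pi := by
    intro hpi
    have hback := (sameDirection_act_neg_iff hmid (P.rot z.arg)).mpr (hpi ▸ P.hasAngle_rot z.arg)
    have hi : i = i₀ := hγ.distinct _ _ _ (hend.symm.trans hback)
    exact Γ.τ_ne h (congrArg Subtype.val hi)
  have harg : z.arg ∈ Set.Ioo (-Real.pi) Real.pi :=
    ⟨Complex.neg_pi_lt_arg z, lt_of_le_of_ne (Complex.arg_le_pi z) hne⟩
  have hrot := P.continuous_rot
  refine ⟨⟨k 0, ⟨h, rfl⟩, hdir 0⟩, ⟨_, i, hend⟩, k, fun t => Q.act (k 1) (P.rot (z.arg * t)), hk,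
    Q.continuous_act.comp (continuous_const.prodMk (by fun_prop)), rfl, hdir,
    by simp [P.rot_zero, Q.act_one], fun t => ⟨by rw [Q.pt_act, hpt], ?_⟩, by simp⟩
  exact fun hback => P.not_hasAngle_pi_rot_mul harg t
    ((sameDirection_act_neg_iff hmid _).mp hback)

end Surface

/-! ### Structures induced by a surface -/

theorem eqToHom_apply_eq_cast {A B : Type d} (h : A = B) (x : A) :
    (eqToHom h : A ⟶ B) x = cast h x := by
  subst h
  rfl

section Induced

variable {S : Type b} [TopologicalSpace S] [ChartedSpace (EuclideanHalfSpace 2) S]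
  [IsManifold (𝓡∂ 2) ∞ S] {𝔾 : Type a} [Group 𝔾] [TopologicalSpace 𝔾] [IsTopologicalGroup 𝔾]
  {p : 𝔾 →* GL (Fin 2) ℝ} {Q : GStructure.{a, b, c} p S} {Γ : Graph.{d, e}}
  {γ : Γ.Realization → S}

/-- The marked frame `f x`, for `x` in `p⁻¹(O(1))`. -/
def MarkedFrame.act {X : Γ.Cell} (f : MarkedFrame Q γ X) {ε : ℤˣ} {x : 𝔾}
    (hx : p x = reflection ε) : MarkedFrame Q γ X :=
  ⟨Q.act f.1 x, by
    obtain ⟨i, hi⟩ := f.2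
    refine ⟨i, SameDirection.trans ?_ hi⟩
    rw [Q.first_act, Frame.first_eq, Frame.sameDirection_comb_iff _ hasAngle_one, hx,
      ← one_mul (reflection ε), firstCol_mul_reflection, firstCol_one]
    exact hasAngle_one⟩

namespace CellFrame

variable {X : Γ.Cell} (D : CellFrame Q γ X) (P : PolarLift p)

theorem structuredSet_label_zero (f : MarkedFrame Q γ X) :
    SameDirection (Q.ρ f.1).first (germ γ X ((D.structuredSet P).label (frameClass f) 0)) := by
  obtain ⟨k, ε, y, hy, hk⟩ := D.exists_hasPolar P f
  have hlabel := D.structuredSet_label P hy hk 0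
  rw [Fin.val_zero, Nat.cast_zero, mul_zero, add_zero] at hlabel
  exact hlabel ▸ hk.sameDirection hy

theorem structuredSet_reflect {f f' : MarkedFrame Q γ X} {ε : ℤˣ} {x : 𝔾}
    (hx : p x = reflection ε) (hf : f'.1 = Q.act f.1 x) :
    (D.structuredSet P).act (frameClass f) (DeltaG.reflect _ ε x hx) = frameClass f' := by
  obtain ⟨k, ε', y, hy, hk⟩ := D.exists_hasPolar P f
  rw [DeltaG.reflect_eq_affine]
  refine D.structuredSet_act P hy hx hk ?_
  rw [mul_zero, add_zero]
  exact hk.act hf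

theorem structuredSet_rotate {f f' : MarkedFrame Q γ X} (h : IsNext f f') :
    (D.structuredSet P).act (frameClass f) (DeltaG.rotate p _) = frameClass f' := by
  obtain ⟨k, ε, y, hy, hk⟩ := D.exists_hasPolar P f
  rw [DeltaG.rotate_eq_affine]
  refine D.structuredSet_act P hy _ hk ?_
  rw [mul_one, mul_one]
  exact hk.of_isNext hy h

end CellFrame

theorem GraphStructure.len_eq (L : GraphStructure.{a, c, d, e} p Γ) {X : Γ.Cell}
    (D : CellFrame Q γ X) : (L.lift.obj X).len = D.len := by
  obtain ⟨o⟩ := (L.lift.obj X).frame_nonempty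
  have hcard := Fintype.card_congr
    ((((L.lift.obj X).label o).trans (Equiv.cast (L.carrier_eq X))).trans D.label.symm)
  simpa using hcard

namespace IsInduced

variable {L : GraphStructure.{a, c, d, e} p Γ}
  {β : ∀ X : Γ.Cell, (L.lift.obj X).Frame ≃ FrameClass Q γ X}

section Frames

variable {X : Γ.Cell} (hL : IsInduced Q γ L β) (D : CellFrame Q γ X) (P : PolarLift p)

include hL

theorem act_reflect (o : (L.lift.obj X).Frame) {ε : ℤˣ} {x : 𝔾} (hx : p x = reflection ε) :
    β X ((L.lift.obj X).act o (DeltaG.reflect _ ε x hx)) =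
      (D.structuredSet P).act (β X o) (DeltaG.reflect _ ε x hx) := by
  obtain ⟨f, hf⟩ := Quotient.exists_rep (β X o)
  rw [hL.reflect X o f (f.act hx) ε x hx hf.symm rfl, ← hf]
  exact (D.structuredSet_reflect P hx rfl).symm

theorem act_rotate (o : (L.lift.obj X).Frame) :
    β X ((L.lift.obj X).act o (DeltaG.rotate p _)) =
      (D.structuredSet P).act (β X o) (DeltaG.rotate p _) := by
  obtain ⟨f, hf⟩ := Quotient.exists_rep (β X o)
  obtain ⟨k, ε, y, hy, hk⟩ := D.exists_hasPolar P f
  have ho : β X o = frameClass (D.polarFrame P k hy 0) :=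
    hf.symm.trans (hk.frameClass_eq hy (D.hasPolar_polarFrame P k hy 0))
  have hnext := D.isNext_polarFrame P k hy
  rw [hL.rotate X o _ _ ho hnext, ho, D.structuredSet_rotate P hnext]

theorem act_affine (o : (L.lift.obj X).Frame) (m : ℤ) {ε : ℤˣ} {y : 𝔾}
    (hy : p y = reflection ε) :
    β X ((L.lift.obj X).act o (DeltaG.affine _ m ε y hy)) =
      (D.structuredSet P).act (β X o) (DeltaG.affine _ m ε y hy) :=
  StructuredSet.map_act_affine (Y := D.structuredSet P)
    (fun o _ _ hx => hL.act_reflect D P o hx) (hL.act_rotate D P) o m hy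

theorem label_eq (hγ : IsImmersed γ) (o : (L.lift.obj X).Frame)
    (i : Fin ((L.lift.obj X).len + 1)) :
    cast (L.carrier_eq X) ((L.lift.obj X).label o i) =
      (D.structuredSet P).label (β X o) (Fin.cast (congrArg (· + 1) (L.len_eq D)) i) := by
  have hβ := hL.act_affine D P o (i : ℕ) (map_one_eq_reflection p)
  obtain ⟨f, hf⟩ := Quotient.exists_rep
    (β X ((L.lift.obj X).act o (DeltaG.affine _ (i : ℕ) 1 1 (map_one_eq_reflection p))))
  have hzero := hL.label_zero X _ f hf.symm
  have hzero' := D.structuredSet_label_zero P f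
  rw [StructuredSet.label_act_affine] at hzero
  rw [show frameClass f = _ from hf.trans hβ] at hzero'
  exact (hγ.distinct _ _ _ (hzero.symm.trans hzero')).trans
    ((D.structuredSet P).label_act_affine (β X o) (Fin.cast (congrArg (· + 1) (L.len_eq D)) i))

end Frames

variable {L' : GraphStructure.{a, c, d, e} p Γ}
  {β' : ∀ X : Γ.Cell, (L'.lift.obj X).Frame ≃ FrameClass Q γ X}

theorem exists_iso_comps_eq (hL : IsInduced Q γ L β) (hL' : IsInduced Q γ L' β')
    {X : Γ.Cell} (D : CellFrame Q γ X) (P : PolarLift p) :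
    ∃ (hn : (L.lift.obj X).len = (L'.lift.obj X).len) (η : L.lift.obj X ≅ L'.lift.obj X),
      ∀ o o', β X o = β' X o' →
        StructuredSet.comps η.hom o' o = eqToHom (congrArg DeltaG.mk hn) := by
  have hn : (L.lift.obj X).len = (L'.lift.obj X).len := (L.len_eq D).trans (L'.len_eq D).symm
  obtain ⟨o₀⟩ := (L.lift.obj X).frame_nonempty
  set o₀' := (β' X).symm (β X o₀) with ho₀'
  refine ⟨hn, StructuredSet.isoOfFrames (congrArg DeltaG.mk hn) o₀' o₀, fun o o' h => ?_⟩
  obtain ⟨m, ε, y, hy, hm⟩ := DeltaG.exists_eq_affine ((L.lift.obj X).diff o₀ o)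
  have ho : (L.lift.obj X).act o₀ (DeltaG.affine _ m ε y hy) = o := by
    rw [← hm, (L.lift.obj X).act_diff]
  have ho' : (L'.lift.obj X).act o₀' (DeltaG.affine _ m ε y hy) = o' := by
    apply (β' X).injective
    rw [hL'.act_affine D P, ← h, ← ho, hL.act_affine D P, ho₀', Equiv.apply_symm_apply]
  rw [← ho, ← ho', StructuredSet.comps_act]
  change _ ≫ StructuredSet.comps (StructuredSet.homOfComp _ _ _) _ _ ≫ _ = _
  rw [StructuredSet.comps_homOfComp]
  exact DeltaG.affine_hom_comp_eqToHom hn m hy _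

theorem under_eq_cast (hγ : IsImmersed γ) (hL : IsInduced Q γ L β) (hL' : IsInduced Q γ L' β')
    {X : Γ.Cell} (D : CellFrame Q γ X) (P : PolarLift p)
    (hn : (L.lift.obj X).len = (L'.lift.obj X).len) {η : L.lift.obj X ⟶ L'.lift.obj X}
    (hη : ∀ o o', β X o = β' X o' →
      StructuredSet.comps η o' o = eqToHom (congrArg DeltaG.mk hn))
    (q' : (L'.lift.obj X).Frame) (q : (L.lift.obj X).Frame) (i : (L.lift.obj X).carrier) :
    StructuredSet.under η q' q i = cast ((L.carrier_eq X).trans (L'.carrier_eq X).symm) i := by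
  obtain ⟨j, rfl⟩ := ((L.lift.obj X).label q).surjective i
  have hq : β' X ((β' X).symm (β X q)) = β X q := (β' X).apply_symm_apply _
  rw [StructuredSet.under_indep _ _ ((β' X).symm (β X q)) _ q, StructuredSet.under,
    hη _ _ hq.symm, DeltaG.vertexMap_eqToHom hn, Equiv.symm_apply_apply]
  apply (cast_bijective (L'.carrier_eq X)).injective
  rw [cast_cast, hL.label_eq D P hγ, hL'.label_eq D P hγ, hq]
  rfl

theorem map_inc_comp_hom (hγ : IsImmersed γ) (P : PolarLift p) (hL : IsInduced Q γ L β)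
    (hL' : IsInduced Q γ L' β') (hn : ∀ X, (L.lift.obj X).len = (L'.lift.obj X).len)
    {η : ∀ X, L.lift.obj X ⟶ L'.lift.obj X}
    (hη : ∀ X o o', β X o = β' X o' →
      StructuredSet.comps (η X) o' o = eqToHom (congrArg DeltaG.mk (hn X))) (h : Γ.H) :
    L.lift.map (Γ.inc h) ≫ η _ = η _ ≫ L'.lift.map (Γ.inc h) := by
  obtain ⟨f, f', hff⟩ := exists_isTransport Q P hγ h
  have ho := (β (.vert (Γ.src h))).apply_symm_apply (frameClass f)
  have ho' := (β (.edge (Γ.edgeOf h))).apply_symm_apply (frameClass f')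
  have hq := (β' (.vert (Γ.src h))).apply_symm_apply (frameClass f)
  have hq' := (β' (.edge (Γ.edgeOf h))).apply_symm_apply (frameClass f')
  refine StructuredSet.hom_ext_comp ((β' _).symm (frameClass f')) ((β _).symm (frameClass f)) ?_
  rw [StructuredSet.comps_comp _ _ _ ((β _).symm (frameClass f')),
    StructuredSet.comps_comp _ _ _ ((β' _).symm (frameClass f)),
    hη _ _ _ (ho'.trans hq'.symm), hη _ _ _ (ho.trans hq.symm),
    hL.transport h _ _ f f' ho ho' hff, hL'.transport h _ _ f f' hq hq' hff]
  exact DeltaG.collapse_comp_eqToHom (hn _) (hn _) _ _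

theorem existsUnique_isCanonicalIso (hγ : IsImmersed γ) (D : ∀ X, CellFrame Q γ X)
    (P : PolarLift p) (hL : IsInduced Q γ L β) (hL' : IsInduced Q γ L' β') :
    ∃! η : L.lift ≅ L'.lift, IsCanonicalIso β β' η := by
  choose hn η hη using fun X => exists_iso_comps_eq hL hL' (D X) P
  have hnat : ∀ {X Y : Γ.Cell} (u : Γ.CellHom X Y),
      L.lift.map (X := X) (Y := Y) u ≫ (η Y).hom =
        (η X).hom ≫ L'.lift.map (X := X) (Y := Y) u := by
    intro X Y u
    cases u with
    | id =>
      change L.lift.map (𝟙 X) ≫ _ = _ ≫ L'.lift.map (𝟙 X)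
      rw [L.lift.map_id, L'.lift.map_id, Category.id_comp, Category.comp_id]
    | inc h => exact hL.map_inc_comp_hom hγ P hL' hn hη h
  refine ⟨NatIso.ofComponents η hnat, ⟨?_, fun X o o' h => ⟨hn X, hη X o o' h⟩⟩, ?_⟩
  · refine NatTrans.ext (funext fun X => ?_)
    rw [eqToHom_app]
    ext i
    exact (under_eq_cast hγ hL hL' (D X) P (hn X) (hη X) _ _ i).trans
      (eqToHom_apply_eq_cast _ i).symm
  · intro η' hη'
    ext X : 3
    obtain ⟨o⟩ := (L.lift.obj X).frame_nonempty
    have ho : β X o = β' X ((β' X).symm (β X o)) := ((β' X).apply_symm_apply _).symm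
    refine StructuredSet.hom_ext_comp ((β' X).symm (β X o)) o ?_
    obtain ⟨_, hcomps⟩ := hη'.frames X _ _ ho
    exact hcomps.trans (hη X _ _ ho).symm

end IsInduced

end Induced

/-! ### The canonical structure -/

section Canonical

variable {Γ : Graph.{d, e}}

theorem Graph.star_edgeOf_eq (h : Γ.H) : {h' : Γ.H | h' ∈ (Γ.edgeOf h).1} = {h, Γ.τ h} :=
  Set.ext fun _ => Sym2.mem_iff

theorem Graph.finite_star (hfin : ∀ v, Finite {h : Γ.H // Γ.src h = v}) :
    ∀ X : Γ.Cell, Finite (Γ.star X)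
  | .vert v => hfin v
  | .edge ⟨_, h, rfl⟩ => by
    have hpair := Set.toFinite {h, Γ.τ h}
    rw [← Γ.star_edgeOf_eq] at hpair
    exact hpair

theorem Graph.nonempty_star (hne : ∀ v, Nonempty {h : Γ.H // Γ.src h = v}) :
    ∀ X : Γ.Cell, Nonempty (Γ.star X)
  | .vert v => hne v
  | .edge ⟨_, h, rfl⟩ => ⟨⟨h, Sym2.mem_mk_left _ _⟩⟩

theorem Graph.card_star_edgeOf (h : Γ.H) : Nat.card (Γ.star (.edge (Γ.edgeOf h))) = 2 := by
  rw [← Set.ncard_pair (Γ.τ_ne h).symm, ← Γ.star_edgeOf_eq]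
  rfl

variable {S : Type b} [TopologicalSpace S] [ChartedSpace (EuclideanHalfSpace 2) S]
  [IsManifold (𝓡∂ 2) ∞ S] {𝔾 : Type a} [Group 𝔾] [TopologicalSpace 𝔾]
  {p : 𝔾 →* GL (Fin 2) ℝ} {Q : GStructure.{a, b, c} p S} {γ : Γ.Realization → S}

theorem CellFrame.len_edgeOf {h : Γ.H} (D : CellFrame Q γ (.edge (Γ.edgeOf h))) : D.len = 1 := by
  have hcard := Nat.card_congr D.label
  rw [Graph.card_star_edgeOf, Nat.card_fin] at hcard
  omega

variable [IsTopologicalGroup 𝔾] (D : ∀ X : Γ.Cell, CellFrame Q γ X) (P : PolarLift p)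

section Lift

variable (o : ∀ h : Γ.H, FrameClass Q γ (.vert (Γ.src h)))
  (o' : ∀ h : Γ.H, FrameClass Q γ (.edge (Γ.edgeOf h)))

/-- The lift of the incidence diagram on morphisms: the component of the morphism of `h` in the
frames `o' h` and `o h` is `0 ↦ 0`, `i ↦ 1` (`i > 0`). -/
def liftMap : ∀ {X Y : Γ.Cell}, Γ.CellHom X Y →
    ((D X).structuredSet P ⟶ (D Y).structuredSet P)
  | _, _, .id _ => 𝟙 _
  | _, _, .inc h => StructuredSet.homOfComp (o' h) (o h) (DeltaG.collapse p _ _)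

theorem liftMap_comp {X Y Z : Γ.Cell} (u : Γ.CellHom X Y) (v : Γ.CellHom Y Z) :
    liftMap D P o o' (u.comp v) = liftMap D P o o' u ≫ liftMap D P o o' v := by
  cases u with
  | id => exact (Category.id_comp _).symm
  | inc h =>
    cases v
    exact (Category.comp_id _).symm

/-- The lift of the incidence diagram determined by frames `o h` and `o' h` at the two ends of each
half-edge `h`. -/
def liftFunctor : Γ.Cell ⥤ StructuredSet.{a, d, c} p where
  obj X := (D X).structuredSet P
  map u := liftMap D P o o' u
  map_id _ := rfl
  map_comp u v := liftMap_comp D P o o' u v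

end Lift

theorem CellFrame.structuredSet_label_zero_eq (hγ : IsImmersed γ) {X : Γ.Cell}
    (D : CellFrame Q γ X) {f : MarkedFrame Q γ X} {i : Γ.star X}
    (hi : SameDirection (Q.ρ f.1).first (germ γ X i)) :
    (D.structuredSet P).label (frameClass f) 0 = i :=
  hγ.distinct _ _ _ ((D.structuredSet_label_zero P f).symm.trans hi)

theorem CellFrame.structuredSet_label_last_eq (hγ : IsImmersed γ) {h : Γ.H}
    (D : CellFrame Q γ (.edge (Γ.edgeOf h))) {f : MarkedFrame Q γ (.edge (Γ.edgeOf h))}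
    (hf : SameDirection (Q.ρ f.1).first (midpointGerm γ (Γ.τ h))) :
    (D.structuredSet P).label (frameClass f) (Fin.last _) =
      (⟨h, Sym2.mem_mk_left _ _⟩ : {h' : Γ.H // h' ∈ (Γ.edgeOf h).1}) := by
  have hzero := D.structuredSet_label_zero_eq P hγ
    (i := (⟨Γ.τ h, Sym2.mem_mk_right _ _⟩ : {h' : Γ.H // h' ∈ (Γ.edgeOf h).1})) hf
  have hlast : Fin.last (D.structuredSet P).len ≠ 0 := by
    rw [Ne, Fin.ext_iff, Fin.val_last, Fin.val_zero]
    exact D.len_edgeOf.trans_ne one_ne_zero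
  have hmem := ((D.structuredSet P).label (frameClass f) (Fin.last _)).2
  refine Subtype.ext ((Sym2.mem_iff.mp hmem).resolve_right fun hτ => hlast ?_)
  exact ((D.structuredSet P).label (frameClass f)).injective ((Subtype.ext hτ).trans hzero.symm)

variable {f : ∀ h : Γ.H, MarkedFrame Q γ (.vert (Γ.src h))}
  {f' : ∀ h : Γ.H, MarkedFrame Q γ (.edge (Γ.edgeOf h))}

theorem under_liftMap (hγ : IsImmersed γ) (ht : ∀ h, IsTransport h (f h) (f' h)) {X Y : Γ.Cell}
    (u : Γ.CellHom X Y) (q' : ((D Y).structuredSet P).Frame)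
    (q : ((D X).structuredSet P).Frame) (i : Γ.star X) :
    StructuredSet.under (liftMap D P (fun h => frameClass (f h)) (fun h => frameClass (f' h)) u)
      q' q i = u.onStar i := by
  cases u with
  | id => exact StructuredSet.under_id _ q' q i
  | inc h =>
    have hzero := (D (.vert (Γ.src h))).structuredSet_label_zero_eq P hγ
      (i := (⟨h, rfl⟩ : {h' : Γ.H // Γ.src h' = Γ.src h})) (ht h).sameDirection_fst
    have hzero' := (D (.edge (Γ.edgeOf h))).structuredSet_label_zero_eq P hγ
      (i := (⟨Γ.τ h, Sym2.mem_mk_right _ _⟩ : {h' : Γ.H // h' ∈ (Γ.edgeOf h).1}))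
      (ht h).sameDirection_snd
    have hlast := (D (.edge (Γ.edgeOf h))).structuredSet_label_last_eq P hγ
      (ht h).sameDirection_snd
    by_cases hi : i.1 = h
    · exact (StructuredSet.under_collapse_of_eq _ _ q' q
        ((Subtype.ext hi).trans hzero.symm)).trans (hzero'.trans (if_pos hi).symm)
    · exact (StructuredSet.under_collapse_of_ne _ _ q' q
        fun hi' => hi (congrArg Subtype.val (hi'.trans hzero))).trans
          (hlast.trans (if_neg hi).symm)

include D P in
theorem exists_isInduced (hγ : IsImmersed γ) :
    ∃ (L : GraphStructure.{a, c, d, e} p Γ)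
      (β : ∀ X : Γ.Cell, (L.lift.obj X).Frame ≃ FrameClass Q γ X), IsInduced Q γ L β := by
  choose f f' ht using fun h => exists_isTransport Q P hγ h
  refine ⟨⟨liftFunctor D P (fun h => frameClass (f h)) (fun h => frameClass (f' h)), ?_⟩,
    fun X => Equiv.refl _, ?_, ?_, ?_, ?_⟩
  · refine CategoryTheory.Functor.ext (fun X => rfl) fun X Y u => ?_
    ext i
    exact under_liftMap D P hγ ht u _ _ i
  · rintro X _ g rfl
    exact (D X).structuredSet_label_zero P g
  · rintro X _ g g' ε x hx rfl hg
    exact (D X).structuredSet_reflect P hx hg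
  · rintro X _ g g' rfl hg
    exact (D X).structuredSet_rotate P hg
  · rintro h _ _ g g' rfl rfl hg
    obtain ⟨ε, x, hx, heq, heq'⟩ := (ht h).unique P hg
    have hact := (D (.vert (Γ.src h))).structuredSet_reflect P hx (f' := (f h).act hx) rfl
    have hact' := (D (.edge (Γ.edgeOf h))).structuredSet_reflect P hx (f' := (f' h).act hx) rfl
    rw [heq ((f h).act hx) rfl] at hact
    rw [heq' ((f' h).act hx) rfl] at hact'
    exact StructuredSet.comps_collapse_of_act_reflect (D _).len_edgeOf hx hact' hact

end Canonical

end

end PlanarGraph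

theorem mainTheorem5_general {𝔾 : Type*} [Group 𝔾] [TopologicalSpace 𝔾] [IsTopologicalGroup 𝔾]
    (p : 𝔾 →* GL (Fin 2) ℝ) (hp : IsCoveringMap p)
    {S : Type*} [TopologicalSpace S] [ChartedSpace (EuclideanHalfSpace 2) S]
    [IsManifold (𝓡∂ 2) ∞ S] (Q : GStructure p S) (Γ : Graph)
    (hfin : ∀ v, Finite {h : Γ.H // Γ.src h = v}) (hne : ∀ v, Nonempty {h : Γ.H // Γ.src h = v})
    (γ : Γ.Realization → S) (hγ : IsImmersed γ) :
    ∃ (L : GraphStructure p Γ) (β : ∀ X : Γ.Cell, (L.lift.obj X).Frame ≃ FrameClass Q γ X),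
      IsInduced Q γ L β ∧
      ∀ (L' : GraphStructure p Γ)
        (β' : ∀ X : Γ.Cell, (L'.lift.obj X).Frame ≃ FrameClass Q γ X),
        IsInduced Q γ L' β' → ∃! η : L.lift ≅ L'.lift, IsCanonicalIso β β' η := by
  obtain ⟨P⟩ := exists_polarLift p hp
  have hD : ∀ X : Γ.Cell, Nonempty (CellFrame Q γ X) := fun X =>
    haveI := Graph.finite_star hfin X
    haveI := Graph.nonempty_star hne X
    exists_cellFrame Q hγ X
  obtain ⟨D⟩ := Classical.nonempty_pi.mpr hD
  obtain ⟨L, β, hL⟩ := exists_isInduced D P hγ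
  exact ⟨L, β, hL, fun L' β' hL' => hL.existsUnique_isCanonicalIso hγ D P hL'⟩

theorem mainTheorem5 {𝔾 : Type*} [Group 𝔾] [TopologicalSpace 𝔾] [IsTopologicalGroup 𝔾]
    (p : 𝔾 →* GL (Fin 2) ℝ) (hp : IsConnectiveCovering p)
    {S : Type*} [TopologicalSpace S] [T2Space S] [SecondCountableTopology S] [ConnectedSpace S]
    [ChartedSpace (EuclideanHalfSpace 2) S] [IsManifold (𝓡∂ 2) ∞ S] (Q : GStructure p S)
    (Γ : Graph) (hfin : ∀ v, Finite {h : Γ.H // Γ.src h = v})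
    (hne : ∀ v, Nonempty {h : Γ.H // Γ.src h = v})
    (γ : Γ.Realization → S) (hγ : IsEmbedded γ) :
    ∃ (L : GraphStructure p Γ) (β : ∀ X : Γ.Cell, (L.lift.obj X).Frame ≃ FrameClass Q γ X),
      IsInduced Q γ L β ∧
      ∀ (L' : GraphStructure p Γ)
        (β' : ∀ X : Γ.Cell, (L'.lift.obj X).Frame ≃ FrameClass Q γ X),
        IsInduced Q γ L' β' → ∃! η : L.lift ≅ L'.lift, IsCanonicalIso β β' η :=
  mainTheorem5_general p hp.isCoveringMap Q Γ hfin hne γ hγ.isImmersed
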